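/- Let $m,c_1,c_2,k>0$ and $0<\alpha_1<\alpha_2<1$. For a locally absolutely continuous function $x$ on $[0,\infty)$ and $0<\alpha<1$ let $D^{\alpha}x(t)=\frac{1}{\Gamma(1-\alpha)}\int_0^t\frac{\dot x(\tau)}{(t-\tau)^{\alpha}}\,d\tau$ be the Caputo derivative with lower terminal $0$, and let $\mu_\beta(\omega)=\frac{\sin(\beta\pi)}{\pi}\omega^{-\beta}$. Let $f$ be the external force and $u$ the control. First order (integer order) equations for locally absolutely continuous states are understood for almost every $t>0$, fractional ones for every $t>0$ (with absolutely convergent integrals). **State equation.** Functions $x_1,\dots,x_4$ are said to solve the state equation $$D^{\alpha_1}x_1=x_2,\quad D^{\alpha_2-\alpha_1}x_2=x_3,\quad D^{1-\alpha_2}x_3=x_4,\quad \dot x_4=-\tfrac km x_1-\tfrac{c_1}m x_2-\tfrac{c_2}m x_3+\tfrac fm+\tfrac um \qquad (\mathrm S)$$ if they are locally absolutely continuous on $[0,\infty)$, satisfy (S), and $x_2(0)=x_3(0)=0$ (the values $x_1(0),x_4(0)$ being arbitrary). The *sliding dynamics* is (S) without the terms $f/m+u/m$. The *sliding variable* is $$s(t)=x_4+\tfrac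 km\int_0^t x_1\,d\tau+\tfrac{c_1}m\int_0^t x_2\,d\tau+\tfrac{c_2}m\int_0^t x_3\,d\tau .$$ The following hold. 1. $(x_1,\dots,x_4)$ solves (S) if and only if $x=x_1$ is $C^1$ on $[0,\infty)$ with locally absolutely continuous $\dot x$ and satisfies $m\ddot x+c_1D^{\alpha_1}x+c_2D^{\alpha_2}x+kx=f+u$ almost everywhere, and $x_2=D^{\alpha_1}x$, $x_3=D^{\alpha_2}x$, $x_4=\dot x$ on $[0,\infty)$. 2. For every solution of (S), $\dot s=(f+u)/m$ almost everywhere on $(0,\infty)$; and $s$ is constant on $[0,\infty)$ if and only if $(x_1,\dots,x_4)$ solves the sliding dynamics. 3. Let $T\ge 0$ and suppose that a solution of (S) has $s$ constant on $[T,\infty)$ (for $T=0$: any solution of the sliding dynamics). There exist diffusive states, i.e. functions $z(\omega,t)$ with $\partial_t z=-\omega z+\dot x_1$ on $[0,\infty)$ and $z(\omega,0)=0$ for all $\omega>0$, and for any two of them, $z_1,z_2$, we have for all $t\ge0$ $$x_2(t)=\int_0^\infty\mu_{1-\alpha_1}(\omega)z_1(\omega,t)\,d\omega,\qquad x_3(t)=\int_0^\infty\mu_{1-\alpha_2}(\omega)z_2(\omega,t)\,d\omega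 ,$$ these integrals and those below converging absolutely. The energy $$V_3=\tfrac12kx_1^2+\tfrac{c_1}2\int_0^\infty\mu_{1-\alpha_1}z_1^2\,d\omega+\tfrac{c_2}2\int_0^\infty\mu_{1-\alpha_2}z_2^2\,d\omega+\tfrac12mx_4^2$$ is differentiable at every $t>T$, with $$\dot V_3=-c_1\int_0^\infty\omega\mu_{1-\alpha_1}z_1^2\,d\omega-c_2\int_0^\infty\omega\mu_{1-\alpha_2}z_2^2\,d\omega\le 0,$$ and $\dot V_3(t)<0$ unless $x_1,\dots,x_4$ all vanish identically on $[0,t]$. 4. The sliding dynamics is stable: for every $\varepsilon>0$ there is $\delta>0$ such that every solution of it with $|x_1(0)|<\delta$ and $|x_4(0)|<\delta$ (and $x_2(0)=x_3(0)=0$) satisfies $|x_i(t)|<\varepsilon$ for all $t\ge0$ and $i=1,\dots,4$. 5. (Known force bound.) Let $|f(t)|\le F$ for all $t\ge 0$ and let $\rho_1,\rho_2>0$. For every solution of (S) under the switching law $u=-\bigl(F+\frac{\rho_1}{\sqrt2}\bigr)\operatorname{sign}(s)-\rho_2 s$, understood in the sense of Filippov (for almost every $t>0$, with $\operatorname{sign}(0)$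 replaced by some value in $[-1,1]$), the function $V_4=\frac12s^2$ satisfies $\dot V_4\le-\frac{\rho_1}m\sqrt{V_4}-\frac{2\rho_2}mV_4$ almost everywhere on $(0,\infty)$, and $s(t)\to0$ and $x_1(t)\to0$ as $t\to\infty$. 6. (Unknown force bound.) Let $f$ be bounded on $[0,\infty)$ and let $\rho_1,\rho_2,\mu>0$. For every solution of (S) under $u=-\bigl(\hat F+\frac{\rho_1}{\sqrt2}\bigr)\operatorname{sign}(s)-\rho_2s$ (in the sense of Filippov) with the adaptive law $\dot{\hat F}=\frac\mu m|s|$, $\hat F(0)$ arbitrary, one has $s(t)\to0$ and $x_1(t)\to0$ as $t\to\infty$. -/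

import Mathlib

open Set MeasureTheory Filter Topology

noncomputable section

namespace FracOsc

/-- Local absolute continuity on the half-line `[0, ∞)`. -/
def LocAC (f : ℝ → ℝ) : Prop :=
  ∀ T : ℝ, 0 < T → AbsolutelyContinuousOnInterval f 0 T

/-- Integrand of the Caputo derivative of order `α ∈ (0, 1)` at time `t`. -/
def caputoIntegrand (α : ℝ) (f : ℝ → ℝ) (t τ : ℝ) : ℝ :=
  deriv f τ / (t - τ) ^ α

/-- Caputo derivative of order `α ∈ (0, 1)` with lower terminal `0`. -/
def caputo (α : ℝ) (f : ℝ → ℝ) (t : ℝ) : ℝ :=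
  1 / Real.Gamma (1 - α) * ∫ τ in (0 : ℝ)..t, caputoIntegrand α f t τ

/-- The fractional equation `D^α f = g` on `(0, ∞)`, for a locally absolutely continuous `f`;
the defining integral is required to converge absolutely at every `t > 0`. -/
structure CaputoEq (α : ℝ) (f g : ℝ → ℝ) : Prop where
  locAC : LocAC f
  integrable : ∀ t : ℝ, 0 < t → IntervalIntegrable (caputoIntegrand α f t) volume 0 t
  eq : ∀ t : ℝ, 0 < t → caputo α f t = g t

/-- The velocity of a motion given for `t ≥ 0` (one-sided derivative at `t = 0`). -/
def velocity (x : ℝ → ℝ) : ℝ → ℝ := derivWithin x (Ici 0)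

/-- `x` is a motion of the modified Kelvin-Voigt oscillator
`m x'' + c₁ D^{α₁} x + c₂ D^{α₂} x + k x = f + u` on `[0, ∞)`: it is continuously differentiable
with locally absolutely continuous velocity and the equation holds almost everywhere. -/
structure IsMotion (m c₁ c₂ k α₁ α₂ : ℝ) (f u x : ℝ → ℝ) : Prop where
  contDiffOn : ContDiffOn ℝ 1 x (Ici 0)
  locAC_velocity : LocAC (velocity x)
  eq : ∀ᵐ t ∂(volume.restrict (Ioi (0 : ℝ))),
    m * deriv (velocity x) t + c₁ * caputo α₁ x t + c₂ * caputo α₂ x t + k * x t = f t + u t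

/-- The three fractional equations shared by the controlled state equation and by the sliding
dynamics. The fractional states vanish initially, `x₁ 0` and `x₄ 0` are arbitrary. -/
structure FractionalPart (α₁ α₂ : ℝ) (x₁ x₂ x₃ x₄ : ℝ → ℝ) : Prop where
  eq₁ : CaputoEq α₁ x₁ x₂
  eq₂ : CaputoEq (α₂ - α₁) x₂ x₃
  eq₃ : CaputoEq (1 - α₂) x₃ x₄
  locAC₄ : LocAC x₄
  init₂ : x₂ 0 = 0
  init₃ : x₃ 0 = 0

/-- Trajectories of the controlled four-dimensional non-commensurate state equation. -/
structure IsStateTrajectory (m c₁ c₂ k α₁ α₂ : ℝ) (f u x₁ x₂ x₃ x₄ : ℝ → ℝ) : Prop where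
  frac : FractionalPart α₁ α₂ x₁ x₂ x₃ x₄
  eq₄ : ∀ᵐ t ∂(volume.restrict (Ioi (0 : ℝ))),
    deriv x₄ t = -(k / m) * x₁ t - c₁ / m * x₂ t - c₂ / m * x₃ t + f t / m + u t / m

/-- Trajectories of the sliding mode dynamics. -/
structure IsSlidingTrajectory (m c₁ c₂ k α₁ α₂ : ℝ) (x₁ x₂ x₃ x₄ : ℝ → ℝ) : Prop where
  frac : FractionalPart α₁ α₂ x₁ x₂ x₃ x₄
  eq₄ : ∀ᵐ t ∂(volume.restrict (Ioi (0 : ℝ))),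
    deriv x₄ t = -(k / m) * x₁ t - c₁ / m * x₂ t - c₂ / m * x₃ t

/-- The fractional sliding variable `s`. -/
def slidingVar (m c₁ c₂ k : ℝ) (x₁ x₂ x₃ x₄ : ℝ → ℝ) (t : ℝ) : ℝ :=
  x₄ t + k / m * (∫ τ in (0 : ℝ)..t, x₁ τ) + c₁ / m * (∫ τ in (0 : ℝ)..t, x₂ τ)
    + c₂ / m * (∫ τ in (0 : ℝ)..t, x₃ τ)

/-- The weight `μ_β(ω) = sin(βπ)/π · ω^{-β}` of the frequency distributed model. -/
def freqWeight (β ω : ℝ) : ℝ := Real.sin (β * Real.pi) / Real.pi * ω ^ (-β)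

/-- `z ω t` is the diffusive state driven by the input `v`: for every frequency `ω > 0`,
`∂z/∂t = -ω z + v` on `[0, ∞)` and `z = 0` at `t = 0`. -/
def IsDiffusiveState (v : ℝ → ℝ) (z : ℝ → ℝ → ℝ) : Prop :=
  ∀ ω : ℝ, 0 < ω → z ω 0 = 0 ∧
    ∀ t : ℝ, 0 ≤ t → HasDerivWithinAt (z ω) (-ω * z ω t + v t) (Ici 0) t

/-- The energy functional with two diffusive states. -/
def energy (m c₁ c₂ k α₁ α₂ : ℝ) (x₁ x₄ : ℝ → ℝ) (z₁ z₂ : ℝ → ℝ → ℝ) (t : ℝ) : ℝ :=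
  1 / 2 * k * x₁ t ^ 2
    + c₁ / 2 * (∫ ω in Ioi (0 : ℝ), freqWeight (1 - α₁) ω * z₁ ω t ^ 2)
    + c₂ / 2 * (∫ ω in Ioi (0 : ℝ), freqWeight (1 - α₂) ω * z₂ ω t ^ 2)
    + 1 / 2 * m * x₄ t ^ 2

/-- The dissipation `c₁ ∫ ω μ_{1-α₁} z₁² + c₂ ∫ ω μ_{1-α₂} z₂²`. -/
def dissipation (c₁ c₂ α₁ α₂ : ℝ) (z₁ z₂ : ℝ → ℝ → ℝ) (t : ℝ) : ℝ :=
  c₁ * (∫ ω in Ioi (0 : ℝ), ω * freqWeight (1 - α₁) ω * z₁ ω t ^ 2)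
    + c₂ * (∫ ω in Ioi (0 : ℝ), ω * freqWeight (1 - α₂) ω * z₂ ω t ^ 2)

/-- Lyapunov stability of the zero state of the sliding mode dynamics. -/
def SlidingStable (m c₁ c₂ k α₁ α₂ : ℝ) : Prop :=
  ∀ ε : ℝ, 0 < ε → ∃ δ : ℝ, 0 < δ ∧ ∀ x₁ x₂ x₃ x₄ : ℝ → ℝ,
    IsSlidingTrajectory m c₁ c₂ k α₁ α₂ x₁ x₂ x₃ x₄ → |x₁ 0| < δ → |x₄ 0| < δ →
    ∀ t : ℝ, 0 ≤ t → |x₁ t| < ε ∧ |x₂ t| < ε ∧ |x₃ t| < ε ∧ |x₄ t| < ε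

/-- The sign function, with the Filippov value `[-1, 1]` at the discontinuity `0`. -/
def signSet (r : ℝ) : Set ℝ :=
  {σ | σ ∈ Icc (-1 : ℝ) 1 ∧ (0 < r → σ = 1) ∧ (r < 0 → σ = -1)}

/-- The control `u` follows the switching law `u = -K sign(s) - ρ₂ s`, in the sense of Filippov,
with the (possibly time-dependent) switching gain `K`. -/
def FollowsSwitchingLaw (K : ℝ → ℝ) (ρ₂ : ℝ) (s u : ℝ → ℝ) : Prop :=
  ∀ᵐ t ∂(volume.restrict (Ioi (0 : ℝ))), ∃ σ ∈ signSet (s t), u t = -K t * σ - ρ₂ * s t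

/-- The adaptive law `dF̂/dt = (μ / m) |s|` on `[0, ∞)`. -/
def FollowsAdaptiveLaw (m μ : ℝ) (s Fhat : ℝ → ℝ) : Prop :=
  ∀ t : ℝ, 0 ≤ t → HasDerivWithinAt Fhat (μ / m * |s t|) (Ici 0) t

end FracOsc

end

/-! Everything is expressed through the velocity `x₄`. A Caputo equation D^α f = g inverts to f -
f(0) = J^α g, where J^a is the Riemann-Liouville integral. The semigroup law J^a J^b = J^(a+b)
(`fracInt_fracInt`: Fubini and Euler's beta integral) then collapses the fractional chain to x₃ =
J^(1-α₂) x₄, x₂ = J^(1-α₁) x₄ and x₁ = x₁(0) + ∫ x₄ (`FractionalPart.eq_fracInt`). For the converse,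
J^a of a locally absolutely continuous function has an explicit weak derivative (`fracIntDeriv`), to
which J^b may be applied at every time once a + b ≥ 1.

The memory terms become visibly dissipative through the Laplace representation t^(-α)/Γ(1-α) = ∫
μ_{1-α}(ω) e^(-ωt) dω. Thus x₂ and x₃ are superpositions of damped first order filters z(ω, ·)
driven by x₄ (`fracInt_eq_integral_freqWeight`), and ½∫μz² changes at the rate -∫ωμz² + x₄∫μz. In
the total energy all exchanged powers cancel and only the dissipation is left
(`FractionalPart.hasDerivAt_energy`). If the dissipation vanishes at a single instant t, then z(ω,
t) = 0 for every ω, so all exponential moments of x₄ on [0, t] vanish and Weierstrass' theorem gives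
x₄ = 0 there. Stability follows because the filters start with zero energy; x₂ and x₃ are controlled
by the time-uniform bound |z| ≤ 3A min(1, 1/ω) of `abs_diffState_le_decay`.

Under the switching laws s²/2, augmented by (F̂ - F)²/(2μ) in the adaptive case, decreases at least
at a rate a|s|. Hence s is bounded, Lipschitz and integrable in time, and Barbalat's lemma gives s →
0. For x₁ the energy is formed with q = x₄ - s instead of x₄, since the equation for q' contains
neither force nor control. The perturbing power is then s(kx₁ + c₁x₂ + c₂x₃), and `young_decay`
bounds it by half of the dissipation plus a constant times |s|(1 + energy). As |s| is integrable,
`gronwall_dissipation` bounds the energy and the total dissipation. By Fubini some single filter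
z(ω, ·) is square integrable in time and tends to zero. Integrating its equation over windows of
fixed length yields q → 0, hence x₄ → 0; dominated convergence over the frequencies yields x₂, x₃ →
0; integrating q' over windows yields x₁ → 0. -/

noncomputable section

namespace FracOsc

/-! ### Riemann-Liouville integrals -/

/-- The Riemann-Liouville kernel `t^{a-1}/Γ(a)`, extended by zero to `t ≤ 0`. -/
def fracKernel (a t : ℝ) : ℝ := if 0 < t then t ^ (a - 1) / Real.Gamma a else 0

/-- The Riemann-Liouville integral of order `a` with lower terminal `0`. -/
def fracInt (a : ℝ) (h : ℝ → ℝ) (t : ℝ) : ℝ := ∫ s in (0 : ℝ)..t, fracKernel a (t - s) * h s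

lemma fracKernel_of_pos {a t : ℝ} (ht : 0 < t) : fracKernel a t = t ^ (a - 1) / Real.Gamma a :=
  if_pos ht

lemma fracKernel_of_nonpos {a t : ℝ} (ht : t ≤ 0) : fracKernel a t = 0 := if_neg ht.not_gt

lemma fracKernel_one {t : ℝ} (ht : 0 < t) : fracKernel 1 t = 1 := by
  simp [fracKernel_of_pos ht]

lemma fracKernel_nonneg {a : ℝ} (ha : 0 < a) (t : ℝ) : 0 ≤ fracKernel a t := by
  unfold fracKernel
  split_ifs with h
  · have := Real.Gamma_pos_of_pos ha
    positivity
  · exact le_rfl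

lemma measurable_fracKernel (a : ℝ) : Measurable (fracKernel a) := by
  unfold fracKernel
  exact Measurable.ite measurableSet_Ioi (by fun_prop) measurable_const

/-- This is the complex beta integral read on [0, t], where both bases are nonnegative and the
complex powers are therefore casts of real ones. -/
lemma integral_mul_rpow_sub {a b t : ℝ} (ha : 0 < a) (hb : 0 < b) (ht : 0 < t) :
    ∫ x in (0 : ℝ)..t, x ^ (b - 1) * (t - x) ^ (a - 1) =
      t ^ (a + b - 1) * (Real.Gamma a * Real.Gamma b / Real.Gamma (a + b)) := by
  have h1 := Complex.betaIntegral_scaled (b : ℂ) (a : ℂ) ht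
  have h2 := Complex.betaIntegral_eq_Gamma_mul_div (b : ℂ) (a : ℂ) (by simpa) (by simpa)
  rw [h2] at h1
  have h3 : ∫ x in (0 : ℝ)..t, (x : ℂ) ^ ((b : ℂ) - 1) * ((t : ℂ) - x) ^ ((a : ℂ) - 1) =
      ((∫ x in (0 : ℝ)..t, x ^ (b - 1) * (t - x) ^ (a - 1) : ℝ) : ℂ) := by
    rw [← intervalIntegral.integral_ofReal]
    refine intervalIntegral.integral_congr fun x hx => ?_
    rw [uIcc_of_le ht.le] at hx
    push_cast [Complex.ofReal_cpow hx.1, Complex.ofReal_cpow (sub_nonneg.2 hx.2)]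
    rfl
  rw [h3] at h1
  have h4 : ((t : ℂ) ^ ((b : ℂ) + a - 1)) = ((t ^ (b + a - 1) : ℝ) : ℂ) := by
    push_cast [Complex.ofReal_cpow ht.le]
    rfl
  rw [h4, Complex.Gamma_ofReal, Complex.Gamma_ofReal, ← Complex.ofReal_add,
    Complex.Gamma_ofReal] at h1
  norm_cast at h1
  rw [h1, add_comm b a, mul_comm (Real.Gamma b)]

lemma fracKernel_mul_integral_aux {a b t : ℝ} (ha : 0 < a) (hb : 0 < b) (ht : 0 < t) :
    ∫ x in (0 : ℝ)..t, fracKernel a (t - x) * fracKernel b x = fracKernel (a + b) t := by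
  have h : ∫ x in (0 : ℝ)..t, fracKernel a (t - x) * fracKernel b x =
      ∫ x in (0 : ℝ)..t, (x ^ (b - 1) * (t - x) ^ (a - 1)) *
        (Real.Gamma a * Real.Gamma b)⁻¹ := by
    rw [intervalIntegral.integral_of_le ht.le, intervalIntegral.integral_of_le ht.le,
      integral_Ioc_eq_integral_Ioo, integral_Ioc_eq_integral_Ioo]
    refine setIntegral_congr_fun measurableSet_Ioo fun x hx => ?_
    simp only [fracKernel_of_pos hx.1, fracKernel_of_pos (sub_pos.2 hx.2)]
    field_simp
  have := Real.Gamma_pos_of_pos ha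
  have := Real.Gamma_pos_of_pos hb
  rw [h, intervalIntegral.integral_mul_const, integral_mul_rpow_sub ha hb ht,
    fracKernel_of_pos ht]
  field_simp

/-- Euler's beta integral in terms of the Riemann-Liouville kernels. -/
lemma integral_fracKernel_mul {a b r t : ℝ} (ha : 0 < a) (hb : 0 < b) (hr : r < t) :
    ∫ s in r..t, fracKernel a (t - s) * fracKernel b (s - r) = fracKernel (a + b) (t - r) := by
  rw [← fracKernel_mul_integral_aux ha hb (sub_pos.2 hr)]
  have := intervalIntegral.integral_comp_sub_right
    (fun x => fracKernel a (t - r - x) * fracKernel b x) r (a := r) (b := t)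
  simpa using this

lemma intervalIntegrable_fracKernel_mul {a b r t : ℝ} (ha : 0 < a) (hb : 0 < b) (hr : r < t) :
    IntervalIntegrable (fun s => fracKernel a (t - s) * fracKernel b (s - r)) volume r t := by
  -- A non-integrable function has integral 0 by convention, so the nonzero value of the beta
  -- integral already yields integrability.
  apply intervalIntegral.intervalIntegrable_of_integral_ne_zero
  rw [integral_fracKernel_mul ha hb hr, fracKernel_of_pos (sub_pos.2 hr)]
  have := Real.Gamma_pos_of_pos (add_pos ha hb)
  have := sub_pos.2 hr
  positivity

lemma intervalIntegrable_fracKernel {a : ℝ} (ha : 0 < a) (t : ℝ) :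
    IntervalIntegrable (fun s => fracKernel a (t - s)) volume 0 t := by
  rcases le_or_gt t 0 with ht | ht
  · refine (intervalIntegrable_const (c := (0 : ℝ))).congr_uIoo fun s hs => ?_
    rw [uIoo_of_ge ht] at hs
    exact (fracKernel_of_nonpos (by linarith [hs.1])).symm
  have h := intervalIntegrable_fracKernel_mul ha one_pos ht
  refine h.congr_uIoo fun s hs => ?_
  rw [uIoo_of_le ht.le] at hs
  simp [fracKernel_one hs.1]

lemma intervalIntegrable_fracKernel_mul_continuousOn {a t : ℝ} {h : ℝ → ℝ} (ha : 0 < a)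
    (ht : 0 ≤ t) (hh : ContinuousOn h (Icc 0 t)) :
    IntervalIntegrable (fun s => fracKernel a (t - s) * h s) volume 0 t :=
  (intervalIntegrable_fracKernel ha t).mul_continuousOn (by rwa [uIcc_of_le ht])

@[simp] lemma fracInt_zero_right (a : ℝ) (h : ℝ → ℝ) : fracInt a h 0 = 0 := by simp [fracInt]

lemma fracInt_one {t : ℝ} (ht : 0 ≤ t) (h : ℝ → ℝ) : fracInt 1 h t = ∫ s in (0 : ℝ)..t, h s := by
  unfold fracInt
  rw [intervalIntegral.integral_of_le ht, intervalIntegral.integral_of_le ht,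
    integral_Ioc_eq_integral_Ioo, integral_Ioc_eq_integral_Ioo]
  refine setIntegral_congr_fun measurableSet_Ioo fun x hx => ?_
  simp [fracKernel_one (sub_pos.2 hx.2)]

lemma fracInt_congr {a t : ℝ} {h g : ℝ → ℝ} (ht : 0 ≤ t)
    (hg : ∀ᵐ s, s ∈ Ioo 0 t → h s = g s) : fracInt a h t = fracInt a g t := by
  unfold fracInt
  rw [intervalIntegral.integral_of_le ht, intervalIntegral.integral_of_le ht,
    integral_Ioc_eq_integral_Ioo, integral_Ioc_eq_integral_Ioo]
  refine setIntegral_congr_ae measurableSet_Ioo ?_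
  filter_upwards [hg] with s hs h1
  rw [hs h1]

/-- The semigroup law `J^a J^b = J^{a+b}` of the Riemann-Liouville integrals, at a point `t` at
which the right-hand side converges absolutely. -/
theorem fracInt_fracInt {a b t : ℝ} {h : ℝ → ℝ} (ha : 0 < a) (hb : 0 < b) (ht : 0 ≤ t)
    (hh : IntervalIntegrable h volume 0 t)
    (hk : IntervalIntegrable (fun s => fracKernel (a + b) (t - s) * h s) volume 0 t) :
    IntervalIntegrable (fun s => fracKernel a (t - s) * fracInt b h s) volume 0 t ∧
      fracInt a (fracInt b h) t = fracInt (a + b) h t := by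
  set μ := (volume : Measure ℝ).restrict (Ioo 0 t) with hμ
  rw [intervalIntegrable_iff_integrableOn_Ioo_of_le ht] at hh hk ⊢
  -- The kernel vanishes for nonpositive arguments, so the triangle r < s < t can be treated as the
  -- full square.
  let F : ℝ × ℝ → ℝ := fun p => fracKernel a (t - p.1) * fracKernel b (p.1 - p.2) * h p.2
  have hFm : AEStronglyMeasurable F (μ.prod μ) := by
    refine AEStronglyMeasurable.mul ?_ hh.aestronglyMeasurable.comp_snd
    refine Measurable.aestronglyMeasurable ?_
    exact ((measurable_fracKernel a).comp (by fun_prop)).mul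
      ((measurable_fracKernel b).comp (by fun_prop))
  have hzero : ∀ r ∈ Ioo 0 t, ∀ s ∈ Ioo 0 t \ Ioo r t,
      fracKernel a (t - s) * fracKernel b (s - r) = 0 := by
    intro r hr s hs
    have : s - r ≤ 0 := by
      by_contra hc
      exact hs.2 ⟨by linarith, hs.1.2⟩
    rw [fracKernel_of_nonpos this, mul_zero]
  have hsub : ∀ r ∈ Ioo 0 t, Ioo r t ⊆ Ioo 0 t := fun r hr s hs => ⟨hr.1.trans hs.1, hs.2⟩
  have hint : ∀ r ∈ Ioo 0 t,
      Integrable (fun s => fracKernel a (t - s) * fracKernel b (s - r)) μ := by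
    intro r hr
    have := intervalIntegrable_fracKernel_mul ha hb hr.2
    rw [intervalIntegrable_iff_integrableOn_Ioo_of_le hr.2.le] at this
    exact this.of_forall_sdiff_eq_zero measurableSet_Ioo (hzero r hr)
  have hval : ∀ r ∈ Ioo 0 t,
      ∫ s, fracKernel a (t - s) * fracKernel b (s - r) ∂μ = fracKernel (a + b) (t - r) := by
    intro r hr
    rw [← integral_fracKernel_mul ha hb hr.2, intervalIntegral.integral_of_le hr.2.le,
      integral_Ioc_eq_integral_Ioo]
    exact setIntegral_eq_of_subset_of_forall_sdiff_eq_zero measurableSet_Ioo (hsub r hr)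
      (hzero r hr)
  have hF : Integrable F (μ.prod μ) := by
    -- Tonelli with the `s`-integral inside: the kernels are nonnegative, so integrating |F| over
    -- `s` gives `fracKernel (a + b) (t - r) * ‖h r‖`, whose integrability is `hk`.
    rw [integrable_prod_iff' hFm]
    constructor
    · filter_upwards [ae_restrict_mem measurableSet_Ioo] with r hr
      exact (hint r hr).mul_const (h r)
    · refine (hk.norm).congr ?_
      filter_upwards [ae_restrict_mem measurableSet_Ioo] with r hr
      have : ∀ s, ‖F (s, r)‖ = fracKernel a (t - s) * fracKernel b (s - r) * ‖h r‖ := by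
        intro s
        rw [norm_mul, Real.norm_of_nonneg
          (mul_nonneg (fracKernel_nonneg ha _) (fracKernel_nonneg hb _))]
      simp_rw [this]
      rw [integral_mul_const, hval r hr, norm_mul,
        Real.norm_of_nonneg (fracKernel_nonneg (add_pos ha hb) _)]
  have hinner : ∀ s ∈ Ioo 0 t, ∫ r, F (s, r) ∂μ = fracKernel a (t - s) * fracInt b h s := by
    intro s hs
    simp only [F, mul_assoc]
    rw [integral_const_mul, fracInt, intervalIntegral.integral_of_le hs.1.le,
      integral_Ioc_eq_integral_Ioo]
    congr 1
    refine setIntegral_eq_of_subset_of_forall_sdiff_eq_zero measurableSet_Ioo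
      (fun r hr => ⟨hr.1, hr.2.trans hs.2⟩) fun r hr => ?_
    rw [fracKernel_of_nonpos, zero_mul]
    by_contra hc
    exact hr.2 ⟨hr.1.1, by linarith⟩
  constructor
  · refine hF.integral_prod_left.congr ?_
    filter_upwards [ae_restrict_mem measurableSet_Ioo] with s hs using hinner s hs
  · have hswap := integral_integral_swap (f := fun s r => F (s, r)) hF
    rw [fracInt, intervalIntegral.integral_of_le ht, integral_Ioc_eq_integral_Ioo, fracInt,
      intervalIntegral.integral_of_le ht, integral_Ioc_eq_integral_Ioo]
    rw [← setIntegral_congr_fun measurableSet_Ioo hinner, hswap]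
    refine setIntegral_congr_fun measurableSet_Ioo fun r hr => ?_
    simp only [F]
    rw [integral_mul_const, hval r hr]

lemma caputo_eq_fracInt {α t : ℝ} (ht : 0 ≤ t) (f : ℝ → ℝ) :
    caputo α f t = fracInt (1 - α) (deriv f) t := by
  unfold caputo fracInt caputoIntegrand
  rw [← intervalIntegral.integral_const_mul]
  rw [intervalIntegral.integral_of_le ht, intervalIntegral.integral_of_le ht,
    integral_Ioc_eq_integral_Ioo, integral_Ioc_eq_integral_Ioo]
  refine setIntegral_congr_fun measurableSet_Ioo fun s hs => ?_
  have h := sub_pos.2 hs.2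
  simp only [fracKernel_of_pos h]
  rw [show 1 - α - 1 = -α by ring, Real.rpow_neg h.le]
  ring

lemma intervalIntegrable_caputoIntegrand_iff {α t : ℝ} (hα : α < 1) (ht : 0 ≤ t) (f : ℝ → ℝ) :
    IntervalIntegrable (caputoIntegrand α f t) volume 0 t ↔
      IntervalIntegrable (fun s => fracKernel (1 - α) (t - s) * deriv f s) volume 0 t := by
  have hG := Real.Gamma_pos_of_pos (sub_pos.2 hα)
  have key : ∀ s ∈ uIoo 0 t, fracKernel (1 - α) (t - s) * deriv f s =
      (Real.Gamma (1 - α))⁻¹ * caputoIntegrand α f t s := by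
    intro s hs
    rw [uIoo_of_le ht] at hs
    have h := sub_pos.2 hs.2
    rw [fracKernel_of_pos h, show 1 - α - 1 = -α by ring, Real.rpow_neg h.le, caputoIntegrand]
    ring
  constructor
  · intro h
    exact (h.const_mul _).congr_uIoo fun s hs => (key s hs).symm
  · intro h
    refine (h.const_mul (Real.Gamma (1 - α))).congr_uIoo fun s hs => ?_
    simp only [key s hs]
    field_simp

/-! ### Locally absolutely continuous functions on the half-line -/

lemma LocAC.congr {f g : ℝ → ℝ} (hf : LocAC f) (h : EqOn f g (Ici 0)) : LocAC g := by
  intro T hT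
  have := hf T hT
  rw [absolutelyContinuousOnInterval_iff] at this ⊢
  intro ε hε
  obtain ⟨δ, hδ, H⟩ := this ε hε
  refine ⟨δ, hδ, fun E hE hs => ?_⟩
  refine lt_of_eq_of_lt (Finset.sum_congr rfl fun i hi => ?_) (H E hE hs)
  have hi := hE.1 i hi
  rw [uIcc_of_le hT.le] at hi
  rw [h hi.1.1, h hi.2.1]

lemma LocAC.continuousOn {f : ℝ → ℝ} (hf : LocAC f) : ContinuousOn f (Ici 0) := by
  intro t ht
  have ht : 0 ≤ t := ht
  have h := (hf (t + 1) (by linarith)).continuousOn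
  rw [uIcc_of_le (by linarith)] at h
  refine (h t ⟨ht, by linarith⟩).mono_of_mem_nhdsWithin ?_
  rw [← Ici_inter_Iic]
  exact inter_mem_nhdsWithin _ (Iic_mem_nhds (by linarith))

lemma LocAC.absolutelyContinuousOnInterval {f : ℝ → ℝ} (hf : LocAC f) {a b : ℝ} (ha : 0 ≤ a)
    (hb : 0 ≤ b) : AbsolutelyContinuousOnInterval f a b := by
  refine (hf (max a b + 1) (by positivity)).mono ?_
  rw [uIcc_of_le (a := 0) (by positivity)]
  rintro x ⟨h1, h2⟩
  exact ⟨(le_min ha hb).trans h1, h2.trans (by linarith)⟩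

lemma LocAC.intervalIntegrable_deriv {f : ℝ → ℝ} (hf : LocAC f) {a b : ℝ} (ha : 0 ≤ a)
    (hb : 0 ≤ b) : IntervalIntegrable (deriv f) volume a b :=
  (hf.absolutelyContinuousOnInterval ha hb).intervalIntegrable_deriv

lemma LocAC.integral_deriv {f : ℝ → ℝ} (hf : LocAC f) {a b : ℝ} (ha : 0 ≤ a)
    (hb : 0 ≤ b) : ∫ t in a..b, deriv f t = f b - f a :=
  (hf.absolutelyContinuousOnInterval ha hb).integral_deriv_eq_sub

lemma ae_pos_of_forall_Icc {p : ℝ → Prop} (h : ∀ n : ℕ, ∀ᵐ t, t ∈ Icc (0 : ℝ) n → p t) :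
    ∀ᵐ t, 0 ≤ t → p t := by
  filter_upwards [ae_all_iff.2 h] with t ht h0
  obtain ⟨n, hn⟩ := exists_nat_ge t
  exact ht n ⟨h0, hn⟩

lemma LocAC.ae_differentiableAt {f : ℝ → ℝ} (hf : LocAC f) :
    ∀ᵐ t, 0 ≤ t → DifferentiableAt ℝ f t := by
  refine ae_pos_of_forall_Icc fun n => ?_
  have := (hf.absolutelyContinuousOnInterval le_rfl (Nat.cast_nonneg n)).ae_differentiableAt
  rwa [uIcc_of_le (Nat.cast_nonneg n)] at this

lemma locAC_of_integral {f g : ℝ → ℝ} (hg : ∀ t, 0 ≤ t → IntervalIntegrable g volume 0 t)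
    (hf : ∀ t, 0 ≤ t → f t = f 0 + ∫ s in (0 : ℝ)..t, g s) : LocAC f := by
  refine LocAC.congr (f := fun t => f 0 + ∫ s in (0 : ℝ)..t, g s) (fun T hT => ?_)
    fun t ht => (hf t ht).symm
  refine AbsolutelyContinuousOnInterval.fun_add ?_
    ((hg T hT.le).absolutelyContinuousOnInterval_intervalIntegral left_mem_uIcc)
  exact (LipschitzWith.const (f 0)).lipschitzOnWith.absolutelyContinuousOnInterval

lemma eventuallyEq_nhds_of_eqOn_Ici {f g : ℝ → ℝ} (h : EqOn f g (Ici 0)) {t : ℝ} (ht : 0 < t) :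
    f =ᶠ[𝓝 t] g := by
  filter_upwards [Ioi_mem_nhds ht] with s hs using h (mem_Ici.2 (mem_Ioi.1 hs).le)

lemma ae_hasDerivAt_of_integral {f g : ℝ → ℝ}
    (hg : ∀ t, 0 ≤ t → IntervalIntegrable g volume 0 t)
    (hf : ∀ t, 0 ≤ t → f t = f 0 + ∫ s in (0 : ℝ)..t, g s) :
    ∀ᵐ t, 0 < t → HasDerivAt f (g t) t := by
  have : ∀ᵐ t, 0 ≤ t → HasDerivAt (fun t => ∫ s in (0 : ℝ)..t, g s) (g t) t := by
    refine ae_pos_of_forall_Icc fun n => ?_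
    have := (hg n (Nat.cast_nonneg n)).ae_hasDerivAt_integral
    rw [uIcc_of_le (Nat.cast_nonneg n)] at this
    filter_upwards [this] with t ht h using ht h 0 ⟨le_rfl, Nat.cast_nonneg n⟩
  filter_upwards [this] with t ht h0
  refine ((ht h0.le).const_add (f 0)).congr_of_eventuallyEq ?_
  exact eventuallyEq_nhds_of_eqOn_Ici (fun s hs => hf s hs) h0

/-- Freezing `v` at the value `v 0` for negative times makes it continuous on the whole line, so
two-sided calculus applies to data that are controlled only on `[0, ∞)`. -/
lemma continuous_comp_max_zero {v : ℝ → ℝ} (hv : ContinuousOn v (Ici 0)) :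
    Continuous fun t => v (max t 0) :=
  hv.comp_continuous (by fun_prop) fun t => le_max_right t 0

lemma intervalIntegrable_of_continuousOn_Ici {v : ℝ → ℝ} (hv : ContinuousOn v (Ici 0)) {a b : ℝ}
    (ha : 0 ≤ a) (hb : 0 ≤ b) : IntervalIntegrable v volume a b :=
  (hv.mono fun _ hx => (le_min ha hb).trans hx.1).intervalIntegrable

lemma integral_comp_max_zero (v : ℝ → ℝ) {a b : ℝ} (ha : 0 ≤ a) (hb : 0 ≤ b) :
    ∫ s in a..b, v (max s 0) = ∫ s in a..b, v s := by
  refine intervalIntegral.integral_congr fun s hs => ?_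
  have : 0 ≤ s := (le_min ha hb).trans hs.1
  simp [this]

lemma hasDerivAt_integral_of_continuousOn {v : ℝ → ℝ} (hv : ContinuousOn v (Ici 0)) {t : ℝ}
    (ht : 0 < t) : HasDerivAt (fun t => ∫ s in (0 : ℝ)..t, v s) (v t) t := by
  have h := intervalIntegral.integral_hasDerivAt_right
    ((continuous_comp_max_zero hv).intervalIntegrable 0 t)
    ((continuous_comp_max_zero hv).stronglyMeasurableAtFilter _ _)
    (continuous_comp_max_zero hv).continuousAt
  rw [max_eq_left ht.le] at h
  exact h.congr_of_eventuallyEq (eventuallyEq_nhds_of_eqOn_Ici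
    (fun s hs => (integral_comp_max_zero v le_rfl hs).symm) ht)

lemma contDiffOn_of_integral {x v : ℝ → ℝ} (hv : ContinuousOn v (Ici 0))
    (hx : ∀ t, 0 ≤ t → x t = x 0 + ∫ s in (0 : ℝ)..t, v s) :
    ContDiffOn ℝ 1 x (Ici 0) ∧ ∀ t, 0 ≤ t → HasDerivWithinAt x (v t) (Ici 0) t := by
  have hc := continuous_comp_max_zero hv
  let X : ℝ → ℝ := fun t => x 0 + ∫ s in (0 : ℝ)..t, v (max s 0)
  have hX : ∀ t, HasDerivAt X (v (max t 0)) t := fun t =>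
    (intervalIntegral.integral_hasDerivAt_right (hc.intervalIntegrable 0 t)
      (hc.stronglyMeasurableAtFilter _ _) hc.continuousAt).const_add _
  have heq : EqOn x X (Ici 0) := fun t ht => by
    simp only [X, hx t ht, integral_comp_max_zero v le_rfl ht]
  constructor
  · refine ContDiffOn.congr (ContDiff.contDiffOn ?_) heq
    rw [contDiff_one_iff_deriv]
    refine ⟨fun t => (hX t).differentiableAt, ?_⟩
    rwa [show deriv X = fun t => v (max t 0) from funext fun t => (hX t).deriv]
  · intro t ht
    have := (hX t).hasDerivWithinAt (s := Ici 0)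
    rw [max_eq_left ht] at this
    exact this.congr heq (heq ht)

lemma velocity_eq {x v : ℝ → ℝ} {t : ℝ} (ht : 0 ≤ t) (h : HasDerivWithinAt x (v t) (Ici 0) t) :
    velocity x t = v t :=
  h.derivWithin (uniqueDiffOn_Ici 0 t ht)

lemma velocity_eq_deriv (x : ℝ → ℝ) {t : ℝ} (ht : 0 < t) : velocity x t = deriv x t :=
  derivWithin_of_mem_nhds (Ici_mem_nhds ht)

lemma hasDerivWithinAt_velocity {x : ℝ → ℝ} (hx : ContDiffOn ℝ 1 x (Ici 0)) {t : ℝ}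
    (ht : 0 ≤ t) : HasDerivWithinAt x (velocity x t) (Ici 0) t :=
  (hx.differentiableOn (by norm_num) t ht).hasDerivWithinAt

lemma continuousOn_velocity {x : ℝ → ℝ} (hx : ContDiffOn ℝ 1 x (Ici 0)) :
    ContinuousOn (velocity x) (Ici 0) :=
  hx.continuousOn_derivWithin (uniqueDiffOn_Ici 0) (by norm_num)

lemma locAC_of_contDiffOn {x : ℝ → ℝ} (hx : ContDiffOn ℝ 1 x (Ici 0)) : LocAC x := by
  intro T hT
  refine (hx.mono ?_).absolutelyContinuousOnInterval
  rw [uIcc_of_le hT.le]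
  exact fun s hs => hs.1

/-! ### Fractional equations and Riemann-Liouville integrals -/

/-- From order 1 on the kernel has no singularity, so mere integrability of `h` suffices at every
`t`. For smaller orders the convergence at a given `t` is a genuine condition. -/
lemma intervalIntegrable_fracKernel_mul_of_one_le {a t : ℝ} (ha : 1 ≤ a) (ht : 0 ≤ t)
    {h : ℝ → ℝ} (hh : IntervalIntegrable h volume 0 t) :
    IntervalIntegrable (fun s => fracKernel a (t - s) * h s) volume 0 t := by
  have hc : Continuous fun s : ℝ => (t - s) ^ (a - 1) / Real.Gamma a :=
    ((continuous_const.sub continuous_id).rpow_const fun _ => Or.inr (by linarith)).div_const _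
  refine (hh.continuousOn_mul hc.continuousOn).congr_uIoo fun s hs => ?_
  rw [uIoo_of_le ht] at hs
  simp only [fracKernel_of_pos (sub_pos.2 hs.2)]

lemma fracInt_compl {α t : ℝ} {h : ℝ → ℝ} (hα : 0 < α) (hα' : α < 1) (ht : 0 ≤ t)
    (hh : IntervalIntegrable h volume 0 t) :
    fracInt α (fracInt (1 - α) h) t = ∫ s in (0 : ℝ)..t, h s := by
  rw [← fracInt_one ht, (fracInt_fracInt hα (sub_pos.2 hα') ht hh ?_).2, add_sub_cancel]
  rw [add_sub_cancel]
  exact intervalIntegrable_fracKernel_mul_of_one_le le_rfl ht hh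

lemma fracInt_fracInt_of_continuousOn {a b t : ℝ} {h : ℝ → ℝ} (ha : 0 < a) (hb : 0 < b)
    (ht : 0 ≤ t) (hh : ContinuousOn h (Ici 0)) :
    fracInt a (fracInt b h) t = fracInt (a + b) h t :=
  (fracInt_fracInt ha hb ht (intervalIntegrable_of_continuousOn_Ici hh le_rfl ht)
    (intervalIntegrable_fracKernel_mul_continuousOn (add_pos ha hb) ht
      (hh.mono fun _ hs => hs.1))).2

lemma CaputoEq.eq_fracInt_deriv {α t : ℝ} {f g : ℝ → ℝ} (h : CaputoEq α f g)
    (ht : 0 < t) : g t = fracInt (1 - α) (deriv f) t := by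
  rw [← h.eq t ht, caputo_eq_fracInt ht.le]

/-- Applying J^α to g = J^(1-α) f' produces J^1 f', which is the increment of `f`. -/
lemma CaputoEq.sub_eq_fracInt {α t : ℝ} {f g : ℝ → ℝ} (h : CaputoEq α f g) (hα : 0 < α)
    (hα' : α < 1) (ht : 0 ≤ t) : f t - f 0 = fracInt α g t := by
  rw [fracInt_congr (g := fracInt (1 - α) (deriv f)) ht
    (Eventually.of_forall fun s hs => h.eq_fracInt_deriv hs.1),
    fracInt_compl hα hα' ht (h.locAC.intervalIntegrable_deriv le_rfl ht),
    h.locAC.integral_deriv le_rfl ht]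

/-- The states of the fractional part of the state equation in terms of the velocity `x₄`. -/
lemma FractionalPart.eq_fracInt {α₁ α₂ : ℝ} {x₁ x₂ x₃ x₄ : ℝ → ℝ}
    (h : FractionalPart α₁ α₂ x₁ x₂ x₃ x₄) (hα₁ : 0 < α₁) (hα : α₁ < α₂) (hα₂ : α₂ < 1) {t : ℝ}
    (ht : 0 ≤ t) :
    x₂ t = fracInt (1 - α₁) x₄ t ∧ x₃ t = fracInt (1 - α₂) x₄ t ∧
      x₁ t = x₁ 0 + ∫ s in (0 : ℝ)..t, x₄ s := by
  have hc := h.locAC₄.continuousOn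
  -- The chain is inverted from `x₄` downwards. The orders add up to 1 - α₂, then (α₂ - α₁) + (1 -
  -- α₂) = 1 - α₁, then α₁ + (1 - α₁) = 1; the zero initial values remove the constants at the first
  -- two stages.
  have h3 : ∀ t, 0 ≤ t → x₃ t = fracInt (1 - α₂) x₄ t := fun t ht => by
    rw [← h.eq₃.sub_eq_fracInt (by linarith) (by linarith) ht, h.init₃, sub_zero]
  have h2 : ∀ t, 0 ≤ t → x₂ t = fracInt (1 - α₁) x₄ t := fun t ht => by
    rw [← sub_zero (x₂ t), ← h.init₂, h.eq₂.sub_eq_fracInt (by linarith) (by linarith) ht,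
      fracInt_congr ht (Eventually.of_forall fun s hs => h3 s hs.1.le),
      fracInt_fracInt_of_continuousOn (by linarith) (by linarith) ht hc]
    ring_nf
  refine ⟨h2 t ht, h3 t ht, ?_⟩
  rw [← fracInt_compl hα₁ (hα.trans hα₂) ht (intervalIntegrable_of_continuousOn_Ici hc le_rfl ht),
    ← fracInt_congr ht (Eventually.of_forall fun s hs => h2 s hs.1.le),
    ← h.eq₁.sub_eq_fracInt hα₁ (hα.trans hα₂) ht]
  ring

lemma FractionalPart.hasDerivWithinAt {α₁ α₂ : ℝ} {x₁ x₂ x₃ x₄ : ℝ → ℝ}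
    (h : FractionalPart α₁ α₂ x₁ x₂ x₃ x₄) (hα₁ : 0 < α₁) (hα : α₁ < α₂) (hα₂ : α₂ < 1) :
    ContDiffOn ℝ 1 x₁ (Ici 0) ∧ ∀ t, 0 ≤ t → HasDerivWithinAt x₁ (x₄ t) (Ici 0) t :=
  contDiffOn_of_integral h.locAC₄.continuousOn fun _ ht => (h.eq_fracInt hα₁ hα hα₂ ht).2.2

lemma FractionalPart.velocity_eq {α₁ α₂ : ℝ} {x₁ x₂ x₃ x₄ : ℝ → ℝ}
    (h : FractionalPart α₁ α₂ x₁ x₂ x₃ x₄) (hα₁ : 0 < α₁) (hα : α₁ < α₂) (hα₂ : α₂ < 1) {t : ℝ}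
    (ht : 0 ≤ t) : velocity x₁ t = x₄ t :=
  FracOsc.velocity_eq ht ((h.hasDerivWithinAt hα₁ hα hα₂).2 t ht)

lemma fracInt_const {a t : ℝ} (ha : 0 < a) (ht : 0 < t) (c : ℝ) :
    fracInt a (fun _ => c) t = c * fracKernel (a + 1) t := by
  rw [← fracKernel_mul_integral_aux ha one_pos ht, fracInt, intervalIntegral.integral_mul_const,
    mul_comm]
  congr 1
  rw [intervalIntegral.integral_of_le ht.le, intervalIntegral.integral_of_le ht.le]
  refine setIntegral_congr_fun measurableSet_Ioc fun s hs => ?_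
  simp [fracKernel_one hs.1]

lemma fracInt_add {a t : ℝ} {g h : ℝ → ℝ}
    (hg : IntervalIntegrable (fun s => fracKernel a (t - s) * g s) volume 0 t)
    (hh : IntervalIntegrable (fun s => fracKernel a (t - s) * h s) volume 0 t) :
    fracInt a (fun s => g s + h s) t = fracInt a g t + fracInt a h t := by
  simp only [fracInt, mul_add]
  exact intervalIntegral.integral_add hg hh

/-- Substitute v = v(0) + J^1 v' and use the semigroup law. -/
lemma fracInt_of_locAC {a t : ℝ} {v : ℝ → ℝ} (ha : 0 < a) (ht : 0 < t) (hv : LocAC v) :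
    fracInt a v t = v 0 * fracKernel (a + 1) t + fracInt (a + 1) (deriv v) t := by
  have hi := hv.intervalIntegrable_deriv le_rfl ht.le
  have hs := fracInt_fracInt ha one_pos ht.le hi
    (intervalIntegrable_fracKernel_mul_of_one_le (by linarith) ht.le hi)
  rw [← fracInt_const ha ht, ← hs.2, ← fracInt_add
    ((intervalIntegrable_fracKernel ha t).mul_const _) hs.1]
  refine fracInt_congr ht.le (Eventually.of_forall fun s hs => ?_)
  rw [fracInt_one hs.1.le, hv.integral_deriv le_rfl hs.1.le]
  ring

/-- The weak derivative of `fracInt a v`. -/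
def fracIntDeriv (a : ℝ) (v : ℝ → ℝ) (t : ℝ) : ℝ := v 0 * fracKernel a t + fracInt a (deriv v) t

/-- Total order at least 1 makes J^b J^a v' converge at every `t`, although `deriv v` is only
integrable. The choice b = 1 identifies `fracIntDeriv a v` as the weak derivative of J^a v; the
choice b = 1 - α computes its Caputo derivative. -/
lemma fracInt_fracIntDeriv {a b t : ℝ} {v : ℝ → ℝ} (ha : 0 < a) (hb : 0 < b) (hab : 1 ≤ b + a)
    (ht : 0 < t) (hv : LocAC v) :
    IntervalIntegrable (fun s => fracKernel b (t - s) * fracIntDeriv a v s) volume 0 t ∧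
      fracInt b (fracIntDeriv a v) t =
        v 0 * fracKernel (b + a) t + fracInt (b + a) (deriv v) t := by
  have hi := hv.intervalIntegrable_deriv le_rfl ht.le
  have hs := fracInt_fracInt hb ha ht.le hi
    (intervalIntegrable_fracKernel_mul_of_one_le hab ht.le hi)
  have hk : IntervalIntegrable (fun s => fracKernel b (t - s) * (v 0 * fracKernel a s))
      volume 0 t := by
    have := (intervalIntegrable_fracKernel_mul hb ha ht).const_mul (v 0)
    simp only [sub_zero] at this
    refine this.congr_uIoo fun s _ => ?_
    ring
  constructor
  · refine (hk.add hs.1).congr_uIoo fun s _ => ?_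
    simp only [fracIntDeriv]
    ring
  · unfold fracIntDeriv
    rw [fracInt_add hk hs.1, hs.2]
    congr 1
    rw [← fracKernel_mul_integral_aux hb ha ht, fracInt, ← intervalIntegral.integral_const_mul]
    refine intervalIntegral.integral_congr fun s _ => ?_
    ring

lemma locAC_of_eq_fracInt {a : ℝ} {v x : ℝ → ℝ} (ha : 0 < a) (hv : LocAC v)
    (hx : ∀ t, 0 ≤ t → x t = fracInt a v t) :
    LocAC x ∧ ∀ᵐ t, 0 < t → HasDerivAt x (fracIntDeriv a v t) t := by
  have hi : ∀ t, 0 ≤ t → IntervalIntegrable (fracIntDeriv a v) volume 0 t := by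
    intro t ht
    rcases ht.eq_or_lt with rfl | ht
    · exact IntervalIntegrable.refl
    refine (fracInt_fracIntDeriv ha one_pos (by linarith) ht hv).1.congr_uIoo fun s hs => ?_
    rw [uIoo_of_le ht.le] at hs
    simp [fracKernel_one (sub_pos.2 hs.2)]
  have he : ∀ t, 0 ≤ t → x t = x 0 + ∫ s in (0 : ℝ)..t, fracIntDeriv a v s := by
    intro t ht
    rw [hx t ht, hx 0 le_rfl, fracInt_zero_right, zero_add, ← fracInt_one ht]
    rcases ht.eq_or_lt with rfl | ht
    · simp
    rw [(fracInt_fracIntDeriv ha one_pos (by linarith) ht hv).2, fracInt_of_locAC ha ht hv,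
      add_comm a 1]
  exact ⟨locAC_of_integral hi he, ae_hasDerivAt_of_integral hi he⟩

/-- The Caputo derivative is J^(1-α) of the weak derivative of J^a v; the condition α ≤ a is exactly
what brings the total order 1 - α + a up to 1. -/
lemma caputoEq_of_eq_fracInt {a α : ℝ} {v x y : ℝ → ℝ} (ha : 0 < a) (hα : α ≤ a)
    (hα1 : α < 1) (hv : LocAC v) (hx : ∀ t, 0 ≤ t → x t = fracInt a v t)
    (hy : ∀ t, 0 < t → y t =
      v 0 * fracKernel (1 - α + a) t + fracInt (1 - α + a) (deriv v) t) :
    CaputoEq α x y := by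
  obtain ⟨hac, hd⟩ := locAC_of_eq_fracInt ha hv hx
  have hd' : ∀ᵐ t, 0 < t → fracIntDeriv a v t = deriv x t := by
    filter_upwards [hd] with t h1 h2 using (h1 h2).deriv.symm
  refine ⟨hac, fun t ht => ?_, fun t ht => ?_⟩
  · rw [intervalIntegrable_caputoIntegrand_iff hα1 ht.le]
    refine (fracInt_fracIntDeriv ha (sub_pos.2 hα1) (by linarith) ht hv).1.congr_ae ?_
    rw [uIoc_of_le ht.le]
    refine (ae_restrict_iff' measurableSet_Ioc).2 ?_
    filter_upwards [hd'] with s h1 h2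
    rw [h1 h2.1]
  · rw [caputo_eq_fracInt ht.le, hy t ht,
      ← (fracInt_fracIntDeriv ha (sub_pos.2 hα1) (by linarith) ht hv).2]
    refine fracInt_congr ht.le ?_
    filter_upwards [hd'] with s h1 h2 using (h1 h2.1).symm

/-- The first equation is the definition of `x₂`. The other two differentiate J^(1-α₁) and J^(1-α₂)
of the velocity, which is where its absolute continuity enters; the total orders are 2 - α₂ and 1.
-/
lemma fractionalPart_of_contDiffOn {α₁ α₂ : ℝ} {x₁ x₂ x₃ x₄ : ℝ → ℝ} (hα₁ : 0 < α₁)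
    (hα : α₁ < α₂) (hα₂ : α₂ < 1) (hx : ContDiffOn ℝ 1 x₁ (Ici 0)) (hv : LocAC (velocity x₁))
    (h : ∀ t, 0 ≤ t → x₂ t = caputo α₁ x₁ t ∧ x₃ t = caputo α₂ x₁ t ∧ x₄ t = velocity x₁ t) :
    FractionalPart α₁ α₂ x₁ x₂ x₃ x₄ := by
  have hD : ∀ s, 0 < s → deriv x₁ s = velocity x₁ s := fun s hs => (velocity_eq_deriv x₁ hs).symm
  have hc : ∀ {α : ℝ} t, 0 ≤ t → caputo α x₁ t = fracInt (1 - α) (velocity x₁) t :=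
    fun t ht => by
      rw [caputo_eq_fracInt ht, fracInt_congr ht (Eventually.of_forall fun s hs => hD s hs.1)]
  have h2 : ∀ t, 0 ≤ t → x₂ t = fracInt (1 - α₁) (velocity x₁) t := fun t ht => by
    rw [(h t ht).1, hc t ht]
  have h3 : ∀ t, 0 ≤ t → x₃ t = fracInt (1 - α₂) (velocity x₁) t := fun t ht => by
    rw [(h t ht).2.1, hc t ht]
  refine ⟨⟨locAC_of_contDiffOn hx, fun t ht => ?_, fun t ht => ((h t ht.le).1).symm⟩, ?_, ?_,
    hv.congr fun t ht => (h t ht).2.2.symm, by simp [h2 0 le_rfl], by simp [h3 0 le_rfl]⟩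
  · rw [intervalIntegrable_caputoIntegrand_iff (hα.trans hα₂) ht.le]
    refine (intervalIntegrable_fracKernel_mul_continuousOn (a := 1 - α₁) (by linarith) ht.le
      ((continuousOn_velocity hx).mono fun s hs => hs.1)).congr_uIoo fun s hs => ?_
    rw [uIoo_of_le ht.le] at hs
    simp only [hD s hs.1]
  · refine caputoEq_of_eq_fracInt (by linarith) (by linarith) (by linarith) hv h2 fun t ht => ?_
    rw [h3 t ht.le, fracInt_of_locAC (by linarith) ht hv,
      show 1 - (α₂ - α₁) + (1 - α₁) = 1 - α₂ + 1 by ring]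
  · refine caputoEq_of_eq_fracInt (by linarith) le_rfl (by linarith) hv h3 fun t ht => ?_
    rw [(h t ht.le).2.2, show 1 - (1 - α₂) + (1 - α₂) = 1 by ring, fracKernel_one ht,
      fracInt_one ht.le, hv.integral_deriv le_rfl ht.le]
    ring

/-- The equation of motion is equivalent to the four-dimensional fractional state equation. -/
theorem isStateTrajectory_iff_isMotion {m c₁ c₂ k α₁ α₂ : ℝ} (hm : 0 < m) (hα₁ : 0 < α₁)
    (hα : α₁ < α₂) (hα₂ : α₂ < 1) (f u x₁ x₂ x₃ x₄ : ℝ → ℝ) :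
    IsStateTrajectory m c₁ c₂ k α₁ α₂ f u x₁ x₂ x₃ x₄ ↔
      IsMotion m c₁ c₂ k α₁ α₂ f u x₁ ∧
        ∀ t : ℝ, 0 ≤ t → x₂ t = caputo α₁ x₁ t ∧ x₃ t = caputo α₂ x₁ t ∧
          x₄ t = velocity x₁ t := by
  constructor
  · intro h
    have hv : EqOn x₄ (velocity x₁) (Ici 0) := fun t ht =>
      (h.frac.velocity_eq hα₁ hα hα₂ ht).symm
    have hc : ∀ {α : ℝ} t, 0 ≤ t → caputo α x₁ t = fracInt (1 - α) x₄ t := fun t ht => by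
      rw [caputo_eq_fracInt ht]
      refine fracInt_congr ht (Eventually.of_forall fun s hs => ?_)
      rw [hv hs.1.le, velocity_eq_deriv x₁ hs.1]
    have hX : ∀ t : ℝ, 0 ≤ t → x₂ t = caputo α₁ x₁ t ∧ x₃ t = caputo α₂ x₁ t ∧
        x₄ t = velocity x₁ t := by
      intro t ht
      obtain ⟨h2, h3, -⟩ := h.frac.eq_fracInt hα₁ hα hα₂ ht
      exact ⟨by rw [h2, hc t ht], by rw [h3, hc t ht], hv ht⟩
    refine ⟨⟨(h.frac.hasDerivWithinAt hα₁ hα hα₂).1, h.frac.locAC₄.congr hv, ?_⟩, hX⟩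
    filter_upwards [h.eq₄, ae_restrict_mem measurableSet_Ioi] with t ht h0
    obtain ⟨h2, h3, -⟩ := hX t (le_of_lt h0)
    rw [← (eventuallyEq_nhds_of_eqOn_Ici hv h0).deriv_eq, ← h2, ← h3, ht]
    field_simp
    ring
  · rintro ⟨h, hX⟩
    refine ⟨fractionalPart_of_contDiffOn hα₁ hα hα₂ h.contDiffOn h.locAC_velocity hX, ?_⟩
    filter_upwards [h.eq, ae_restrict_mem measurableSet_Ioi] with t ht h0
    obtain ⟨h2, h3, -⟩ := hX t (le_of_lt h0)
    have hv : EqOn x₄ (velocity x₁) (Ici 0) := fun t ht => (hX t ht).2.2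
    rw [(eventuallyEq_nhds_of_eqOn_Ici hv h0).deriv_eq, h2, h3]
    field_simp
    linarith

/-! ### The sliding variable -/

lemma FractionalPart.continuousOn {α₁ α₂ : ℝ} {x₁ x₂ x₃ x₄ : ℝ → ℝ}
    (h : FractionalPart α₁ α₂ x₁ x₂ x₃ x₄) :
    ContinuousOn x₁ (Ici 0) ∧ ContinuousOn x₂ (Ici 0) ∧ ContinuousOn x₃ (Ici 0) ∧
      ContinuousOn x₄ (Ici 0) :=
  ⟨h.eq₁.locAC.continuousOn, h.eq₂.locAC.continuousOn, h.eq₃.locAC.continuousOn,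
    h.locAC₄.continuousOn⟩

/-- The integral part of the sliding variable is continuously differentiable. -/
lemma FractionalPart.hasDerivAt_slidingVar_sub {m c₁ c₂ k α₁ α₂ : ℝ} {x₁ x₂ x₃ x₄ : ℝ → ℝ}
    (h : FractionalPart α₁ α₂ x₁ x₂ x₃ x₄) {t : ℝ} (ht : 0 < t) :
    HasDerivAt (fun t => slidingVar m c₁ c₂ k x₁ x₂ x₃ x₄ t - x₄ t)
      (k / m * x₁ t + c₁ / m * x₂ t + c₂ / m * x₃ t) t := by
  obtain ⟨h1, h2, h3, -⟩ := h.continuousOn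
  have := (((hasDerivAt_integral_of_continuousOn h1 ht).const_mul (k / m)).add
    ((hasDerivAt_integral_of_continuousOn h2 ht).const_mul (c₁ / m))).add
    ((hasDerivAt_integral_of_continuousOn h3 ht).const_mul (c₂ / m))
  refine this.congr_of_eventuallyEq (Eventually.of_forall fun t => ?_)
  simp only [slidingVar, Pi.add_apply]
  ring

lemma FractionalPart.locAC_slidingVar {m c₁ c₂ k α₁ α₂ : ℝ} {x₁ x₂ x₃ x₄ : ℝ → ℝ}
    (h : FractionalPart α₁ α₂ x₁ x₂ x₃ x₄) : LocAC (slidingVar m c₁ c₂ k x₁ x₂ x₃ x₄) := by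
  obtain ⟨h1, h2, h3, -⟩ := h.continuousOn
  have key : ∀ {x : ℝ → ℝ} (c : ℝ), ContinuousOn x (Ici 0) → ∀ T, 0 < T →
      AbsolutelyContinuousOnInterval (fun t => c * ∫ s in (0 : ℝ)..t, x s) 0 T :=
    fun c hx T hT => AbsolutelyContinuousOnInterval.const_mul c
      ((intervalIntegrable_of_continuousOn_Ici hx le_rfl
        hT.le).absolutelyContinuousOnInterval_intervalIntegral left_mem_uIcc)
  intro T hT
  exact (((h.locAC₄ T hT).fun_add (key _ h1 T hT)).fun_add (key _ h2 T hT)).fun_add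
    (key _ h3 T hT)

theorem IsStateTrajectory.ae_hasDerivAt_slidingVar {m c₁ c₂ k α₁ α₂ : ℝ}
    {f u x₁ x₂ x₃ x₄ : ℝ → ℝ} (h : IsStateTrajectory m c₁ c₂ k α₁ α₂ f u x₁ x₂ x₃ x₄) :
    ∀ᵐ t ∂(volume.restrict (Ioi (0 : ℝ))),
      HasDerivAt (slidingVar m c₁ c₂ k x₁ x₂ x₃ x₄) ((f t + u t) / m) t := by
  filter_upwards [h.eq₄, ae_restrict_mem measurableSet_Ioi,
    ae_restrict_of_ae h.frac.locAC₄.ae_differentiableAt] with t ht h0 hd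
  have h0 : 0 < t := h0
  have := (h.frac.hasDerivAt_slidingVar_sub (m := m) (c₁ := c₁) (c₂ := c₂) (k := k) h0).add
    (hd h0.le).hasDerivAt
  rw [ht] at this
  refine (this.congr_of_eventuallyEq (Eventually.of_forall fun s => ?_)).congr_deriv ?_
  · simp
  · ring

theorem IsStateTrajectory.slidingVar_eq_iff {m c₁ c₂ k α₁ α₂ : ℝ}
    {f u x₁ x₂ x₃ x₄ : ℝ → ℝ} (h : IsStateTrajectory m c₁ c₂ k α₁ α₂ f u x₁ x₂ x₃ x₄) :
    (∀ t : ℝ, 0 ≤ t → slidingVar m c₁ c₂ k x₁ x₂ x₃ x₄ t = slidingVar m c₁ c₂ k x₁ x₂ x₃ x₄ 0) ↔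
      IsSlidingTrajectory m c₁ c₂ k α₁ α₂ x₁ x₂ x₃ x₄ := by
  have hs := h.ae_hasDerivAt_slidingVar
  constructor
  · intro hconst
    refine ⟨h.frac, ?_⟩
    filter_upwards [hs, h.eq₄, ae_restrict_mem measurableSet_Ioi] with t ht h4 h0
    have h1 : HasDerivAt (slidingVar m c₁ c₂ k x₁ x₂ x₃ x₄) 0 t :=
      (hasDerivAt_const t _).congr_of_eventuallyEq
        (eventuallyEq_nhds_of_eqOn_Ici (fun s hs => hconst s hs) h0)
    have := ht.unique h1
    rw [h4]
    linear_combination this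
  · intro hsl t ht
    -- Comparing the two equations for `deriv x₄` shows that the derivative of `s` vanishes almost
    -- everywhere; absolute continuity upgrades this to constancy.
    have hac := h.frac.locAC_slidingVar (m := m) (c₁ := c₁) (c₂ := c₂) (k := k)
    rw [← sub_eq_zero, ← hac.integral_deriv le_rfl ht,
      intervalIntegral.integral_of_le ht]
    refine setIntegral_eq_zero_of_ae_eq_zero ?_
    have h1 := hs.and (h.eq₄.and hsl.eq₄)
    rw [ae_restrict_iff' measurableSet_Ioi] at h1
    filter_upwards [h1] with s h1 hs
    obtain ⟨h1, h2, h3⟩ := h1 hs.1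
    rw [h1.deriv]
    linear_combination h3 - h2

/-! ### Diffusive states -/

/-- The diffusive state driven by `v`, given by Duhamel's formula. -/
def diffState (v : ℝ → ℝ) (ω t : ℝ) : ℝ :=
  Real.exp (-(ω * t)) * ∫ τ in (0 : ℝ)..t, Real.exp (ω * τ) * v (max τ 0)

@[simp] lemma diffState_zero (v : ℝ → ℝ) (ω : ℝ) : diffState v ω 0 = 0 := by simp [diffState]

lemma continuous_diffState {v : ℝ → ℝ} (hv : ContinuousOn v (Ici 0)) :
    Continuous fun p : ℝ × ℝ => diffState v p.1 p.2 := by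
  have hc := continuous_comp_max_zero hv
  refine Continuous.mul (by fun_prop) ?_
  refine intervalIntegral.continuous_parametric_intervalIntegral_of_continuous
    (f := fun (p : ℝ × ℝ) τ => Real.exp (p.1 * τ) * v (max τ 0)) ?_ continuous_snd
  exact Continuous.mul (by fun_prop) (hc.comp continuous_snd)

lemma continuous_diffState_left {v : ℝ → ℝ} (hv : ContinuousOn v (Ici 0)) (t : ℝ) :
    Continuous fun ω => diffState v ω t :=
  (continuous_diffState hv).comp (continuous_id.prodMk continuous_const)

lemma continuous_diffState_right {v : ℝ → ℝ} (hv : ContinuousOn v (Ici 0)) (ω : ℝ) :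
    Continuous fun t => diffState v ω t :=
  (continuous_diffState hv).comp (continuous_const.prodMk continuous_id)

lemma hasDerivAt_diffState {v : ℝ → ℝ} (hv : ContinuousOn v (Ici 0)) (ω t : ℝ) :
    HasDerivAt (diffState v ω) (-ω * diffState v ω t + v (max t 0)) t := by
  have hc : Continuous fun τ => Real.exp (ω * τ) * v (max τ 0) :=
    Continuous.mul (by fun_prop) (continuous_comp_max_zero hv)
  have h1 := intervalIntegral.integral_hasDerivAt_right (hc.intervalIntegrable 0 t)
    (hc.stronglyMeasurableAtFilter _ _) hc.continuousAt
  have h2 : HasDerivAt (fun t => Real.exp (-(ω * t))) (Real.exp (-(ω * t)) * -ω) t := by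
    have := ((hasDerivAt_id t).const_mul ω).neg.exp
    simpa using this
  refine (h2.mul h1).congr_deriv ?_
  rw [diffState, ← mul_assoc, ← Real.exp_add, neg_add_cancel, Real.exp_zero]
  ring

lemma isDiffusiveState_diffState {v : ℝ → ℝ} (hv : ContinuousOn v (Ici 0)) :
    IsDiffusiveState v (diffState v) := by
  refine fun ω _ => ⟨diffState_zero v ω, fun t ht => ?_⟩
  have := (hasDerivAt_diffState hv ω t).hasDerivWithinAt (s := Ici 0)
  rwa [max_eq_left ht] at this

/-- The integrating factor e^(ωt) turns the difference of two solutions into a function with zero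
right derivative. Besides uniqueness of diffusive states, this serves to verify identities for
`diffState` by checking the differential equation. -/
lemma eq_diffState {v ζ : ℝ → ℝ} (hv : ContinuousOn v (Ici 0)) {ω : ℝ} (h0 : ζ 0 = 0)
    (hζ : ∀ t, 0 ≤ t → HasDerivWithinAt ζ (-ω * ζ t + v t) (Ici 0) t) {t : ℝ} (ht : 0 ≤ t) :
    ζ t = diffState v ω t := by
  let g : ℝ → ℝ := fun t => Real.exp (ω * t) * (ζ t - diffState v ω t)
  have hg : ∀ t, 0 ≤ t → HasDerivWithinAt g 0 (Ici 0) t := by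
    intro t ht
    have h1 : HasDerivAt (fun t => Real.exp (ω * t)) (Real.exp (ω * t) * ω) t := by
      simpa using ((hasDerivAt_id t).const_mul ω).exp
    have h2 := (hasDerivAt_diffState hv ω t).hasDerivWithinAt (s := Ici 0)
    rw [max_eq_left ht] at h2
    refine (h1.hasDerivWithinAt.mul ((hζ t ht).sub h2)).congr_deriv ?_
    simp only [Pi.sub_apply]
    ring
  have := constant_of_has_deriv_right_zero (f := g) (a := 0) (b := t)
    (fun s hs => (hg s hs.1).continuousWithinAt.mono fun _ h => h.1)
    (fun s hs => (hg s hs.1).mono (Ici_subset_Ici.2 hs.1)) t ⟨ht, le_rfl⟩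
  simp only [g, h0, diffState_zero, sub_zero, mul_zero, mul_eq_zero, (Real.exp_pos _).ne',
    false_or] at this
  linarith

lemma IsDiffusiveState.eq_diffState {v : ℝ → ℝ} {z : ℝ → ℝ → ℝ} (hv : ContinuousOn v (Ici 0))
    (hz : IsDiffusiveState v z) {ω t : ℝ} (hω : 0 < ω) (ht : 0 ≤ t) :
    z ω t = diffState v ω t :=
  FracOsc.eq_diffState hv (hz ω hω).1 (hz ω hω).2 ht

lemma abs_diffState_le_mul {v : ℝ → ℝ} {ω t C : ℝ} (hω : 0 < ω) (ht : 0 ≤ t)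
    (hC : ∀ τ ∈ Icc 0 t, |v τ| ≤ C) : |diffState v ω t| ≤ C * t := by
  have h : ‖∫ τ in (0 : ℝ)..t, Real.exp (ω * τ) * v (max τ 0)‖ ≤
      Real.exp (ω * t) * C * |t - 0| := by
    refine intervalIntegral.norm_integral_le_of_norm_le_const fun τ hτ => ?_
    rw [uIoc_of_le ht] at hτ
    rw [norm_mul, Real.norm_of_nonneg (Real.exp_pos _).le, max_eq_left hτ.1.le, Real.norm_eq_abs]
    have := hC τ ⟨hτ.1.le, hτ.2⟩
    have h2 := hτ.2
    gcongr
  rw [diffState, abs_mul, abs_of_pos (Real.exp_pos _)]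
  rw [sub_zero, abs_of_nonneg ht, Real.norm_eq_abs] at h
  calc _ ≤ Real.exp (-(ω * t)) * (Real.exp (ω * t) * C * t) := by gcongr
    _ = (Real.exp (-(ω * t)) * Real.exp (ω * t)) * (C * t) := by ring
    _ = C * t := by rw [← Real.exp_add, neg_add_cancel, Real.exp_zero, one_mul]

lemma integral_exp_mul {ω t : ℝ} (hω : ω ≠ 0) :
    ∫ τ in (0 : ℝ)..t, Real.exp (ω * τ) = (Real.exp (ω * t) - 1) / ω := by
  rw [intervalIntegral.integral_eq_sub_of_hasDerivAt (f := fun τ => Real.exp (ω * τ) / ω)]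
  · simp [sub_div]
  · intro x _
    have h1 : HasDerivAt (fun t => Real.exp (ω * t)) (Real.exp (ω * x) * ω) x := by
      simpa using ((hasDerivAt_id x).const_mul ω).exp
    refine (h1.div_const ω).congr_deriv ?_
    field_simp
  · exact Continuous.intervalIntegrable (by fun_prop) _ _

/-- The kernel e^(-ω(t-τ)) has mass at most 1/ω. This is the bound for high frequencies, whereas C t
serves for low ones. -/
lemma abs_diffState_le_div {v : ℝ → ℝ} {ω t C : ℝ} (hω : 0 < ω) (ht : 0 ≤ t)
    (hC : ∀ τ ∈ Icc 0 t, |v τ| ≤ C) : |diffState v ω t| ≤ C / ω := by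
  have hC0 : 0 ≤ C := (abs_nonneg _).trans (hC 0 ⟨le_rfl, ht⟩)
  have h : ‖∫ τ in (0 : ℝ)..t, Real.exp (ω * τ) * v (max τ 0)‖ ≤
      ∫ τ in (0 : ℝ)..t, Real.exp (ω * τ) * C := by
    refine intervalIntegral.norm_integral_le_of_norm_le ht (Eventually.of_forall fun τ hτ => ?_)
      (Continuous.intervalIntegrable (by fun_prop) _ _)
    rw [norm_mul, Real.norm_of_nonneg (Real.exp_pos _).le, max_eq_left hτ.1.le, Real.norm_eq_abs]
    have := hC τ ⟨hτ.1.le, hτ.2⟩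
    gcongr
  rw [intervalIntegral.integral_mul_const, integral_exp_mul hω.ne', Real.norm_eq_abs] at h
  rw [diffState, abs_mul, abs_of_pos (Real.exp_pos _)]
  calc _ ≤ Real.exp (-(ω * t)) * ((Real.exp (ω * t) - 1) / ω * C) := by gcongr
    _ = (Real.exp (-(ω * t)) * Real.exp (ω * t) - Real.exp (-(ω * t))) * (C / ω) := by ring
    _ ≤ 1 * (C / ω) := by
      have := Real.exp_pos (-(ω * t))
      rw [← Real.exp_add, neg_add_cancel, Real.exp_zero]
      gcongr
      linarith
    _ = C / ω := one_mul _

/-- Integration by parts in Duhamel's formula. -/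
lemma diffState_eq_sub {x v : ℝ → ℝ} (hv : ContinuousOn v (Ici 0))
    (hx : ∀ t, 0 ≤ t → HasDerivWithinAt x (v t) (Ici 0) t) {ω t : ℝ} (ht : 0 ≤ t) :
    diffState v ω t = x t - Real.exp (-(ω * t)) * x 0 - ω * diffState x ω t := by
  have hxc : ContinuousOn x (Ici 0) := fun t ht => (hx t ht).continuousWithinAt
  refine (eq_diffState (ζ := fun t => x t - Real.exp (-(ω * t)) * x 0 - ω * diffState x ω t) hv
    (by simp) (fun t ht => ?_) ht).symm
  have h2 : HasDerivAt (fun t => Real.exp (-(ω * t))) (Real.exp (-(ω * t)) * -ω) t := by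
    have := ((hasDerivAt_id t).const_mul ω).neg.exp
    simpa using this
  have h3 := (hasDerivAt_diffState hxc ω t).hasDerivWithinAt (s := Ici 0)
  rw [max_eq_left ht] at h3
  refine (((hx t ht).sub (h2.mul_const (x 0)).hasDerivWithinAt).sub (h3.const_mul ω)).congr_deriv ?_
  ring

/-- The decay profile `min(1, 1/ω)` of bounded diffusive states. -/
def decay (ω : ℝ) : ℝ := min 1 ω⁻¹

lemma decay_pos {ω : ℝ} (hω : 0 < ω) : 0 < decay ω := lt_min one_pos (inv_pos.2 hω)

lemma decay_le_one (ω : ℝ) : decay ω ≤ 1 := min_le_left _ _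

lemma mul_decay_le_one {ω : ℝ} (hω : 0 < ω) : ω * decay ω ≤ 1 := by
  calc ω * decay ω ≤ ω * ω⁻¹ := by
        have := min_le_right 1 ω⁻¹
        unfold decay
        gcongr
    _ = 1 := mul_inv_cancel₀ hω.ne'

lemma le_mul_decay {a A B ω : ℝ} (h1 : a ≤ A) (h2 : a ≤ A / ω) (hB : A ≤ B) (hω : 0 < ω) :
    a ≤ B * decay ω := by
  unfold decay
  rcases min_cases 1 ω⁻¹ with ⟨h, -⟩ | ⟨h, -⟩ <;> rw [h]
  · linarith
  · have := inv_pos.2 hω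
    rw [div_eq_mul_inv] at h2
    nlinarith

lemma abs_diffState_le_of_le {v : ℝ → ℝ} {ω t C R : ℝ} (hω : 0 < ω) (ht : 0 ≤ t) (htR : t ≤ R)
    (hC : ∀ τ ∈ Icc 0 t, |v τ| ≤ C) : |diffState v ω t| ≤ C * max R 1 * decay ω := by
  have hC0 : 0 ≤ C := (abs_nonneg _).trans (hC 0 ⟨le_rfl, ht⟩)
  refine le_mul_decay (A := C * max R 1) ?_ ?_ le_rfl hω
  · exact (abs_diffState_le_mul hω ht hC).trans
      (mul_le_mul_of_nonneg_left (htR.trans (le_max_left _ _)) hC0)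
  · refine (abs_diffState_le_div hω ht hC).trans ?_
    gcongr
    exact le_mul_of_one_le_right hC0 (le_max_right _ _)

/-- A bound for the diffusive states which is uniform in time. -/
lemma abs_diffState_le_decay {x v : ℝ → ℝ} (hv : ContinuousOn v (Ici 0))
    (hx : ∀ t, 0 ≤ t → HasDerivWithinAt x (v t) (Ici 0) t) {ω t A : ℝ} (hω : 0 < ω) (ht : 0 ≤ t)
    (hA : ∀ τ ∈ Icc 0 t, |x τ| ≤ A) (hB : ∀ τ ∈ Icc 0 t, |v τ| ≤ A) :
    |diffState v ω t| ≤ 3 * A * decay ω := by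
  have hA0 : 0 ≤ A := (abs_nonneg _).trans (hA 0 ⟨le_rfl, ht⟩)
  refine le_mul_decay (A := 3 * A) ?_ ?_ le_rfl hω
  -- At low frequencies the bound A t would grow with time. After integration by parts each of the
  -- three terms is at most A, because the filter driven by `x` is bounded by A/ω.
  · rw [diffState_eq_sub hv hx ht]
    have h1 : |ω * diffState x ω t| ≤ A := by
      rw [abs_mul, abs_of_pos hω]
      have := abs_diffState_le_div hω ht hA
      rw [le_div_iff₀ hω] at this
      linarith
    have h2 : |Real.exp (-(ω * t)) * x 0| ≤ A := by
      rw [abs_mul, abs_of_pos (Real.exp_pos _)]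
      have h3 : Real.exp (-(ω * t)) ≤ 1 := Real.exp_le_one_iff.2 (by nlinarith)
      calc _ ≤ 1 * |x 0| := by gcongr
        _ ≤ A := by simpa using hA 0 ⟨le_rfl, ht⟩
    have h3 := hA t ⟨ht, le_rfl⟩
    have := abs_sub (x t - Real.exp (-(ω * t)) * x 0) (ω * diffState x ω t)
    have := abs_sub (x t) (Real.exp (-(ω * t)) * x 0)
    linarith
  · refine (abs_diffState_le_div hω ht hB).trans ?_
    gcongr
    linarith

/-! ### Weighted integrals over the frequencies -/

lemma freqWeight_pos {β ω : ℝ} (hβ : 0 < β) (hβ' : β < 1) (hω : 0 < ω) : 0 < freqWeight β ω := by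
  have : 0 < Real.sin (β * Real.pi) :=
    Real.sin_pos_of_pos_of_lt_pi (by positivity) (by nlinarith [Real.pi_pos])
  have := Real.pi_pos
  unfold freqWeight
  positivity

lemma measurable_freqWeight (β : ℝ) : Measurable (freqWeight β) := by
  unfold freqWeight
  fun_prop

/-- Near 0 the power ω^(-β) is integrable since β < 1; near infinity the decay profile improves it
to ω^(-β-1). -/
lemma integrableOn_freqWeight_mul_decay {β : ℝ} (hβ : 0 < β) (hβ' : β < 1) :
    IntegrableOn (fun ω => freqWeight β ω * decay ω) (Ioi 0) := by
  rw [← Ioc_union_Ioi_eq_Ioi zero_le_one]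
  refine IntegrableOn.union ?_ ?_
  · have h := (intervalIntegral.intervalIntegrable_rpow' (a := 0) (b := 1) (r := -β)
      (by linarith)).const_mul (Real.sin (β * Real.pi) / Real.pi)
    rw [intervalIntegrable_iff_integrableOn_Ioc_of_le zero_le_one] at h
    refine h.congr_fun (fun ω hω => ?_) measurableSet_Ioc
    simp [freqWeight, decay, min_eq_left ((one_le_inv₀ hω.1).2 hω.2)]
  · have h := (integrableOn_Ioi_rpow_of_lt (a := -β - 1) (by linarith) one_pos).const_mul
      (Real.sin (β * Real.pi) / Real.pi)
    refine IntegrableOn.congr_fun h (fun ω hω => ?_) measurableSet_Ioi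
    have hω : 1 < ω := hω
    simp only [freqWeight, decay, min_eq_right (inv_le_one_of_one_le₀ hω.le)]
    rw [Real.rpow_sub_one (by linarith)]
    ring

/-- A majorant for the weighted integrals of a diffusive state. -/
def majorant (β : ℝ) : ℝ := ∫ ω in Ioi (0 : ℝ), freqWeight β ω * decay ω

section Weighted

variable {β K : ℝ} (hβ : 0 < β) (hβ' : β < 1) {ζ : ℝ → ℝ}

include hβ hβ'

lemma majorant_nonneg : 0 ≤ majorant β :=
  setIntegral_nonneg measurableSet_Ioi fun _ hω =>
    (mul_pos (freqWeight_pos hβ hβ' hω) (decay_pos hω)).le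

lemma norm_freqWeight_mul_le (h : ∀ ω, 0 < ω → |ζ ω| ≤ K * decay ω) {ω : ℝ} (hω : 0 < ω) :
    ‖freqWeight β ω * ζ ω‖ ≤ K * (freqWeight β ω * decay ω) := by
  have hw := freqWeight_pos hβ hβ' hω
  rw [norm_mul, Real.norm_of_nonneg hw.le, Real.norm_eq_abs]
  have := mul_le_mul_of_nonneg_left (h ω hω) hw.le
  linarith

lemma integrableOn_freqWeight_mul (hζ : Continuous ζ)
    (h : ∀ ω, 0 < ω → |ζ ω| ≤ K * decay ω) :
    IntegrableOn (fun ω => freqWeight β ω * ζ ω) (Ioi 0) := by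
  refine Integrable.mono' ((integrableOn_freqWeight_mul_decay hβ hβ').const_mul K)
    ((measurable_freqWeight β).mul hζ.measurable).aestronglyMeasurable ?_
  filter_upwards [ae_restrict_mem measurableSet_Ioi] with ω hω
  exact norm_freqWeight_mul_le hβ hβ' h hω

lemma abs_integral_freqWeight_mul_le (h : ∀ ω, 0 < ω → |ζ ω| ≤ K * decay ω) :
    |∫ ω in Ioi (0 : ℝ), freqWeight β ω * ζ ω| ≤ K * majorant β := by
  rw [majorant, ← integral_const_mul, ← Real.norm_eq_abs]
  refine norm_integral_le_of_norm_le ((integrableOn_freqWeight_mul_decay hβ hβ').const_mul K) ?_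
  filter_upwards [ae_restrict_mem measurableSet_Ioi] with ω hω
  exact norm_freqWeight_mul_le hβ hβ' h hω

end Weighted

lemma abs_sq_le_decay {a K ω : ℝ} (hω : 0 < ω) (h : |a| ≤ K * decay ω) :
    |a ^ 2| ≤ K ^ 2 * decay ω := by
  have hd := decay_pos hω
  have h1 := decay_le_one ω
  rw [abs_pow]
  calc |a| ^ 2 ≤ (K * decay ω) ^ 2 := by gcongr
    _ = K ^ 2 * decay ω * decay ω := by ring
    _ ≤ K ^ 2 * decay ω * 1 := by gcongr
    _ = _ := mul_one _

/-- One of the two decay factors absorbs ω and the other remains as a majorant, so the dissipation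
integrals converge. -/
lemma abs_mul_sq_le_decay {a K ω : ℝ} (hω : 0 < ω) (h : |a| ≤ K * decay ω) :
    |ω * a ^ 2| ≤ K ^ 2 * decay ω := by
  have hd := decay_pos hω
  have h1 := mul_decay_le_one hω
  rw [abs_mul, abs_pow, abs_of_pos hω]
  calc ω * |a| ^ 2 ≤ ω * (K * decay ω) ^ 2 := by gcongr
    _ = K ^ 2 * decay ω * (ω * decay ω) := by ring
    _ ≤ K ^ 2 * decay ω * 1 := by gcongr
    _ = _ := mul_one _

/-- On bounded time intervals, the diffusive states are dominated by the decay profile. -/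
lemma exists_abs_diffState_le {v : ℝ → ℝ} (hv : ContinuousOn v (Ici 0)) (R : ℝ) :
    ∃ K, 0 ≤ K ∧ (∀ t ∈ Icc 0 R, |v t| ≤ K) ∧
      ∀ t ∈ Icc 0 R, ∀ ω, 0 < ω → |diffState v ω t| ≤ K * decay ω := by
  obtain ⟨C, hC⟩ := isCompact_Icc.exists_bound_of_continuousOn (s := Icc 0 R)
    (hv.mono fun _ h => h.1)
  have hC0 : C ≤ |C| * max R 1 := (le_abs_self C).trans
    (le_mul_of_one_le_right (abs_nonneg C) (le_max_right _ _))
  refine ⟨|C| * max R 1, by positivity, fun t ht => (hC t ht).trans hC0, fun t ht ω hω => ?_⟩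
  exact abs_diffState_le_of_le hω ht.1 ht.2 fun τ hτ =>
    (hC τ ⟨hτ.1, hτ.2.trans ht.2⟩).trans (le_abs_self C)

section

variable {v : ℝ → ℝ} (hv : ContinuousOn v (Ici 0)) {β t : ℝ} (hβ : 0 < β) (hβ' : β < 1)

include hv hβ hβ'

lemma integrableOn_diffState (ht : 0 ≤ t) :
    IntegrableOn (fun ω => freqWeight β ω * diffState v ω t) (Ioi 0) := by
  obtain ⟨K, -, -, hK⟩ := exists_abs_diffState_le hv t
  exact integrableOn_freqWeight_mul hβ hβ' (continuous_diffState_left hv t) (hK t ⟨ht, le_rfl⟩)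

lemma integrableOn_diffState_sq (ht : 0 ≤ t) :
    IntegrableOn (fun ω => freqWeight β ω * diffState v ω t ^ 2) (Ioi 0) := by
  obtain ⟨K, -, -, hK⟩ := exists_abs_diffState_le hv t
  exact integrableOn_freqWeight_mul hβ hβ' ((continuous_diffState_left hv t).pow 2)
    fun ω hω => abs_sq_le_decay hω (hK t ⟨ht, le_rfl⟩ ω hω)

lemma integrableOn_mul_diffState_sq (ht : 0 ≤ t) :
    IntegrableOn (fun ω => ω * freqWeight β ω * diffState v ω t ^ 2) (Ioi 0) := by
  obtain ⟨K, -, -, hK⟩ := exists_abs_diffState_le hv t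
  refine (integrableOn_freqWeight_mul hβ hβ'
    (continuous_id.mul ((continuous_diffState_left hv t).pow 2))
    fun ω hω => abs_mul_sq_le_decay hω (hK t ⟨ht, le_rfl⟩ ω hω)).congr_fun (fun ω _ => ?_)
    measurableSet_Ioi
  simp only [id, Pi.mul_apply, Pi.pow_apply]
  ring

/-- Continuity in time of weighted integrals of expressions in the diffusive state. -/
lemma continuousOn_integral_freqWeight {Φ : ℝ → ℝ → ℝ} (hΦ : Continuous fun p : ℝ × ℝ => Φ p.1 p.2)
    (hd : ∀ K, ∃ L, ∀ ω, 0 < ω → ∀ a, |a| ≤ K * decay ω → |Φ ω a| ≤ L * decay ω) :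
    ContinuousOn (fun t => ∫ ω in Ioi (0 : ℝ), freqWeight β ω * Φ ω (diffState v ω t)) (Ici 0) := by
  intro t ht
  obtain ⟨K, -, -, hK⟩ := exists_abs_diffState_le hv (t + 1)
  obtain ⟨L, hL⟩ := hd K
  refine continuousWithinAt_of_dominated (bound := fun ω => L * (freqWeight β ω * decay ω)) ?_ ?_
    ((integrableOn_freqWeight_mul_decay hβ hβ').const_mul L) ?_
  · refine Eventually.of_forall fun s => ?_
    exact ((measurable_freqWeight β).mul (hΦ.comp (continuous_id.prodMk
      (continuous_diffState_left hv s))).measurable).aestronglyMeasurable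
  · have : ∀ᶠ s in 𝓝[Ici 0] t, s ∈ Icc 0 (t + 1) := by
      filter_upwards [self_mem_nhdsWithin,
        mem_nhdsWithin_of_mem_nhds (Iic_mem_nhds (lt_add_one t))] with s h1 h2 using ⟨h1, h2⟩
    filter_upwards [this] with s hs
    filter_upwards [ae_restrict_mem measurableSet_Ioi] with ω hω
    exact norm_freqWeight_mul_le (ζ := fun ω => Φ ω (diffState v ω s)) hβ hβ'
      (fun ω hω => hL ω hω _ (hK s hs ω hω)) hω
  · refine Eventually.of_forall fun ω => Continuous.continuousWithinAt ?_
    exact continuous_const.mul (hΦ.comp (continuous_const.prodMk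
      (continuous_diffState_right hv ω)))

lemma continuousOn_integral_sq :
    ContinuousOn (fun t => ∫ ω in Ioi (0 : ℝ), freqWeight β ω * diffState v ω t ^ 2) (Ici 0) :=
  continuousOn_integral_freqWeight hv hβ hβ' (Φ := fun _ a => a ^ 2) (by fun_prop)
    fun K => ⟨K ^ 2, fun _ hω _ h => abs_sq_le_decay hω h⟩

lemma continuousOn_integral_mul_sq :
    ContinuousOn (fun t => ∫ ω in Ioi (0 : ℝ), ω * freqWeight β ω * diffState v ω t ^ 2)
      (Ici 0) := by
  have := continuousOn_integral_freqWeight hv hβ hβ' (Φ := fun ω a => ω * a ^ 2) (by fun_prop)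
    fun K => ⟨K ^ 2, fun _ hω _ h => abs_mul_sq_le_decay hω h⟩
  refine this.congr fun t _ => ?_
  simp only [mul_left_comm, mul_assoc]

/-- The balance law of the quadratic energy stored in a diffusive state. -/
lemma hasDerivAt_integral_sq (ht : 0 < t) :
    HasDerivAt (fun t => ∫ ω in Ioi (0 : ℝ), freqWeight β ω * diffState v ω t ^ 2)
      (-2 * (∫ ω in Ioi (0 : ℝ), ω * freqWeight β ω * diffState v ω t ^ 2)
        + 2 * v t * ∫ ω in Ioi (0 : ℝ), freqWeight β ω * diffState v ω t) t := by
  obtain ⟨K, hK0, hv1, hK⟩ := exists_abs_diffState_le hv (t + 1)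
  let F' : ℝ → ℝ → ℝ := fun s ω =>
    freqWeight β ω * (2 * diffState v ω s * (-ω * diffState v ω s + v (max s 0)))
  have hF'c : ∀ s, Continuous fun ω =>
      2 * diffState v ω s * (-ω * diffState v ω s + v (max s 0)) := fun s => by
    have := continuous_diffState_left hv s
    fun_prop
  -- Since ω z stays bounded by K, the time derivative 2z(-ωz + v) retains the decay of its first
  -- factor z and is dominated uniformly for times near `t`.
  have hb : ∀ s ∈ Ioo 0 (t + 1), ∀ ω, 0 < ω →
      |2 * diffState v ω s * (-ω * diffState v ω s + v (max s 0))| ≤ 4 * K ^ 2 * decay ω := by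
    intro s hs ω hω
    have h1 := hK s ⟨hs.1.le, hs.2.le⟩ ω hω
    have h2 := hv1 s ⟨hs.1.le, hs.2.le⟩
    have hd := decay_pos hω
    have h3 : |-ω * diffState v ω s + v (max s 0)| ≤ 2 * K := by
      rw [max_eq_left hs.1.le]
      have h4 : |-ω * diffState v ω s| ≤ K := by
        rw [abs_mul, abs_neg, abs_of_pos hω]
        calc ω * |diffState v ω s| ≤ ω * (K * decay ω) := by gcongr
          _ = K * (ω * decay ω) := by ring
          _ ≤ K * 1 := by
            have := mul_decay_le_one hω
            gcongr
          _ = K := mul_one K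
      have := abs_add_le (-ω * diffState v ω s) (v s)
      linarith
    rw [abs_mul, abs_mul, abs_two]
    calc _ ≤ 2 * (K * decay ω) * (2 * K) := by gcongr
      _ = _ := by ring
  have h := (hasDerivAt_integral_of_dominated_loc_of_deriv_le (μ := volume.restrict (Ioi (0 : ℝ)))
    (F := fun s ω => freqWeight β ω * diffState v ω s ^ 2) (F' := F') (x₀ := t)
    (s := Ioo 0 (t + 1)) (bound := fun ω => 4 * K ^ 2 * (freqWeight β ω * decay ω))
    (Ioo_mem_nhds ht (lt_add_one t)) ?_ (integrableOn_diffState_sq hv hβ hβ' ht.le) ?_ ?_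
    ((integrableOn_freqWeight_mul_decay hβ hβ').const_mul _) ?_).2
  · refine h.congr_deriv ?_
    rw [← integral_const_mul, ← integral_const_mul, ← integral_add
      ((integrableOn_mul_diffState_sq hv hβ hβ' ht.le).const_mul _)
      ((integrableOn_diffState hv hβ hβ' ht.le).const_mul _)]
    refine integral_congr_ae (Eventually.of_forall fun ω => ?_)
    simp only [F', max_eq_left ht.le]
    ring
  · refine Eventually.of_forall fun s => ?_
    exact ((measurable_freqWeight β).mul
      ((continuous_diffState_left hv s).pow 2).measurable).aestronglyMeasurable
  · exact ((measurable_freqWeight β).mul (hF'c t).measurable).aestronglyMeasurable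
  · filter_upwards [ae_restrict_mem measurableSet_Ioi] with ω hω s hs
    exact norm_freqWeight_mul_le (ζ := fun ω =>
      2 * diffState v ω s * (-ω * diffState v ω s + v (max s 0))) hβ hβ' (hb s hs) hω
  · refine Eventually.of_forall fun ω s _ => ?_
    refine (((hasDerivAt_diffState hv ω s).pow 2).const_mul (freqWeight β ω)).congr_deriv ?_
    simp [F']

end

/-! ### The diffusive representation of Riemann-Liouville integrals -/

/-- The Laplace transform of ω^(α-1) is Γ(α) r^(-α), and Euler's reflection formula turns sin(πα)
Γ(α)/π into 1/Γ(1-α). This identity dictates the weight. -/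
lemma integral_freqWeight_mul_exp {α r : ℝ} (hα : 0 < α) (hα' : α < 1) (hr : 0 < r) :
    ∫ ω in Ioi (0 : ℝ), freqWeight (1 - α) ω * Real.exp (-(r * ω)) = fracKernel (1 - α) r := by
  have h1 := Real.integral_rpow_mul_exp_neg_mul_Ioi hα hr
  have h2 := Real.Gamma_mul_Gamma_one_sub α
  have hs : 0 < Real.sin (Real.pi * α) :=
    Real.sin_pos_of_pos_of_lt_pi (by positivity) (by nlinarith [Real.pi_pos])
  have h3 : Real.sin ((1 - α) * Real.pi) = Real.sin (Real.pi * α) := by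
    rw [show (1 - α) * Real.pi = Real.pi - Real.pi * α by ring, Real.sin_pi_sub]
  have h4 := Real.Gamma_pos_of_pos (sub_pos.2 hα')
  have h5 := Real.pi_pos
  simp only [freqWeight, mul_assoc]
  rw [integral_const_mul, neg_sub, h1, h3, fracKernel_of_pos hr, sub_sub, add_comm, ← sub_sub,
    one_div, Real.inv_rpow hr.le, ← Real.rpow_neg hr.le]
  rw [eq_div_iff hs.ne'] at h2
  rw [eq_div_iff h4.ne']
  calc _ = r ^ (-α) * ((Real.Gamma α * Real.Gamma (1 - α) * Real.sin (Real.pi * α)) / Real.pi) := by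
        ring
    _ = r ^ (1 - 1 - α) := by rw [h2, div_self h5.ne', mul_one]; ring_nf

lemma integrableOn_freqWeight_mul_exp {α r : ℝ} (hα : 0 < α) (hα' : α < 1) (hr : 0 < r) :
    IntegrableOn (fun ω => freqWeight (1 - α) ω * Real.exp (-(r * ω))) (Ioi 0) := by
  apply Integrable.of_integral_ne_zero
  rw [integral_freqWeight_mul_exp hα hα' hr, fracKernel_of_pos hr]
  have := Real.Gamma_pos_of_pos (sub_pos.2 hα')
  positivity

/-- The frequency distributed model of the Riemann-Liouville integral of order `1 - α`. -/
theorem fracInt_eq_integral_freqWeight {α t : ℝ} {v : ℝ → ℝ} (hα : 0 < α) (hα' : α < 1)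
    (ht : 0 ≤ t) (hv : ContinuousOn v (Ici 0)) :
    fracInt (1 - α) v t = ∫ ω in Ioi (0 : ℝ), freqWeight (1 - α) ω * diffState v ω t := by
  set μ := (volume : Measure ℝ).restrict (Ioo 0 t) with hμ
  set ν := (volume : Measure ℝ).restrict (Ioi 0) with hν
  have hvm : AEStronglyMeasurable v μ :=
    (hv.mono fun _ h => h.1.le).aestronglyMeasurable measurableSet_Ioo
  let F : ℝ × ℝ → ℝ := fun p => freqWeight (1 - α) p.2 * Real.exp (-((t - p.1) * p.2)) * v p.1
  have hFm : AEStronglyMeasurable F (μ.prod ν) := by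
    refine AEStronglyMeasurable.mul ?_ hvm.comp_fst
    refine Measurable.aestronglyMeasurable ?_
    exact ((measurable_freqWeight _).comp measurable_snd).mul (by fun_prop)
  have hF : Integrable F (μ.prod ν) := by
    rw [integrable_prod_iff hFm]
    constructor
    · filter_upwards [ae_restrict_mem measurableSet_Ioo] with s hs
      exact (integrableOn_freqWeight_mul_exp hα hα' (sub_pos.2 hs.2)).mul_const (v s)
    · have hk := intervalIntegrable_fracKernel_mul_continuousOn (sub_pos.2 hα') ht
        (hv.mono (t := Icc 0 t) fun _ h => h.1)
      rw [intervalIntegrable_iff_integrableOn_Ioo_of_le ht] at hk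
      refine hk.norm.congr ?_
      filter_upwards [ae_restrict_mem measurableSet_Ioo] with s hs
      rw [norm_mul, Real.norm_of_nonneg (fracKernel_nonneg (sub_pos.2 hα') _),
        ← integral_freqWeight_mul_exp hα hα' (sub_pos.2 hs.2), ← integral_mul_const]
      refine setIntegral_congr_fun measurableSet_Ioi fun ω hω => ?_
      have := freqWeight_pos (sub_pos.2 hα') (by linarith) hω
      rw [norm_mul, Real.norm_of_nonneg (mul_pos this (Real.exp_pos _)).le]
  have hswap := integral_integral_swap (f := fun s ω => F (s, ω)) hF
  rw [fracInt, intervalIntegral.integral_of_le ht, integral_Ioc_eq_integral_Ioo]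
  calc ∫ s in Ioo 0 t, fracKernel (1 - α) (t - s) * v s = ∫ s, ∫ ω, F (s, ω) ∂ν ∂μ := by
        refine setIntegral_congr_fun measurableSet_Ioo fun s hs => ?_
        simp only [F]
        rw [integral_mul_const, integral_freqWeight_mul_exp hα hα' (sub_pos.2 hs.2)]
    _ = _ := hswap
    _ = _ := by
        refine setIntegral_congr_fun measurableSet_Ioi fun ω hω => ?_
        have key : ∫ s, Real.exp (-((t - s) * ω)) * v s ∂μ =
            ∫ s in Ioo 0 t, Real.exp (-(ω * t)) * (Real.exp (ω * s) * v (max s 0)) := by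
          refine setIntegral_congr_fun measurableSet_Ioo fun s hs => ?_
          rw [max_eq_left hs.1.le, ← mul_assoc, ← Real.exp_add]
          congr 2
          ring
        simp only [F, mul_assoc]
        rw [integral_const_mul (μ := μ), key, integral_const_mul, diffState,
          intervalIntegral.integral_of_le ht, integral_Ioc_eq_integral_Ioo]

/-! ### A vanishing Laplace transform -/

lemma integral_polynomial_exp_mul_eq_zero {V : ℝ → ℝ} {t : ℝ} (hV : Continuous V)
    (h : ∀ n : ℕ, ∫ τ in (0 : ℝ)..t, Real.exp ((n + 1) * τ) * V τ = 0) (p : Polynomial ℝ) :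
    ∫ τ in (0 : ℝ)..t, p.eval (Real.exp τ) * (Real.exp τ * V τ) = 0 := by
  have hc : ∀ p : Polynomial ℝ, IntervalIntegrable
      (fun τ => p.eval (Real.exp τ) * (Real.exp τ * V τ)) volume 0 t := fun p =>
    ((p.continuous.comp Real.continuous_exp).mul
      (Real.continuous_exp.mul hV)).intervalIntegrable _ _
  induction p using Polynomial.induction_on' with
  | add p q hp hq =>
    simp only [Polynomial.eval_add, add_mul]
    rw [intervalIntegral.integral_add (hc p) (hc q), hp, hq, add_zero]
  | monomial n a =>
    have : ∀ τ, (Polynomial.monomial n a).eval (Real.exp τ) * (Real.exp τ * V τ) =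
        a * (Real.exp ((n + 1) * τ) * V τ) := fun τ => by
      rw [Polynomial.eval_monomial, add_mul, Real.exp_add, one_mul, Real.exp_nat_mul]
      ring
    simp_rw [this]
    rw [intervalIntegral.integral_const_mul, h n, mul_zero]

/-- A continuous function on `[0, t]` all of whose exponential moments vanish is zero. -/
lemma eq_zero_of_exp_moments {V : ℝ → ℝ} {t : ℝ} (ht : 0 < t) (hV : Continuous V)
    (h : ∀ n : ℕ, ∫ τ in (0 : ℝ)..t, Real.exp ((n + 1) * τ) * V τ = 0) :
    ∀ τ ∈ Icc 0 t, V τ = 0 := by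
  have hcW : Continuous fun τ => V τ * (Real.exp τ * V τ) := by fun_prop
  have hpos : ∀ τ, 0 ≤ V τ * (Real.exp τ * V τ) := fun τ => by
    have := Real.exp_pos τ
    nlinarith [mul_self_nonneg (V τ), mul_nonneg this.le (mul_self_nonneg (V τ))]
  have hsmall : ∀ ε, 0 < ε → ∫ τ in (0 : ℝ)..t, V τ * (Real.exp τ * V τ) ≤
      ε * ∫ τ in (0 : ℝ)..t, |Real.exp τ * V τ| := by
    intro ε hε
    -- In the variable y = e^τ the moments are moments against powers of y, so Weierstrass
    -- approximation of `V ∘ log` on [1, e^t] applies. The spare factor e^τ, coming from the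
    -- exponents n + 1, acts as a positive weight.
    obtain ⟨p, hp⟩ := exists_polynomial_near_of_continuousOn 1 (Real.exp t)
      (fun y => V (Real.log y))
      (hV.comp_continuousOn (Real.continuousOn_log.mono fun y hy => by
        simp only [mem_compl_iff, mem_singleton_iff]; linarith [hy.1])) ε hε
    have hi : IntervalIntegrable (fun τ => p.eval (Real.exp τ) * (Real.exp τ * V τ))
        volume 0 t :=
      ((p.continuous.comp Real.continuous_exp).mul
        (Real.continuous_exp.mul hV)).intervalIntegrable _ _
    have hsub : ∫ τ in (0 : ℝ)..t, V τ * (Real.exp τ * V τ) = ∫ τ in (0 : ℝ)..t,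
        (V τ * (Real.exp τ * V τ) - p.eval (Real.exp τ) * (Real.exp τ * V τ)) := by
      rw [intervalIntegral.integral_sub (hcW.intervalIntegrable _ _) hi,
        integral_polynomial_exp_mul_eq_zero hV h p, sub_zero]
    rw [hsub, ← intervalIntegral.integral_const_mul]
    refine intervalIntegral.integral_mono_on ht.le ((hcW.intervalIntegrable _ _).sub hi)
      (Continuous.intervalIntegrable (by fun_prop) _ _) fun τ hτ => ?_
    have h1 := hp (Real.exp τ) ⟨Real.one_le_exp hτ.1, Real.exp_le_exp.2 hτ.2⟩
    rw [Real.log_exp, abs_sub_comm] at h1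
    rw [← sub_mul]
    calc _ ≤ |(V τ - p.eval (Real.exp τ)) * (Real.exp τ * V τ)| := le_abs_self _
      _ = |V τ - p.eval (Real.exp τ)| * |Real.exp τ * V τ| := abs_mul _ _
      _ ≤ _ := by gcongr
  have hzero : ∫ τ in (0 : ℝ)..t, V τ * (Real.exp τ * V τ) = 0 := by
    refine le_antisymm ?_ (intervalIntegral.integral_nonneg ht.le fun τ _ => hpos τ)
    refine le_of_forall_pos_le_add fun ε hε => ?_
    set I := ∫ τ in (0 : ℝ)..t, |Real.exp τ * V τ| with hI
    have hI0 : 0 ≤ I := intervalIntegral.integral_nonneg ht.le fun τ _ => abs_nonneg _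
    refine (hsmall (ε / (I + 1)) (by positivity)).trans ?_
    rw [zero_add, div_mul_eq_mul_div, div_le_iff₀ (by positivity)]
    nlinarith
  rw [intervalIntegral.integral_of_le ht.le, ← integral_Icc_eq_integral_Ioc,
    setIntegral_eq_zero_iff_of_nonneg_ae (Eventually.of_forall hpos)
      hcW.continuousOn.integrableOn_Icc] at hzero
  intro τ hτ
  have := Measure.eqOn_Icc_of_ae_eq volume ht.ne hzero hcW.continuousOn continuousOn_const hτ
  simpa using this

/-- The integer frequencies n + 1 suffice: in Duhamel's formula they are the exponential moments of
`v`, up to a nonzero factor. -/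
lemma eq_zero_of_diffState_eq_zero {v : ℝ → ℝ} {t : ℝ} (ht : 0 < t) (hv : ContinuousOn v (Ici 0))
    (h : ∀ ω, 0 < ω → diffState v ω t = 0) : ∀ τ ∈ Icc 0 t, v τ = 0 := by
  intro τ hτ
  have := eq_zero_of_exp_moments ht (continuous_comp_max_zero hv) (fun n => ?_) τ hτ
  · rwa [max_eq_left hτ.1] at this
  · have := h (n + 1) (by positivity)
    rwa [diffState, mul_eq_zero, or_iff_right (Real.exp_pos _).ne'] at this

lemma integral_mul_sq_nonneg {β : ℝ} (hβ : 0 < β) (hβ' : β < 1) (ζ : ℝ → ℝ) :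
    0 ≤ ∫ ω in Ioi (0 : ℝ), ω * freqWeight β ω * ζ ω ^ 2 :=
  setIntegral_nonneg measurableSet_Ioi fun ω hω => by
    have := freqWeight_pos hβ hβ' hω
    have : 0 < ω := hω
    positivity

lemma integral_sq_nonneg {β : ℝ} (hβ : 0 < β) (hβ' : β < 1) (ζ : ℝ → ℝ) :
    0 ≤ ∫ ω in Ioi (0 : ℝ), freqWeight β ω * ζ ω ^ 2 :=
  setIntegral_nonneg measurableSet_Ioi fun ω hω => by
    have := freqWeight_pos hβ hβ' hω
    positivity

/-- A nonnegative integrand with zero integral vanishes almost everywhere; continuity in ω removes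
the exceptional set. -/
lemma diffState_eq_zero_of_integral_eq_zero {v : ℝ → ℝ} (hv : ContinuousOn v (Ici 0)) {β t : ℝ}
    (hβ : 0 < β) (hβ' : β < 1) (ht : 0 ≤ t)
    (h : ∫ ω in Ioi (0 : ℝ), ω * freqWeight β ω * diffState v ω t ^ 2 = 0) :
    ∀ ω, 0 < ω → diffState v ω t = 0 := by
  rw [setIntegral_eq_zero_iff_of_nonneg_ae ?_ (integrableOn_mul_diffState_sq hv hβ hβ' ht)] at h
  · have h2 : (fun ω => diffState v ω t) =ᵐ[volume.restrict (Ioi 0)] fun _ => 0 := by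
      filter_upwards [h, ae_restrict_mem measurableSet_Ioi] with ω h1 hω
      have h3 := freqWeight_pos hβ hβ' hω
      have h4 : 0 < ω := hω
      have h5 : ω * freqWeight β ω ≠ 0 := by positivity
      simpa [h5] using h1
    exact fun ω hω => Measure.eqOn_open_of_ae_eq h2 isOpen_Ioi
      (continuous_diffState_left hv t).continuousOn continuousOn_const hω
  · filter_upwards [ae_restrict_mem measurableSet_Ioi] with ω hω
    have h3 := freqWeight_pos hβ hβ' hω
    have h4 : 0 < ω := hω
    simp only [Pi.zero_apply]
    positivity

/-! ### The energy balance -/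

section Energy

variable {m c₁ c₂ k α₁ α₂ : ℝ} {x₁ x₂ x₃ x₄ : ℝ → ℝ}

lemma FractionalPart.eq_integral (h : FractionalPart α₁ α₂ x₁ x₂ x₃ x₄) (hα₁ : 0 < α₁)
    (hα : α₁ < α₂) (hα₂ : α₂ < 1) {t : ℝ} (ht : 0 ≤ t) :
    x₂ t = (∫ ω in Ioi (0 : ℝ), freqWeight (1 - α₁) ω * diffState x₄ ω t) ∧
      x₃ t = ∫ ω in Ioi (0 : ℝ), freqWeight (1 - α₂) ω * diffState x₄ ω t := by
  obtain ⟨h2, h3, -⟩ := h.eq_fracInt hα₁ hα hα₂ ht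
  have hc := h.locAC₄.continuousOn
  rw [h2, h3, fracInt_eq_integral_freqWeight hα₁ (hα.trans hα₂) ht hc,
    fracInt_eq_integral_freqWeight (hα₁.trans hα) hα₂ ht hc]
  exact ⟨rfl, rfl⟩

/-- Bounds on `x₁` and `x₄` control the fractional states `x₂` and `x₃`. -/
lemma FractionalPart.abs_le (h : FractionalPart α₁ α₂ x₁ x₂ x₃ x₄) (hα₁ : 0 < α₁)
    (hα : α₁ < α₂) (hα₂ : α₂ < 1) {t A : ℝ} (ht : 0 ≤ t) (h₁ : ∀ τ ∈ Icc 0 t, |x₁ τ| ≤ A)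
    (h₄ : ∀ τ ∈ Icc 0 t, |x₄ τ| ≤ A) :
    |x₂ t| ≤ 3 * A * majorant (1 - α₁) ∧ |x₃ t| ≤ 3 * A * majorant (1 - α₂) := by
  obtain ⟨h2, h3⟩ := h.eq_integral hα₁ hα hα₂ ht
  have hb : ∀ ω, 0 < ω → |diffState x₄ ω t| ≤ 3 * A * decay ω := fun ω hω =>
    abs_diffState_le_decay h.locAC₄.continuousOn (h.hasDerivWithinAt hα₁ hα hα₂).2 hω ht h₁ h₄
  rw [h2, h3]
  exact ⟨abs_integral_freqWeight_mul_le (by linarith) (by linarith) hb,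
    abs_integral_freqWeight_mul_le (by linarith) (by linarith) hb⟩

/-- The energy balance, with the momentum variable `q` in place of the velocity `x₄`. -/
lemma FractionalPart.hasDerivAt_energy (h : FractionalPart α₁ α₂ x₁ x₂ x₃ x₄) (hm : 0 < m)
    (hα₁ : 0 < α₁) (hα : α₁ < α₂) (hα₂ : α₂ < 1) {q : ℝ → ℝ} {t : ℝ} (ht : 0 < t)
    (hq : HasDerivAt q (-(k / m * x₁ t + c₁ / m * x₂ t + c₂ / m * x₃ t)) t) :
    HasDerivAt (energy m c₁ c₂ k α₁ α₂ x₁ q (diffState x₄) (diffState x₄))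
      (-dissipation c₁ c₂ α₁ α₂ (diffState x₄) (diffState x₄) t
        + (x₄ t - q t) * (k * x₁ t + c₁ * x₂ t + c₂ * x₃ t)) t := by
  have hc := h.locAC₄.continuousOn
  obtain ⟨h2, h3⟩ := h.eq_integral hα₁ hα hα₂ ht.le
  have e1 := ((h.hasDerivWithinAt hα₁ hα hα₂).2 t ht.le).hasDerivAt (Ici_mem_nhds ht)
  have e2 := hasDerivAt_integral_sq hc (β := 1 - α₁) (by linarith) (by linarith) ht
  have e3 := hasDerivAt_integral_sq hc (β := 1 - α₂) (by linarith) (by linarith) ht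
  rw [← h2] at e2
  rw [← h3] at e3
  -- The spring and the filters receive the power x₄(kx₁ + c₁x₂ + c₂x₃), while m q q' supplies
  -- -q(kx₁ + c₁x₂ + c₂x₃), which leaves the factor x₄ - q. It is zero during sliding with q = x₄,
  -- and equals s for q = x₄ - s.
  refine (((((e1.fun_pow 2).const_mul (1 / 2 * k)).fun_add (e2.const_mul (c₁ / 2))).fun_add
    (e3.const_mul (c₂ / 2))).fun_add ((hq.fun_pow 2).const_mul (1 / 2 * m))).congr_deriv ?_
  simp only [dissipation]
  field_simp
  ring

lemma FractionalPart.continuousOn_energy (h : FractionalPart α₁ α₂ x₁ x₂ x₃ x₄)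
    (hα₁ : 0 < α₁) (hα : α₁ < α₂) (hα₂ : α₂ < 1) {q : ℝ → ℝ} (hq : ContinuousOn q (Ici 0)) :
    ContinuousOn (energy m c₁ c₂ k α₁ α₂ x₁ q (diffState x₄) (diffState x₄)) (Ici 0) := by
  have hc := h.locAC₄.continuousOn
  have h1 := h.eq₁.locAC.continuousOn
  have h2 := continuousOn_integral_sq hc (β := 1 - α₁) (by linarith) (by linarith)
  have h3 := continuousOn_integral_sq hc (β := 1 - α₂) (by linarith) (by linarith)
  unfold energy
  fun_prop

lemma energy_zero {q : ℝ → ℝ} :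
    energy m c₁ c₂ k α₁ α₂ x₁ q (diffState x₄) (diffState x₄) 0 =
      1 / 2 * k * x₁ 0 ^ 2 + 1 / 2 * m * q 0 ^ 2 := by
  simp [energy]

lemma le_energy (hc₁ : 0 < c₁) (hc₂ : 0 < c₂) (hα₁ : 0 < α₁) (hα : α₁ < α₂) (hα₂ : α₂ < 1)
    {q : ℝ → ℝ} {z₁ z₂ : ℝ → ℝ → ℝ} (t : ℝ) :
    1 / 2 * k * x₁ t ^ 2 + 1 / 2 * m * q t ^ 2 ≤ energy m c₁ c₂ k α₁ α₂ x₁ q z₁ z₂ t := by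
  have h1 := integral_sq_nonneg (β := 1 - α₁) (by linarith) (by linarith) fun ω => z₁ ω t
  have h2 := integral_sq_nonneg (β := 1 - α₂) (by linarith) (by linarith) fun ω => z₂ ω t
  have := mul_nonneg (half_pos hc₁).le h1
  have := mul_nonneg (half_pos hc₂).le h2
  unfold energy
  linarith

lemma dissipation_nonneg (hc₁ : 0 < c₁) (hc₂ : 0 < c₂) (hα₁ : 0 < α₁) (hα : α₁ < α₂)
    (hα₂ : α₂ < 1) (z₁ z₂ : ℝ → ℝ → ℝ) (t : ℝ) : 0 ≤ dissipation c₁ c₂ α₁ α₂ z₁ z₂ t := by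
  have h1 := integral_mul_sq_nonneg (β := 1 - α₁) (by linarith) (by linarith) fun ω => z₁ ω t
  have h2 := integral_mul_sq_nonneg (β := 1 - α₂) (by linarith) (by linarith) fun ω => z₂ ω t
  exact add_nonneg (mul_nonneg hc₁.le h1) (mul_nonneg hc₂.le h2)

/-- As long as the dissipation is zero, the velocity and the fractional states vanish. -/
lemma FractionalPart.eq_zero_of_dissipation (h : FractionalPart α₁ α₂ x₁ x₂ x₃ x₄)
    (hc₁ : 0 < c₁) (hc₂ : 0 < c₂) (hα₁ : 0 < α₁) (hα : α₁ < α₂) (hα₂ : α₂ < 1) {t : ℝ}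
    (ht : 0 < t) (hd : dissipation c₁ c₂ α₁ α₂ (diffState x₄) (diffState x₄) t = 0) :
    ∀ τ ∈ Icc 0 t, x₁ τ = x₁ 0 ∧ x₂ τ = 0 ∧ x₃ τ = 0 ∧ x₄ τ = 0 := by
  have hc := h.locAC₄.continuousOn
  have h1 := integral_mul_sq_nonneg (β := 1 - α₁) (by linarith) (by linarith)
    fun ω => diffState x₄ ω t
  have h2 := integral_mul_sq_nonneg (β := 1 - α₂) (by linarith) (by linarith)
    fun ω => diffState x₄ ω t
  have h4 : ∀ τ ∈ Icc 0 t, x₄ τ = 0 := by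
    refine eq_zero_of_diffState_eq_zero ht hc
      (diffState_eq_zero_of_integral_eq_zero hc (β := 1 - α₁) (by linarith) (by linarith) ht.le ?_)
    unfold dissipation at hd
    have h5 := mul_nonneg hc₂.le h2
    refine le_antisymm (not_lt.1 fun h6 => ?_) h1
    have := mul_pos hc₁ h6
    linarith
  intro τ hτ
  obtain ⟨e2, e3, e1⟩ := h.eq_fracInt hα₁ hα hα₂ hτ.1
  have h0 : ∀ s ∈ Ioo 0 τ, x₄ s = 0 := fun s hs => h4 s ⟨hs.1.le, hs.2.le.trans hτ.2⟩
  have hz : ∀ a, fracInt a x₄ τ = 0 := fun a => by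
    rw [fracInt_congr (g := fun _ => 0) hτ.1 (Eventually.of_forall h0)]
    simp [fracInt]
  refine ⟨?_, by rw [e2, hz], by rw [e3, hz], h4 τ hτ⟩
  rw [e1, ← fracInt_one hτ.1, hz, add_zero]

lemma energy_congr {q : ℝ → ℝ} {z₁ z₂ w : ℝ → ℝ → ℝ} {t : ℝ} (h₁ : ∀ ω, 0 < ω → z₁ ω t = w ω t)
    (h₂ : ∀ ω, 0 < ω → z₂ ω t = w ω t) :
    energy m c₁ c₂ k α₁ α₂ x₁ q z₁ z₂ t = energy m c₁ c₂ k α₁ α₂ x₁ q w w t := by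
  have e1 : ∫ ω in Ioi (0 : ℝ), freqWeight (1 - α₁) ω * z₁ ω t ^ 2 =
      ∫ ω in Ioi (0 : ℝ), freqWeight (1 - α₁) ω * w ω t ^ 2 :=
    setIntegral_congr_fun measurableSet_Ioi fun ω hω => by simp only [h₁ ω hω]
  have e2 : ∫ ω in Ioi (0 : ℝ), freqWeight (1 - α₂) ω * z₂ ω t ^ 2 =
      ∫ ω in Ioi (0 : ℝ), freqWeight (1 - α₂) ω * w ω t ^ 2 :=
    setIntegral_congr_fun measurableSet_Ioi fun ω hω => by simp only [h₂ ω hω]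
  rw [energy, energy, e1, e2]

lemma dissipation_congr {z₁ z₂ w : ℝ → ℝ → ℝ} {t : ℝ} (h₁ : ∀ ω, 0 < ω → z₁ ω t = w ω t)
    (h₂ : ∀ ω, 0 < ω → z₂ ω t = w ω t) :
    dissipation c₁ c₂ α₁ α₂ z₁ z₂ t = dissipation c₁ c₂ α₁ α₂ w w t := by
  have e1 : ∫ ω in Ioi (0 : ℝ), ω * freqWeight (1 - α₁) ω * z₁ ω t ^ 2 =
      ∫ ω in Ioi (0 : ℝ), ω * freqWeight (1 - α₁) ω * w ω t ^ 2 :=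
    setIntegral_congr_fun measurableSet_Ioi fun ω hω => by simp only [h₁ ω hω]
  have e2 : ∫ ω in Ioi (0 : ℝ), ω * freqWeight (1 - α₂) ω * z₂ ω t ^ 2 =
      ∫ ω in Ioi (0 : ℝ), ω * freqWeight (1 - α₂) ω * w ω t ^ 2 :=
    setIntegral_congr_fun measurableSet_Ioi fun ω hω => by simp only [h₂ ω hω]
  rw [dissipation, dissipation, e1, e2]

/-- While the sliding variable is constant, the velocity is differentiable. -/
lemma FractionalPart.hasDerivAt_of_slidingVar_eq (h : FractionalPart α₁ α₂ x₁ x₂ x₃ x₄) {T t : ℝ}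
    (hT : 0 ≤ T) (ht : T < t) (hs : ∀ t : ℝ, T ≤ t → slidingVar m c₁ c₂ k x₁ x₂ x₃ x₄ t =
      slidingVar m c₁ c₂ k x₁ x₂ x₃ x₄ T) :
    HasDerivAt x₄ (-(k / m * x₁ t + c₁ / m * x₂ t + c₂ / m * x₃ t)) t := by
  have h1 := ((h.hasDerivAt_slidingVar_sub (m := m) (c₁ := c₁) (c₂ := c₂) (k := k)
    (hT.trans_lt ht)).const_sub (slidingVar m c₁ c₂ k x₁ x₂ x₃ x₄ T))
  refine h1.congr_of_eventuallyEq ?_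
  filter_upwards [Ioi_mem_nhds ht] with r hr
  rw [← hs r (le_of_lt hr)]
  ring

/-- Diffusive states and the energy during sliding. -/
theorem IsStateTrajectory.diffusive_energy (hm : 0 < m) (hc₁ : 0 < c₁) (hc₂ : 0 < c₂)
    (hk : 0 < k) (hα₁ : 0 < α₁) (hα : α₁ < α₂) (hα₂ : α₂ < 1) {T : ℝ} {f u : ℝ → ℝ}
    (hT : 0 ≤ T) (h : IsStateTrajectory m c₁ c₂ k α₁ α₂ f u x₁ x₂ x₃ x₄)
    (hs : ∀ t : ℝ, T ≤ t → slidingVar m c₁ c₂ k x₁ x₂ x₃ x₄ t =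
      slidingVar m c₁ c₂ k x₁ x₂ x₃ x₄ T) :
    (∃ z : ℝ → ℝ → ℝ, IsDiffusiveState (velocity x₁) z) ∧
      ∀ z₁ z₂ : ℝ → ℝ → ℝ, IsDiffusiveState (velocity x₁) z₁ →
        IsDiffusiveState (velocity x₁) z₂ →
        (∀ t : ℝ, 0 ≤ t →
          IntegrableOn (fun ω => freqWeight (1 - α₁) ω * z₁ ω t) (Ioi 0) ∧
          x₂ t = ∫ ω in Ioi (0 : ℝ), freqWeight (1 - α₁) ω * z₁ ω t) ∧
        (∀ t : ℝ, 0 ≤ t →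
          IntegrableOn (fun ω => freqWeight (1 - α₂) ω * z₂ ω t) (Ioi 0) ∧
          x₃ t = ∫ ω in Ioi (0 : ℝ), freqWeight (1 - α₂) ω * z₂ ω t) ∧
        (∀ t : ℝ, 0 ≤ t →
          IntegrableOn (fun ω => freqWeight (1 - α₁) ω * z₁ ω t ^ 2) (Ioi 0) ∧
          IntegrableOn (fun ω => freqWeight (1 - α₂) ω * z₂ ω t ^ 2) (Ioi 0) ∧
          IntegrableOn (fun ω => ω * freqWeight (1 - α₁) ω * z₁ ω t ^ 2) (Ioi 0) ∧
          IntegrableOn (fun ω => ω * freqWeight (1 - α₂) ω * z₂ ω t ^ 2) (Ioi 0)) ∧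
        (∀ t : ℝ, T < t →
          HasDerivAt (energy m c₁ c₂ k α₁ α₂ x₁ x₄ z₁ z₂)
            (-dissipation c₁ c₂ α₁ α₂ z₁ z₂ t) t ∧
          -dissipation c₁ c₂ α₁ α₂ z₁ z₂ t ≤ 0 ∧
          (-dissipation c₁ c₂ α₁ α₂ z₁ z₂ t < 0 ∨
            ∀ τ ∈ Icc 0 t, x₁ τ = 0 ∧ x₂ τ = 0 ∧ x₃ τ = 0 ∧ x₄ τ = 0)) := by
  have hc := h.frac.locAC₄.continuousOn
  have hv : ∀ t, 0 ≤ t → velocity x₁ t = x₄ t := fun t ht => h.frac.velocity_eq hα₁ hα hα₂ ht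
  have hcv : ContinuousOn (velocity x₁) (Ici 0) := hc.congr hv
  have hiff : ∀ z, IsDiffusiveState (velocity x₁) z → IsDiffusiveState x₄ z :=
    fun z hz ω hω => ⟨(hz ω hω).1, fun t ht => hv t ht ▸ (hz ω hω).2 t ht⟩
  refine ⟨⟨_, isDiffusiveState_diffState hcv⟩, fun z₁ z₂ hz₁ hz₂ => ?_⟩
  have e1 : ∀ t, 0 ≤ t → ∀ ω, 0 < ω → z₁ ω t = diffState x₄ ω t := fun t ht ω hω =>
    (hiff z₁ hz₁).eq_diffState hc hω ht
  have e2 : ∀ t, 0 ≤ t → ∀ ω, 0 < ω → z₂ ω t = diffState x₄ ω t := fun t ht ω hω =>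
    (hiff z₂ hz₂).eq_diffState hc hω ht
  have ha : 0 < 1 - α₁ := by linarith
  have ha' : 1 - α₁ < 1 := by linarith
  have hb : 0 < 1 - α₂ := by linarith
  have hb' : 1 - α₂ < 1 := by linarith
  refine ⟨fun t ht => ⟨?_, ?_⟩, fun t ht => ⟨?_, ?_⟩, fun t ht => ⟨?_, ?_, ?_, ?_⟩,
    fun t ht => ?_⟩
  · exact (integrableOn_diffState hc ha ha' ht).congr_fun
      (fun ω hω => by simp only [e1 t ht ω hω]) measurableSet_Ioi
  · rw [(h.frac.eq_integral hα₁ hα hα₂ ht).1]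
    exact setIntegral_congr_fun measurableSet_Ioi fun ω hω => by simp only [e1 t ht ω hω]
  · exact (integrableOn_diffState hc hb hb' ht).congr_fun
      (fun ω hω => by simp only [e2 t ht ω hω]) measurableSet_Ioi
  · rw [(h.frac.eq_integral hα₁ hα hα₂ ht).2]
    exact setIntegral_congr_fun measurableSet_Ioi fun ω hω => by simp only [e2 t ht ω hω]
  · exact (integrableOn_diffState_sq hc ha ha' ht).congr_fun
      (fun ω hω => by simp only [e1 t ht ω hω]) measurableSet_Ioi
  · exact (integrableOn_diffState_sq hc hb hb' ht).congr_fun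
      (fun ω hω => by simp only [e2 t ht ω hω]) measurableSet_Ioi
  · exact (integrableOn_mul_diffState_sq hc ha ha' ht).congr_fun
      (fun ω hω => by simp only [e1 t ht ω hω]) measurableSet_Ioi
  · exact (integrableOn_mul_diffState_sq hc hb hb' ht).congr_fun
      (fun ω hω => by simp only [e2 t ht ω hω]) measurableSet_Ioi
  · have ht0 : 0 < t := hT.trans_lt ht
    have hd := dissipation_congr (c₁ := c₁) (c₂ := c₂) (α₁ := α₁) (α₂ := α₂) (e1 t ht0.le)
      (e2 t ht0.le)
    have hd0 := dissipation_nonneg hc₁ hc₂ hα₁ hα hα₂ (diffState x₄) (diffState x₄) t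
    have h4 := fun r hr => h.frac.hasDerivAt_of_slidingVar_eq (t := r) hT hr hs
    rw [hd]
    refine ⟨?_, neg_nonpos.2 hd0, ?_⟩
    · have := h.frac.hasDerivAt_energy hm hα₁ hα hα₂ ht0 (h4 t ht)
      rw [sub_self, zero_mul, add_zero] at this
      refine this.congr_of_eventuallyEq (eventuallyEq_nhds_of_eqOn_Ici (fun r hr => ?_) ht0)
      exact energy_congr (e1 r hr) (e2 r hr)
    · rcases hd0.eq_or_lt with h0 | h0
      · right
        have hz := h.frac.eq_zero_of_dissipation hc₁ hc₂ hα₁ hα hα₂ ht0 h0.symm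
        -- At a time r in (T, t) the equation for x₄' holds pointwise and x₄ vanishes in a
        -- neighbourhood, so it reduces to k x₁(r) = 0; this kills the constant value of x₁.
        obtain ⟨r, hr1, hr2⟩ := exists_between ht
        have hr0 : 0 < r := hT.trans_lt hr1
        obtain ⟨y1, y2, y3, -⟩ := hz r ⟨hr0.le, hr2.le⟩
        have h5 : HasDerivAt x₄ 0 r := by
          refine (hasDerivAt_const r (0 : ℝ)).congr_of_eventuallyEq ?_
          filter_upwards [Ioo_mem_nhds hr0 hr2] with s hs using (hz s ⟨hs.1.le, hs.2.le⟩).2.2.2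
        have h6 := (h4 r hr1).unique h5
        rw [y1, y2, y3, mul_zero, mul_zero, add_zero, add_zero, neg_eq_zero, mul_eq_zero,
          or_iff_right (div_pos hk hm).ne'] at h6
        intro τ hτ
        obtain ⟨w1, w⟩ := hz τ hτ
        exact ⟨w1.trans h6, w⟩
      · left
        linarith

/-- The energy does not increase along the sliding dynamics. -/
lemma IsSlidingTrajectory.energy_le (h : IsSlidingTrajectory m c₁ c₂ k α₁ α₂ x₁ x₂ x₃ x₄)
    (hm : 0 < m) (hc₁ : 0 < c₁) (hc₂ : 0 < c₂) (hα₁ : 0 < α₁) (hα : α₁ < α₂) (hα₂ : α₂ < 1)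
    {t : ℝ} (ht : 0 ≤ t) :
    1 / 2 * k * x₁ t ^ 2 + 1 / 2 * m * x₄ t ^ 2 ≤ 1 / 2 * k * x₁ 0 ^ 2 + 1 / 2 * m * x₄ 0 ^ 2 := by
  -- With zero force and control, `s` is constant from time 0 on; hence `x₄` is differentiable at
  -- every positive time and the energy balance holds there.
  have hst : IsStateTrajectory m c₁ c₂ k α₁ α₂ (fun _ => 0) (fun _ => 0) x₁ x₂ x₃ x₄ :=
    ⟨h.frac, by simpa using h.eq₄⟩
  have hs := hst.slidingVar_eq_iff.2 h
  have hd : ∀ r, 0 < r →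
      HasDerivAt (energy m c₁ c₂ k α₁ α₂ x₁ x₄ (diffState x₄) (diffState x₄))
        (-dissipation c₁ c₂ α₁ α₂ (diffState x₄) (diffState x₄) r) r := fun r hr => by
    have := h.frac.hasDerivAt_energy hm hα₁ hα hα₂ hr
      (h.frac.hasDerivAt_of_slidingVar_eq le_rfl hr hs)
    rwa [sub_self, zero_mul, add_zero] at this
  have hanti : AntitoneOn (energy m c₁ c₂ k α₁ α₂ x₁ x₄ (diffState x₄) (diffState x₄))
      (Ici 0) := by
    refine antitoneOn_of_deriv_nonpos (convex_Ici 0)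
      (h.frac.continuousOn_energy hα₁ hα hα₂ h.frac.locAC₄.continuousOn) ?_ ?_
    · rw [interior_Ici]
      exact fun r hr => (hd r hr).differentiableAt.differentiableWithinAt
    · rw [interior_Ici]
      intro r hr
      rw [(hd r hr).deriv]
      exact neg_nonpos.2 (dissipation_nonneg hc₁ hc₂ hα₁ hα hα₂ _ _ r)
  rw [← energy_zero (c₁ := c₁) (c₂ := c₂) (α₁ := α₁) (α₂ := α₂) (x₄ := x₄)]
  exact (le_energy hc₁ hc₂ hα₁ hα hα₂ t).trans (hanti self_mem_Ici ht ht)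

/-- The sliding dynamics is stable. -/
theorem slidingStable (hm : 0 < m) (hc₁ : 0 < c₁) (hc₂ : 0 < c₂) (hk : 0 < k) (hα₁ : 0 < α₁)
    (hα : α₁ < α₂) (hα₂ : α₂ < 1) : SlidingStable m c₁ c₂ k α₁ α₂ := by
  intro ε hε
  have hM1 := majorant_nonneg (β := 1 - α₁) (by linarith) (by linarith)
  have hM2 := majorant_nonneg (β := 1 - α₂) (by linarith) (by linarith)
  obtain ⟨A, hA, hA0, hA1, hA2⟩ : ∃ A, 0 < A ∧ A < ε ∧ 3 * A * majorant (1 - α₁) < ε ∧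
      3 * A * majorant (1 - α₂) < ε := by
    refine ⟨ε / (3 * majorant (1 - α₁) + 3 * majorant (1 - α₂) + 2), by positivity, ?_, ?_, ?_⟩
    · rw [div_lt_iff₀ (by positivity)]
      nlinarith
    · rw [mul_div_assoc', div_mul_eq_mul_div, div_lt_iff₀ (by positivity)]
      nlinarith
    · rw [mul_div_assoc', div_mul_eq_mul_div, div_lt_iff₀ (by positivity)]
      nlinarith
  -- Chosen so that (k + m)δ² = min(k, m)A²: the left side bounds twice the initial energy, and the
  -- right side is at most kA² and mA², which gives |x₁| ≤ A and |x₄| ≤ A.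
  set δ := A * √(min k m / (k + m)) with hδ
  have hmin : 0 < min k m := lt_min hk hm
  have hδ2 : (k + m) * δ ^ 2 = min k m * A ^ 2 := by
    rw [hδ, mul_pow, Real.sq_sqrt (by positivity)]
    field_simp
  refine ⟨δ, by positivity, fun x₁ x₂ x₃ x₄ h h1 h4 t ht => ?_⟩
  have hE : ∀ τ, 0 ≤ τ → k * x₁ τ ^ 2 + m * x₄ τ ^ 2 ≤ min k m * A ^ 2 := fun τ hτ => by
    have := h.energy_le hm hc₁ hc₂ hα₁ hα hα₂ hτ
    have e1 : x₁ 0 ^ 2 ≤ δ ^ 2 := sq_le_sq' (by linarith [(abs_lt.1 h1).1]) (abs_lt.1 h1).2.le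
    have e4 : x₄ 0 ^ 2 ≤ δ ^ 2 := sq_le_sq' (by linarith [(abs_lt.1 h4).1]) (abs_lt.1 h4).2.le
    nlinarith
  have hA' : ∀ τ, 0 ≤ τ → |x₁ τ| ≤ A ∧ |x₄ τ| ≤ A := fun τ hτ => by
    have := hE τ hτ
    have l1 := mul_le_mul_of_nonneg_right (min_le_left k m) (sq_nonneg A)
    have l2 := mul_le_mul_of_nonneg_right (min_le_right k m) (sq_nonneg A)
    constructor
    · refine abs_le_of_sq_le_sq ?_ hA.le
      refine le_of_mul_le_mul_left ?_ hk
      nlinarith [mul_nonneg hm.le (sq_nonneg (x₄ τ))]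
    · refine abs_le_of_sq_le_sq ?_ hA.le
      refine le_of_mul_le_mul_left ?_ hm
      nlinarith [mul_nonneg hk.le (sq_nonneg (x₁ τ))]
  obtain ⟨b2, b3⟩ := h.frac.abs_le hα₁ hα hα₂ ht (fun τ hτ => (hA' τ hτ.1).1)
    (fun τ hτ => (hA' τ hτ.1).2)
  exact ⟨(hA' t ht).1.trans_lt hA0, b2.trans_lt hA1, b3.trans_lt hA2, (hA' t ht).2.trans_lt hA0⟩

end Energy

/-! ### Asymptotics: Barbalat's lemma -/

lemma abs_sub_le_of_hasDerivAt {f f' : ℝ → ℝ} {L : ℝ} (hc : ContinuousOn f (Ici 0))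
    (hf : ∀ t, 0 < t → HasDerivAt f (f' t) t) (hL : ∀ t, 0 < t → |f' t| ≤ L) {s t : ℝ}
    (hs : 0 ≤ s) (hst : s ≤ t) : |f t - f s| ≤ L * (t - s) := by
  rcases hst.eq_or_lt with rfl | hst
  · simp
  obtain ⟨c, hc1, hc2⟩ := exists_hasDerivAt_eq_slope f f' hst
    (hc.mono fun r hr => hs.trans hr.1) fun r hr => hf r (hs.trans_lt hr.1)
  have h := hL c (hs.trans_lt hc1.1)
  rwa [hc2, abs_div, abs_of_pos (sub_pos.2 hst), div_le_iff₀ (sub_pos.2 hst)] at h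

/-- **Barbalat's lemma**: a Lipschitz function whose integrals over windows of fixed length
tend to zero tends to zero. -/
lemma tendsto_zero_of_window {f : ℝ → ℝ} {L : ℝ} (hc : ContinuousOn f (Ici 0))
    (hL : ∀ s t, 0 ≤ s → s ≤ t → |f t - f s| ≤ L * (t - s))
    (h : ∀ d, 0 < d → Tendsto (fun t => ∫ τ in t..(t + d), f τ) atTop (𝓝 0)) :
    Tendsto f atTop (𝓝 0) := by
  have hL0 : 0 ≤ L := by
    have := (abs_nonneg _).trans (hL 0 1 le_rfl zero_le_one)
    linarith
  rw [Metric.tendsto_atTop]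
  intro ε hε
  -- On a window of this length `f` varies by at most ε/2, and the summand 1 covers L = 0. A window
  -- integral below dε/2 then forces |f t| < ε.
  set d := ε / (2 * (L + 1)) with hd
  have hd0 : 0 < d := by positivity
  have hLd : L * d ≤ ε / 2 := by
    rw [hd, mul_div_assoc', div_le_iff₀ (by positivity)]
    nlinarith
  obtain ⟨N, hN⟩ := Metric.tendsto_atTop.1 (h d hd0) (d * (ε / 2)) (by positivity)
  refine ⟨max N 0, fun t ht => ?_⟩
  have ht0 : 0 ≤ t := (le_max_right _ _).trans ht
  have h1 := hN t ((le_max_left _ _).trans ht)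
  rw [Real.dist_eq, sub_zero] at h1 ⊢
  have hi : IntervalIntegrable f volume t (t + d) :=
    intervalIntegrable_of_continuousOn_Ici hc ht0 (by linarith)
  have h2 : ‖∫ τ in t..(t + d), (f τ - f t)‖ ≤ L * d * |t + d - t| := by
    refine intervalIntegral.norm_integral_le_of_norm_le_const fun τ hτ => ?_
    rw [uIoc_of_le (by linarith)] at hτ
    refine (hL t τ ht0 hτ.1.le).trans ?_
    have := hτ.2
    gcongr
    linarith
  rw [intervalIntegral.integral_sub hi intervalIntegrable_const, intervalIntegral.integral_const,
    add_sub_cancel_left, abs_of_pos hd0, Real.norm_eq_abs, smul_eq_mul] at h2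
  have h3 : d * |f t| < d * ε := by
    calc d * |f t| = |d * f t| := by rw [abs_mul, abs_of_pos hd0]
      _ ≤ |(∫ τ in t..(t + d), f τ)| + |(∫ τ in t..(t + d), f τ) - d * f t| := by
        have := abs_sub (∫ τ in t..(t + d), f τ) ((∫ τ in t..(t + d), f τ) - d * f t)
        rwa [sub_sub_cancel] at this
      _ < d * (ε / 2) + L * d * d := by linarith
      _ ≤ d * (ε / 2) + ε / 2 * d := by gcongr
      _ = d * ε := by ring
  exact lt_of_mul_lt_mul_left h3 hd0.le

lemma tendsto_window_of_integrableOn {f : ℝ → ℝ} (hf : IntegrableOn f (Ioi 0)) (d : ℝ) :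
    Tendsto (fun t => ∫ τ in t..(t + d), f τ) atTop (𝓝 0) := by
  have h1 := intervalIntegral_tendsto_integral_Ioi 0 hf tendsto_id
  have h2 := intervalIntegral_tendsto_integral_Ioi 0 hf
    (tendsto_atTop_add_const_right atTop d tendsto_id)
  have h3 := h2.sub h1
  rw [sub_self] at h3
  refine h3.congr' ?_
  filter_upwards [eventually_ge_atTop 0, eventually_ge_atTop (-d)] with t h0 hd
  have hi : ∀ r, 0 ≤ r → IntervalIntegrable f volume 0 r := fun r hr =>
    (intervalIntegrable_iff_integrableOn_Ioc_of_le hr).2 (hf.mono_set Ioc_subset_Ioi_self)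
  exact intervalIntegral.integral_interval_sub_left (hi _ (by simp; linarith)) (hi _ h0)

lemma tendsto_window_of_tendsto {f : ℝ → ℝ} (hf : Tendsto f atTop (𝓝 0)) {d : ℝ} (hd : 0 < d) :
    Tendsto (fun t => ∫ τ in t..(t + d), f τ) atTop (𝓝 0) := by
  rw [Metric.tendsto_atTop] at hf ⊢
  intro ε hε
  obtain ⟨N, hN⟩ := hf (ε / (2 * d)) (by positivity)
  refine ⟨N, fun t ht => ?_⟩
  have h2 : ‖∫ τ in t..(t + d), f τ‖ ≤ ε / (2 * d) * |t + d - t| := by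
    refine intervalIntegral.norm_integral_le_of_norm_le_const fun τ hτ => ?_
    rw [uIoc_of_le (by linarith)] at hτ
    have := (hN τ (ht.trans hτ.1.le)).le
    rwa [Real.dist_eq, sub_zero] at this
  rw [add_sub_cancel_left, abs_of_pos hd] at h2
  rw [dist_zero_right]
  refine h2.trans_lt ?_
  field_simp
  linarith

/-- A diffusive state with an input that tends to zero tends to zero. -/
lemma tendsto_diffState {v : ℝ → ℝ} (hv : ContinuousOn v (Ici 0)) (h : Tendsto v atTop (𝓝 0))
    {ω : ℝ} (hω : 0 < ω) : Tendsto (diffState v ω) atTop (𝓝 0) := by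
  rw [Metric.tendsto_atTop] at h ⊢
  intro ε hε
  obtain ⟨N, hN⟩ := h (ω * (ε / 2)) (by positivity)
  set T := max N 0 with hT
  have hT0 : 0 ≤ T := le_max_right _ _
  have hvT : ContinuousOn (fun r => v (T + r)) (Ici 0) :=
    hv.comp (by fun_prop) fun r (hr : 0 ≤ r) => add_nonneg hT0 hr
  -- Restarting at time T separates an exponentially decaying memory of the past from the response
  -- to an input that is already at most ωε/2, which is at most ε/2.
  have key : ∀ r, 0 ≤ r → diffState v ω (T + r) =
      Real.exp (-(ω * r)) * diffState v ω T + diffState (fun r => v (T + r)) ω r := by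
    intro r hr
    have := eq_diffState (ζ := fun r => diffState v ω (T + r) -
      Real.exp (-(ω * r)) * diffState v ω T) (ω := ω) hvT (by simp) (fun r hr => ?_) hr
    · rw [← this]; ring
    · have h1 := (hasDerivAt_diffState hv ω (T + r)).comp_const_add T r
      rw [max_eq_left (add_nonneg hT0 hr)] at h1
      have h2 : HasDerivAt (fun t => Real.exp (-(ω * t))) (Real.exp (-(ω * r)) * -ω) r := by
        have := ((hasDerivAt_id r).const_mul ω).neg.exp
        simpa using this
      refine ((h1.sub (h2.mul_const (diffState v ω T))).congr_deriv ?_).hasDerivWithinAt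
      ring
  have hexp : Tendsto (fun r => Real.exp (-(ω * r)) * diffState v ω T) atTop (𝓝 0) := by
    have h1 : Tendsto (fun r : ℝ => ω * r) atTop atTop :=
      tendsto_id.const_mul_atTop hω
    simpa using (Real.tendsto_exp_neg_atTop_nhds_zero.comp h1).mul_const (diffState v ω T)
  obtain ⟨M, hM⟩ := Metric.tendsto_atTop.1 hexp (ε / 2) (by positivity)
  refine ⟨T + max M 0, fun t ht => ?_⟩
  have hr0 : 0 ≤ t - T := by linarith [le_max_right M 0]
  have h1 := hM (t - T) (by linarith [le_max_left M 0])
  have h2 : |diffState (fun r => v (T + r)) ω (t - T)| ≤ ω * (ε / 2) / ω := by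
    refine abs_diffState_le_div hω hr0 fun τ hτ => ?_
    have := (hN (T + τ) (by linarith [hτ.1, le_max_left N 0])).le
    rwa [Real.dist_eq, sub_zero] at this
  rw [mul_div_cancel_left₀ _ hω.ne'] at h2
  have h3 := key (t - T) hr0
  rw [add_sub_cancel] at h3
  rw [Real.dist_eq, sub_zero] at h1 ⊢
  rw [h3]
  exact (abs_add_le _ _).trans_lt (by linarith)

/-! ### Asymptotics of the oscillator for an integrable sliding variable -/

/-- For ω ≥ 1, Young's inequality with weight ω charges z to the dissipation; for ω ≤ 1 the
dissipation is too weak and |z| ≤ (1 + z²)/2 charges it to the energy. The dissipation enters with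
coefficient 1/2 and can be absorbed, and every other coefficient carries |s| or s². -/
lemma young_decay {s z ω : ℝ} (hω : 0 < ω) :
    |s| * |z| ≤ |s| / 2 * (decay ω + z ^ 2) + s ^ 2 / 2 * decay ω + 1 / 2 * (ω * z ^ 2) := by
  have hs := abs_nonneg s
  have hz := abs_nonneg z
  rw [← sq_abs s, ← sq_abs z]
  rcases le_total ω 1 with h | h
  · rw [decay, min_eq_left ((one_le_inv₀ hω).2 h)]
    have : |z| ≤ (1 + |z| ^ 2) / 2 := by nlinarith [sq_nonneg (|z| - 1)]
    have := mul_le_mul_of_nonneg_left this hs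
    have : 0 ≤ ω * |z| ^ 2 := by positivity
    nlinarith [sq_nonneg |s|]
  · rw [decay, min_eq_right (inv_le_one_of_one_le₀ h)]
    have h1 : 0 ≤ |s| / 2 * (ω⁻¹ + |z| ^ 2) := by positivity
    have h2 : |s| * |z| ≤ |s| ^ 2 / 2 * ω⁻¹ + 1 / 2 * (ω * |z| ^ 2) := by
      have h3 : |s| ^ 2 / 2 * ω⁻¹ + 1 / 2 * (ω * |z| ^ 2) - |s| * |z| =
          ω⁻¹ / 2 * (|s| - ω * |z|) ^ 2 := by
        field_simp
        ring
      have h4 : 0 ≤ ω⁻¹ / 2 * (|s| - ω * |z|) ^ 2 := by positivity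
      linarith
    linarith

lemma abs_mul_integral_le {v : ℝ → ℝ} (hv : ContinuousOn v (Ici 0)) {β t : ℝ} (hβ : 0 < β)
    (hβ' : β < 1) (ht : 0 ≤ t) (s : ℝ) :
    |s| * |∫ ω in Ioi (0 : ℝ), freqWeight β ω * diffState v ω t| ≤
      (|s| / 2 + s ^ 2 / 2) * majorant β
        + |s| / 2 * (∫ ω in Ioi (0 : ℝ), freqWeight β ω * diffState v ω t ^ 2)
        + 1 / 2 * ∫ ω in Ioi (0 : ℝ), ω * freqWeight β ω * diffState v ω t ^ 2 := by
  have i1 := (integrableOn_freqWeight_mul_decay hβ hβ').const_mul (|s| / 2 + s ^ 2 / 2)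
  have i2 := (integrableOn_diffState_sq hv hβ hβ' ht).const_mul (|s| / 2)
  have i3 := (integrableOn_mul_diffState_sq hv hβ hβ' ht).const_mul (1 / 2)
  have i12 : IntegrableOn (fun ω => (|s| / 2 + s ^ 2 / 2) * (freqWeight β ω * decay ω)
      + |s| / 2 * (freqWeight β ω * diffState v ω t ^ 2)) (Ioi 0) := i1.add i2
  rw [majorant, ← abs_mul, ← integral_const_mul, ← integral_const_mul, ← integral_const_mul,
    ← integral_const_mul, ← integral_add i1 i2, ← integral_add i12 i3, ← Real.norm_eq_abs]
  refine norm_integral_le_of_norm_le (i12.add i3) ?_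
  filter_upwards [ae_restrict_mem measurableSet_Ioi] with ω hω
  have hw := freqWeight_pos hβ hβ' hω
  have h := mul_le_mul_of_nonneg_left (young_decay (s := s) (z := diffState v ω t) hω) hw.le
  rw [norm_mul, norm_mul, Real.norm_of_nonneg hw.le, Real.norm_eq_abs, Real.norm_eq_abs]
  linarith

section Asymptotics

variable {m c₁ c₂ k α₁ α₂ : ℝ} {x₁ x₂ x₃ x₄ : ℝ → ℝ}

lemma FractionalPart.continuousOn_dissipation (h : FractionalPart α₁ α₂ x₁ x₂ x₃ x₄)
    (hα₁ : 0 < α₁) (hα : α₁ < α₂) (hα₂ : α₂ < 1) :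
    ContinuousOn (dissipation c₁ c₂ α₁ α₂ (diffState x₄) (diffState x₄)) (Ici 0) := by
  have hc := h.locAC₄.continuousOn
  have h2 := continuousOn_integral_mul_sq hc (β := 1 - α₁) (by linarith) (by linarith)
  have h3 := continuousOn_integral_mul_sq hc (β := 1 - α₂) (by linarith) (by linarith)
  unfold dissipation
  fun_prop

lemma mul_add_le_aux {a k G E : ℝ} (ha : 0 ≤ a) (hk : 0 ≤ k) (hG : 0 ≤ G) (hE : 0 ≤ E) :
    a * (k / 2 + G / 2 + E) ≤ (2 + k + G) * a * (1 + E) := by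
  have : k / 2 + G / 2 + E ≤ (2 + k + G) * (1 + E) := by
    nlinarith [mul_nonneg hk hE, mul_nonneg hG hE]
  calc a * (k / 2 + G / 2 + E) ≤ a * ((2 + k + G) * (1 + E)) := by gcongr
    _ = _ := by ring

/-- The power of the perturbation `s` is controlled by the energy and the dissipation. -/
lemma FractionalPart.power_le (h : FractionalPart α₁ α₂ x₁ x₂ x₃ x₄) (hm : 0 < m)
    (hc₁ : 0 < c₁) (hc₂ : 0 < c₂) (hk : 0 < k) (hα₁ : 0 < α₁) (hα : α₁ < α₂) (hα₂ : α₂ < 1)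
    {q : ℝ → ℝ} {S t s : ℝ} (ht : 0 ≤ t) (hs : |s| ≤ S) :
    s * (k * x₁ t + c₁ * x₂ t + c₂ * x₃ t) ≤
      1 / 2 * dissipation c₁ c₂ α₁ α₂ (diffState x₄) (diffState x₄) t
      + (2 + k + (c₁ * majorant (1 - α₁) + c₂ * majorant (1 - α₂)) * (1 + S)) * |s|
        * (1 + energy m c₁ c₂ k α₁ α₂ x₁ q (diffState x₄) (diffState x₄) t) := by
  have hc := h.locAC₄.continuousOn
  obtain ⟨h2, h3⟩ := h.eq_integral hα₁ hα hα₂ ht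
  have b2 := abs_mul_integral_le hc (β := 1 - α₁) (by linarith) (by linarith) ht s
  have b3 := abs_mul_integral_le hc (β := 1 - α₂) (by linarith) (by linarith) ht s
  rw [← h2] at b2
  rw [← h3] at b3
  have G1 := majorant_nonneg (β := 1 - α₁) (by linarith) (by linarith)
  have G2 := majorant_nonneg (β := 1 - α₂) (by linarith) (by linarith)
  have w1 := integral_sq_nonneg (β := 1 - α₁) (by linarith) (by linarith)
    fun ω => diffState x₄ ω t
  have w2 := integral_sq_nonneg (β := 1 - α₂) (by linarith) (by linarith)
    fun ω => diffState x₄ ω t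
  unfold energy dissipation
  set W1 := ∫ ω in Ioi (0 : ℝ), freqWeight (1 - α₁) ω * diffState x₄ ω t ^ 2
  set W2 := ∫ ω in Ioi (0 : ℝ), freqWeight (1 - α₂) ω * diffState x₄ ω t ^ 2
  set D1 := ∫ ω in Ioi (0 : ℝ), ω * freqWeight (1 - α₁) ω * diffState x₄ ω t ^ 2
  set D2 := ∫ ω in Ioi (0 : ℝ), ω * freqWeight (1 - α₂) ω * diffState x₄ ω t ^ 2
  have hs0 := abs_nonneg s
  -- The bound on `s` makes every coefficient linear in |s|, the quantity with finite time integral.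
  have hss : s ^ 2 ≤ S * |s| := by
    rw [← sq_abs, sq]
    gcongr
  have hE1 : 0 ≤ 1 / 2 * k * x₁ t ^ 2 := by positivity
  have hE2 : 0 ≤ c₁ / 2 * W1 := by positivity
  have hE3 : 0 ≤ c₂ / 2 * W2 := by positivity
  have hE4 : 0 ≤ 1 / 2 * m * q t ^ 2 := by positivity
  set E := 1 / 2 * k * x₁ t ^ 2 + c₁ / 2 * W1 + c₂ / 2 * W2 + 1 / 2 * m * q t ^ 2 with hE
  have hx1 : |x₁ t| ≤ (1 + x₁ t ^ 2) / 2 := by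
    nlinarith [sq_nonneg (|x₁ t| - 1), sq_abs (x₁ t)]
  have p1 : s * (k * x₁ t) ≤ |s| * (k / 2 + 1 / 2 * k * x₁ t ^ 2) := by
    calc s * (k * x₁ t) ≤ |s * (k * x₁ t)| := le_abs_self _
      _ = |s| * (k * |x₁ t|) := by rw [abs_mul, abs_mul, abs_of_pos hk]
      _ ≤ |s| * (k * ((1 + x₁ t ^ 2) / 2)) := by gcongr
      _ = _ := by ring
  have p2 : s * (c₁ * x₂ t) ≤ |s| * (c₁ * majorant (1 - α₁) * ((1 + S) / 2)) + |s| * (c₁ / 2 * W1)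
      + 1 / 2 * (c₁ * D1) := by
    calc s * (c₁ * x₂ t) ≤ |s * (c₁ * x₂ t)| := le_abs_self _
      _ = c₁ * (|s| * |x₂ t|) := by rw [abs_mul, abs_mul, abs_of_pos hc₁]; ring
      _ ≤ c₁ * ((|s| / 2 + S * |s| / 2) * majorant (1 - α₁) + |s| / 2 * W1 + 1 / 2 * D1) := by
        gcongr
        refine b2.trans ?_
        gcongr
      _ = _ := by ring
  have p3 : s * (c₂ * x₃ t) ≤ |s| * (c₂ * majorant (1 - α₂) * ((1 + S) / 2)) + |s| * (c₂ / 2 * W2)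
      + 1 / 2 * (c₂ * D2) := by
    calc s * (c₂ * x₃ t) ≤ |s * (c₂ * x₃ t)| := le_abs_self _
      _ = c₂ * (|s| * |x₃ t|) := by rw [abs_mul, abs_mul, abs_of_pos hc₂]; ring
      _ ≤ c₂ * ((|s| / 2 + S * |s| / 2) * majorant (1 - α₂) + |s| / 2 * W2 + 1 / 2 * D2) := by
        gcongr
        refine b3.trans ?_
        gcongr
      _ = _ := by ring
  have hS : 0 ≤ S := hs0.trans hs
  set G := (c₁ * majorant (1 - α₁) + c₂ * majorant (1 - α₂)) * (1 + S) with hG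
  have hG0 : 0 ≤ G := by positivity
  have hE0 : 0 ≤ E := by positivity
  have hfin := mul_add_le_aux hs0 hk.le hG0 hE0
  have hq4 : 0 ≤ |s| * (1 / 2 * m * q t ^ 2) := by positivity
  have : s * (k * x₁ t + c₁ * x₂ t + c₂ * x₃ t) ≤
      |s| * (k / 2 + G / 2 + E) + 1 / 2 * (c₁ * D1 + c₂ * D2) := by
    rw [hE, hG]
    linarith
  linarith

end Asymptotics

/-- A Gronwall type estimate for an energy `E` with dissipation `D`. -/
lemma gronwall_dissipation {E E' D g : ℝ → ℝ} {B : ℝ} (hEc : ContinuousOn E (Ici 0))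
    (hE0 : ∀ t, 0 ≤ t → 0 ≤ E t) (hE : ∀ t, 0 < t → HasDerivAt E (E' t) t)
    (hDc : ContinuousOn D (Ici 0)) (hD0 : ∀ t, 0 ≤ t → 0 ≤ D t) (hgc : ContinuousOn g (Ici 0))
    (hB : ∀ t, 0 ≤ t → ∫ τ in (0 : ℝ)..t, g τ ≤ B)
    (h : ∀ t, 0 < t → E' t ≤ -(1 / 2 * D t) + g t * (1 + E t)) {t : ℝ} (ht : 0 ≤ t) :
    E t ≤ (1 + E 0) * Real.exp B ∧
      ∫ τ in (0 : ℝ)..t, D τ ≤ 2 * (1 + E 0) * Real.exp B := by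
  let G : ℝ → ℝ := fun t => ∫ τ in (0 : ℝ)..t, g τ
  -- Gronwall's integrating factor e^(-G) is applied to 1 + E, and the accumulated dissipation is
  -- weighted by the lower bound e^(-B) of e^(-G). Then Y' ≤ ½D(e^(-B) - e^(-G)) ≤ 0.
  let Y : ℝ → ℝ := fun t => (1 + E t) * Real.exp (-G t) +
    1 / 2 * Real.exp (-B) * ∫ τ in (0 : ℝ)..t, D τ
  have hcont : ∀ {f : ℝ → ℝ}, ContinuousOn f (Ici 0) →
      ContinuousOn (fun t => ∫ τ in (0 : ℝ)..t, f τ) (Ici 0) := fun {f} hf =>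
    (contDiffOn_of_integral (x := fun t => ∫ τ in (0 : ℝ)..t, f τ) hf
      fun t _ => by simp).1.continuousOn
  have hGc := hcont hgc
  have hY : ∀ t, 0 < t → HasDerivAt Y (E' t * Real.exp (-G t) +
      (1 + E t) * (Real.exp (-G t) * -g t) + 1 / 2 * Real.exp (-B) * D t) t := fun t ht =>
    (((hE t ht).const_add 1).fun_mul (hasDerivAt_integral_of_continuousOn hgc ht).neg.exp).fun_add
      ((hasDerivAt_integral_of_continuousOn hDc ht).const_mul _)
  have hanti : AntitoneOn Y (Ici 0) := by
    refine antitoneOn_of_deriv_nonpos (convex_Ici 0) ?_ ?_ ?_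
    · have := hcont hDc
      have h3 : ContinuousOn (fun t => Real.exp (-G t)) (Ici 0) := hGc.neg.rexp
      exact ((hEc.const_add 1).mul h3).add (continuousOn_const.mul this)
    · rw [interior_Ici]
      exact fun r hr => (hY r hr).differentiableAt.differentiableWithinAt
    · rw [interior_Ici]
      intro r hr
      rw [(hY r hr).deriv]
      have h1 := mul_le_mul_of_nonneg_right (h r hr) (Real.exp_pos (-G r)).le
      have h2 : Real.exp (-B) * D r ≤ Real.exp (-G r) * D r :=
        mul_le_mul_of_nonneg_right (Real.exp_le_exp.2 (neg_le_neg (hB r (le_of_lt hr))))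
          (hD0 r (le_of_lt hr))
      linarith
  have hY0 : Y t ≤ 1 + E 0 := by
    have := hanti self_mem_Ici ht ht
    simpa [Y, G] using this
  have hDi : 0 ≤ ∫ τ in (0 : ℝ)..t, D τ :=
    intervalIntegral.integral_nonneg ht fun τ hτ => hD0 τ hτ.1
  have hEt := hE0 t ht
  have e1 : Real.exp (-B) ≤ Real.exp (-G t) := Real.exp_le_exp.2 (neg_le_neg (hB t ht))
  have hB1 : Real.exp (-B) * Real.exp B = 1 := by
    rw [← Real.exp_add, neg_add_cancel, Real.exp_zero]
  have hBp := Real.exp_pos B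
  have hBn := Real.exp_pos (-B)
  have e2 : (1 + E t) * Real.exp (-B) ≤ (1 + E t) * Real.exp (-G t) := by gcongr
  have hsum : (1 + E t) * Real.exp (-B) + 1 / 2 * Real.exp (-B) * ∫ τ in (0 : ℝ)..t, D τ ≤
      1 + E 0 := by
    simp only [Y] at hY0
    linarith
  have hsum2 := mul_le_mul_of_nonneg_right hsum hBp.le
  have hsum3 : (1 + E t) + 1 / 2 * ∫ τ in (0 : ℝ)..t, D τ ≤ (1 + E 0) * Real.exp B := by
    calc _ = ((1 + E t) + 1 / 2 * ∫ τ in (0 : ℝ)..t, D τ) * (Real.exp (-B) * Real.exp B) := by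
          rw [hB1, mul_one]
      _ ≤ _ := by linarith
  constructor <;> linarith

section Asymptotics

variable {m c₁ c₂ k α₁ α₂ : ℝ} {x₁ x₂ x₃ x₄ : ℝ → ℝ}

/-- The momentum variable `x₄ - s` of the energy estimate. -/
def momentum (m c₁ c₂ k : ℝ) (x₁ x₂ x₃ x₄ : ℝ → ℝ) (t : ℝ) : ℝ :=
  x₄ t - slidingVar m c₁ c₂ k x₁ x₂ x₃ x₄ t

/-- The velocity cancels in x₄ - s and leaves minus the integral terms of `s`. The derivative
therefore exists at every positive time and contains neither force nor control. -/
lemma FractionalPart.hasDerivAt_momentum (h : FractionalPart α₁ α₂ x₁ x₂ x₃ x₄) {t : ℝ}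
    (ht : 0 < t) : HasDerivAt (momentum m c₁ c₂ k x₁ x₂ x₃ x₄)
      (-(k / m * x₁ t + c₁ / m * x₂ t + c₂ / m * x₃ t)) t := by
  refine (h.hasDerivAt_slidingVar_sub (m := m) (c₁ := c₁) (c₂ := c₂) (k := k) ht).neg
    |>.congr_of_eventuallyEq (Eventually.of_forall fun t => ?_)
  simp [momentum]

lemma FractionalPart.continuousOn_momentum (h : FractionalPart α₁ α₂ x₁ x₂ x₃ x₄) :
    ContinuousOn (momentum m c₁ c₂ k x₁ x₂ x₃ x₄) (Ici 0) :=
  h.locAC₄.continuousOn.sub h.locAC_slidingVar.continuousOn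

/-- If the sliding variable is bounded and integrable, then the energy is bounded and the
total dissipation is finite. -/
lemma FractionalPart.exists_energy_le (h : FractionalPart α₁ α₂ x₁ x₂ x₃ x₄) (hm : 0 < m)
    (hc₁ : 0 < c₁) (hc₂ : 0 < c₂) (hk : 0 < k) (hα₁ : 0 < α₁) (hα : α₁ < α₂) (hα₂ : α₂ < 1)
    {S B : ℝ} (hS : ∀ t, 0 ≤ t → |slidingVar m c₁ c₂ k x₁ x₂ x₃ x₄ t| ≤ S)
    (hB : ∀ t, 0 ≤ t → ∫ τ in (0 : ℝ)..t, |slidingVar m c₁ c₂ k x₁ x₂ x₃ x₄ τ| ≤ B) :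
    ∃ C, 0 ≤ C ∧ ∀ t, 0 ≤ t → k * x₁ t ^ 2 ≤ C ∧
      m * momentum m c₁ c₂ k x₁ x₂ x₃ x₄ t ^ 2 ≤ C ∧
      ∫ τ in (0 : ℝ)..t, dissipation c₁ c₂ α₁ α₂ (diffState x₄) (diffState x₄) τ ≤ C := by
  set q := momentum m c₁ c₂ k x₁ x₂ x₃ x₄ with hq
  set M := 2 + k + (c₁ * majorant (1 - α₁) + c₂ * majorant (1 - α₂)) * (1 + S) with hM
  have hM0 : 0 ≤ M := by
    have hS0 := (abs_nonneg _).trans (hS 0 le_rfl)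
    have G1 := majorant_nonneg (β := 1 - α₁) (by linarith) (by linarith)
    have G2 := majorant_nonneg (β := 1 - α₂) (by linarith) (by linarith)
    positivity
  have hqc : ContinuousOn q (Ici 0) := h.continuousOn_momentum
  have hsq : ∀ t, x₄ t - q t = slidingVar m c₁ c₂ k x₁ x₂ x₃ x₄ t := fun t => by
    simp [hq, momentum]
  have hle : ∀ t, 1 / 2 * k * x₁ t ^ 2 + 1 / 2 * m * q t ^ 2 ≤
      energy m c₁ c₂ k α₁ α₂ x₁ q (diffState x₄) (diffState x₄) t := fun t =>
    le_energy hc₁ hc₂ hα₁ hα hα₂ t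
  have hE0 : ∀ t, 0 ≤ energy m c₁ c₂ k α₁ α₂ x₁ q (diffState x₄) (diffState x₄) t := fun t =>
    le_trans (by positivity) (hle t)
  have key := fun t (ht : 0 ≤ t) => gronwall_dissipation
    (E := energy m c₁ c₂ k α₁ α₂ x₁ q (diffState x₄) (diffState x₄))
    (D := dissipation c₁ c₂ α₁ α₂ (diffState x₄) (diffState x₄))
    (g := fun t => M * |slidingVar m c₁ c₂ k x₁ x₂ x₃ x₄ t|) (B := M * B)
    (h.continuousOn_energy hα₁ hα hα₂ hqc) (fun t _ => hE0 t)
    (fun t ht => h.hasDerivAt_energy hm hα₁ hα hα₂ ht (h.hasDerivAt_momentum ht))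
    (h.continuousOn_dissipation hα₁ hα hα₂)
    (fun t _ => dissipation_nonneg hc₁ hc₂ hα₁ hα hα₂ _ _ t)
    (continuousOn_const.mul h.locAC_slidingVar.continuousOn.abs)
    (fun t ht => by
      rw [intervalIntegral.integral_const_mul]
      exact mul_le_mul_of_nonneg_left (hB t ht) hM0)
    (fun t ht => by
      have := h.power_le hm hc₁ hc₂ hk hα₁ hα hα₂ (q := q) ht.le (hS t ht.le)
      rw [hsq]
      linarith) ht
  have h00 := hE0 0
  have hexp := Real.exp_pos (M * B)
  refine ⟨2 * (1 + energy m c₁ c₂ k α₁ α₂ x₁ q (diffState x₄) (diffState x₄) 0) *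
    Real.exp (M * B), by positivity, fun t ht => ?_⟩
  obtain ⟨k1, k2⟩ := key t ht
  have k3 := hle t
  have k4 : 0 ≤ 1 / 2 * k * x₁ t ^ 2 := by positivity
  have k5 : 0 ≤ 1 / 2 * m * q t ^ 2 := by positivity
  exact ⟨by linarith, by linarith, k2⟩

/-- Finite total dissipation makes the diffusive states square integrable in time. -/
lemma exists_integrableOn_diffState_sq {v : ℝ → ℝ} (hv : ContinuousOn v (Ici 0)) {β C : ℝ}
    (hβ : 0 < β) (hβ' : β < 1)
    (hC : ∀ t, 0 ≤ t → ∫ τ in (0 : ℝ)..t,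
      (∫ ω in Ioi (0 : ℝ), ω * freqWeight β ω * diffState v ω τ ^ 2) ≤ C) :
    ∃ ω, 0 < ω ∧ IntegrableOn (fun t => diffState v ω t ^ 2) (Ioi 0) := by
  set ν := (volume : Measure ℝ).restrict (Ioi 0) with hν
  let D : ℝ → ℝ := fun t => ∫ ω in Ioi (0 : ℝ), ω * freqWeight β ω * diffState v ω t ^ 2
  have hDc : ContinuousOn D (Ici 0) := continuousOn_integral_mul_sq hv hβ hβ'
  have hD0 : ∀ t, 0 ≤ D t := fun t => integral_mul_sq_nonneg hβ hβ' _
  have hD : Integrable D ν := by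
    refine integrableOn_Ioi_of_intervalIntegral_norm_bounded (l := atTop) (b := id) C 0
      (fun t => ?_) tendsto_id ?_
    · exact (hDc.mono fun r hr => hr.1).integrableOn_Icc.mono_set Ioc_subset_Icc_self
    · filter_upwards [eventually_ge_atTop 0] with t ht
      refine (hC t ht).trans' (le_of_eq ?_)
      exact intervalIntegral.integral_congr fun τ _ => Real.norm_of_nonneg (hD0 τ)
  let F : ℝ × ℝ → ℝ := fun p => p.2 * freqWeight β p.2 * diffState v p.2 p.1 ^ 2
  have hFm : AEStronglyMeasurable F (ν.prod ν) := by
    refine Measurable.aestronglyMeasurable ?_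
    refine (measurable_snd.mul ((measurable_freqWeight β).comp measurable_snd)).mul ?_
    exact (((continuous_diffState hv).comp continuous_swap).pow 2).measurable
  have hF : Integrable F (ν.prod ν) := by
    rw [integrable_prod_iff hFm]
    constructor
    · filter_upwards [ae_restrict_mem measurableSet_Ioi] with t ht
      exact integrableOn_mul_diffState_sq hv hβ hβ' (le_of_lt ht)
    · refine hD.congr (Eventually.of_forall fun t => ?_)
      refine setIntegral_congr_fun measurableSet_Ioi fun ω hω => ?_
      have h1 := freqWeight_pos hβ hβ' hω
      have h2 : 0 < ω := hω
      exact (Real.norm_of_nonneg (by positivity)).symm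
  have hne : (ae ν).NeBot := by
    rw [ae_neBot, hν, Ne, Measure.restrict_eq_zero]
    simp
  -- Exchanging the integrals shows square integrability in time for almost every frequency; a
  -- single one is enough.
  obtain ⟨ω, h1, h2⟩ := (hF.prod_left_ae.and (ae_restrict_mem measurableSet_Ioi)).exists
  have h2 : 0 < ω := h2
  refine ⟨ω, h2, ?_⟩
  have h3 := freqWeight_pos hβ hβ' h2
  refine (h1.const_mul (ω * freqWeight β ω)⁻¹).congr (Eventually.of_forall fun t => ?_)
  simp only [F]
  field_simp

/-- The oscillator comes to rest if the sliding variable is integrable and tends to zero. -/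
theorem FractionalPart.tendsto_zero (h : FractionalPart α₁ α₂ x₁ x₂ x₃ x₄) (hm : 0 < m)
    (hc₁ : 0 < c₁) (hc₂ : 0 < c₂) (hk : 0 < k) (hα₁ : 0 < α₁) (hα : α₁ < α₂) (hα₂ : α₂ < 1)
    {S B : ℝ} (hS : ∀ t, 0 ≤ t → |slidingVar m c₁ c₂ k x₁ x₂ x₃ x₄ t| ≤ S)
    (hB : ∀ t, 0 ≤ t → ∫ τ in (0 : ℝ)..t, |slidingVar m c₁ c₂ k x₁ x₂ x₃ x₄ τ| ≤ B)
    (hs : Tendsto (slidingVar m c₁ c₂ k x₁ x₂ x₃ x₄) atTop (𝓝 0)) : Tendsto x₁ atTop (𝓝 0) := by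
  obtain ⟨C, hC0, hC⟩ := h.exists_energy_le hm hc₁ hc₂ hk hα₁ hα hα₂ hS hB
  set q := momentum m c₁ c₂ k x₁ x₂ x₃ x₄ with hq
  set s := slidingVar m c₁ c₂ k x₁ x₂ x₃ x₄ with hsdef
  have hx4q : ∀ t, x₄ t = q t + s t := fun t => by simp [hq, momentum, hsdef]
  have hc := h.locAC₄.continuousOn
  have hc1 := h.eq₁.locAC.continuousOn
  have hc2 := h.eq₂.locAC.continuousOn
  have hc3 := h.eq₃.locAC.continuousOn
  have hqc : ContinuousOn q (Ici 0) := h.continuousOn_momentum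
  have hsc : ContinuousOn s (Ici 0) := h.locAC_slidingVar.continuousOn
  have hS0 : 0 ≤ S := (abs_nonneg _).trans (hS 0 le_rfl)
  have hβ1 : 0 < 1 - α₁ := by linarith
  have hβ1' : 1 - α₁ < 1 := by linarith
  have hβ2 : 0 < 1 - α₂ := by linarith
  have hβ2' : 1 - α₂ < 1 := by linarith
  -- uniform bounds for the states
  obtain ⟨A, hA0, hA1, hA4⟩ : ∃ A, 0 ≤ A ∧ (∀ t, 0 ≤ t → |x₁ t| ≤ A) ∧
      ∀ t, 0 ≤ t → |x₄ t| ≤ A := by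
    refine ⟨√(C / k) + √(C / m) + S, by positivity, fun t ht => ?_, fun t ht => ?_⟩
    · have h1 : |x₁ t| ≤ √(C / k) := by
        refine Real.abs_le_sqrt ?_
        rw [le_div_iff₀ hk]
        linarith [(hC t ht).1]
      have := Real.sqrt_nonneg (C / m)
      linarith
    · have h1 : |q t| ≤ √(C / m) := by
        refine Real.abs_le_sqrt ?_
        rw [le_div_iff₀ hm]
        linarith [(hC t ht).2.1]
      have := Real.sqrt_nonneg (C / k)
      have := abs_add_le (q t) (s t)
      have := hS t ht
      rw [hx4q]
      linarith
  have hA23 := fun t (ht : 0 ≤ t) => h.abs_le hα₁ hα hα₂ ht (fun τ hτ => hA1 τ hτ.1)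
    (fun τ hτ => hA4 τ hτ.1)
  have hqd : ∀ t, 0 < t → HasDerivAt q (-(k / m * x₁ t + c₁ / m * x₂ t + c₂ / m * x₃ t)) t :=
    fun t ht => h.hasDerivAt_momentum ht
  have hqL : ∀ r t, 0 ≤ r → r ≤ t → |q t - q r| ≤ (k / m * A +
      c₁ / m * (3 * A * majorant (1 - α₁)) + c₂ / m * (3 * A * majorant (1 - α₂))) * (t - r) := by
    intro r t hr hrt
    refine abs_sub_le_of_hasDerivAt hqc hqd (fun t ht => ?_) hr hrt
    obtain ⟨b2, b3⟩ := hA23 t ht.le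
    have b1 := hA1 t ht.le
    rw [abs_neg]
    refine (abs_add_three _ _ _).trans ?_
    rw [abs_mul, abs_mul, abs_mul, abs_of_pos (div_pos hk hm), abs_of_pos (div_pos hc₁ hm),
      abs_of_pos (div_pos hc₂ hm)]
    gcongr
  have hx1d := (h.hasDerivWithinAt hα₁ hα hα₂).2
  have hx1L : ∀ r t, 0 ≤ r → r ≤ t → |x₁ t - x₁ r| ≤ A * (t - r) := fun r t hr hrt =>
    abs_sub_le_of_hasDerivAt hc1 (fun t ht => (hx1d t ht.le).hasDerivAt (Ici_mem_nhds ht))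
      (fun t ht => hA4 t ht.le) hr hrt
  -- some diffusive state tends to zero
  obtain ⟨ω, hω, hzi⟩ := exists_integrableOn_diffState_sq hc hβ1 hβ1' (C := C / c₁) fun t ht => by
    rw [le_div_iff₀ hc₁, mul_comm, ← intervalIntegral.integral_const_mul]
    refine (hC t ht).2.2.trans' ?_
    refine intervalIntegral.integral_mono_on ht ?_ ?_ fun τ _ => ?_
    · exact intervalIntegrable_of_continuousOn_Ici
        (continuousOn_const.mul (continuousOn_integral_mul_sq hc hβ1 hβ1')) le_rfl ht
    · exact intervalIntegrable_of_continuousOn_Ici (h.continuousOn_dissipation hα₁ hα hα₂)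
        le_rfl ht
    · have := mul_nonneg hc₂.le (integral_mul_sq_nonneg hβ2 hβ2' fun ω => diffState x₄ ω τ)
      simp only [dissipation]
      linarith
  have hzd : ∀ t, 0 < t → HasDerivAt (diffState x₄ ω) (-ω * diffState x₄ ω t + x₄ t) t := by
    intro t ht
    have := hasDerivAt_diffState hc ω t
    rwa [max_eq_left ht.le] at this
  have hzb : ∀ t, 0 ≤ t → |diffState x₄ ω t| ≤ A / ω := fun t ht =>
    abs_diffState_le_div hω ht fun τ hτ => hA4 τ hτ.1
  have hzc := continuous_diffState_right hc ω
  have hz2 : Tendsto (fun t => diffState x₄ ω t ^ 2) atTop (𝓝 0) := by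
    -- The Lipschitz constant bounds 2|z||z'|, with |z| ≤ A/ω and |z'| = |-ωz + x₄| ≤ 2A.
    refine tendsto_zero_of_window (L := 2 * (A / ω) * (2 * A)) (hzc.pow 2).continuousOn
      (fun r t hr hrt => ?_) fun d _ => tendsto_window_of_integrableOn hzi d
    refine abs_sub_le_of_hasDerivAt (hzc.pow 2).continuousOn (fun t ht => (hzd t ht).pow 2)
      (fun t ht => ?_) hr hrt
    have b1 := hzb t ht.le
    have b2 : |-ω * diffState x₄ ω t + x₄ t| ≤ 2 * A := by
      refine (abs_add_le _ _).trans ?_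
      rw [abs_mul, abs_neg, abs_of_pos hω]
      have := hA4 t ht.le
      rw [le_div_iff₀ hω] at b1
      linarith
    simp only [Nat.cast_ofNat, Nat.add_one_sub_one, pow_one]
    rw [abs_mul, abs_mul, abs_two]
    gcongr
  have hz : Tendsto (diffState x₄ ω) atTop (𝓝 0) := by
    have := (Real.continuous_sqrt.tendsto 0).comp hz2
    rw [Real.sqrt_zero] at this
    refine (tendsto_zero_iff_abs_tendsto_zero _).2 (this.congr fun t => ?_)
    simp [Real.sqrt_sq_eq_abs]
  -- the velocity tends to zero
  have hq0 : Tendsto q atTop (𝓝 0) := by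
    -- Integrating z' = -ωz + q + s over a window expresses ∫q through z and s, which both tend to
    -- zero. Barbalat's lemma is applied to q rather than x₄, because only q is known to be
    -- Lipschitz here.
    refine tendsto_zero_of_window hqc hqL fun d hd => ?_
    have l1 : Tendsto (fun t => diffState x₄ ω (t + d) - diffState x₄ ω t) atTop (𝓝 0) := by
      have := (hz.comp (tendsto_atTop_add_const_right atTop d tendsto_id)).sub hz
      simpa using this
    have l2 := (tendsto_window_of_tendsto hz hd).const_mul ω
    have l3 := tendsto_window_of_tendsto hs hd
    have l := (l1.add l2).sub l3
    simp only [mul_zero, add_zero, sub_zero] at l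
    refine l.congr' ?_
    filter_upwards [eventually_gt_atTop 0] with t ht
    have htd : 0 ≤ t + d := by linarith
    have iz : IntervalIntegrable (diffState x₄ ω) volume t (t + d) := hzc.intervalIntegrable _ _
    have is := intervalIntegrable_of_continuousOn_Ici hsc ht.le htd
    have iq := intervalIntegrable_of_continuousOn_Ici hqc ht.le htd
    have ix := intervalIntegrable_of_continuousOn_Ici hc ht.le htd
    have e : ∫ τ in t..(t + d), (-ω * diffState x₄ ω τ + x₄ τ) =
        diffState x₄ ω (t + d) - diffState x₄ ω t := by
      refine intervalIntegral.integral_eq_sub_of_hasDerivAt (fun τ hτ => hzd τ ?_)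
        ((iz.const_mul _).add ix)
      rw [uIcc_of_le (by linarith)] at hτ
      exact ht.trans_le hτ.1
    rw [← e, intervalIntegral.integral_add (iz.const_mul _) ix, intervalIntegral.integral_const_mul]
    simp_rw [hx4q]
    rw [intervalIntegral.integral_add iq is]
    ring
  have hx40 : Tendsto x₄ atTop (𝓝 0) := by
    have := hq0.add hs
    rw [add_zero] at this
    exact this.congr fun t => (hx4q t).symm
  -- the fractional states tend to zero
  have hfrac : ∀ β, 0 < β → β < 1 →
      Tendsto (fun t => ∫ ω in Ioi (0 : ℝ), freqWeight β ω * diffState x₄ ω t) atTop (𝓝 0) := by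
    intro β hβ hβ'
    have := tendsto_integral_filter_of_dominated_convergence (l := atTop)
      (μ := volume.restrict (Ioi (0 : ℝ)))
      (F := fun t ω => freqWeight β ω * diffState x₄ ω t) (f := fun _ => (0 : ℝ))
      (fun ω => 3 * A * (freqWeight β ω * decay ω)) ?_ ?_
      ((integrableOn_freqWeight_mul_decay hβ hβ').const_mul _) ?_
    · simpa using this
    · exact Eventually.of_forall fun t => ((measurable_freqWeight β).mul
        (continuous_diffState_left hc t).measurable).aestronglyMeasurable
    · filter_upwards [eventually_ge_atTop 0] with t ht
      filter_upwards [ae_restrict_mem measurableSet_Ioi] with ω hω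
      exact norm_freqWeight_mul_le (ζ := fun ω => diffState x₄ ω t) hβ hβ' (fun ω hω =>
        abs_diffState_le_decay hc hx1d hω ht (fun τ hτ => hA1 τ hτ.1) fun τ hτ => hA4 τ hτ.1) hω
    · filter_upwards [ae_restrict_mem measurableSet_Ioi] with ω hω
      simpa using (tendsto_diffState hc hx40 hω).const_mul (freqWeight β ω)
  have hx20 : Tendsto x₂ atTop (𝓝 0) := by
    refine (hfrac _ hβ1 hβ1').congr' ?_
    filter_upwards [eventually_ge_atTop 0] with t ht using (h.eq_integral hα₁ hα hα₂ ht).1.symm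
  have hx30 : Tendsto x₃ atTop (𝓝 0) := by
    refine (hfrac _ hβ2 hβ2').congr' ?_
    filter_upwards [eventually_ge_atTop 0] with t ht using (h.eq_integral hα₁ hα hα₂ ht).2.symm
  -- the position tends to zero
  refine tendsto_zero_of_window hc1 hx1L fun d hd => ?_
  -- The same device for the position: integrating the equation for q' over a window expresses ∫x₁
  -- through the increment of q and the window integrals of x₂ and x₃.
  have l1 : Tendsto (fun t => q (t + d) - q t) atTop (𝓝 0) := by
    have := (hq0.comp (tendsto_atTop_add_const_right atTop d tendsto_id)).sub hq0
    simpa using this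
  have l2 := (tendsto_window_of_tendsto hx20 hd).const_mul (c₁ / m)
  have l3 := (tendsto_window_of_tendsto hx30 hd).const_mul (c₂ / m)
  have l := (((l1.add l2).add l3).neg).const_mul (m / k)
  simp only [mul_zero, add_zero, neg_zero] at l
  refine l.congr' ?_
  filter_upwards [eventually_gt_atTop 0] with t ht
  have htd : 0 ≤ t + d := by linarith
  have i1 := (intervalIntegrable_of_continuousOn_Ici hc1 ht.le htd).const_mul (k / m)
  have i2 := (intervalIntegrable_of_continuousOn_Ici hc2 ht.le htd).const_mul (c₁ / m)
  have i3 := (intervalIntegrable_of_continuousOn_Ici hc3 ht.le htd).const_mul (c₂ / m)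
  have e : ∫ τ in t..(t + d), -(k / m * x₁ τ + c₁ / m * x₂ τ + c₂ / m * x₃ τ) =
      q (t + d) - q t := by
    refine intervalIntegral.integral_eq_sub_of_hasDerivAt (fun τ hτ => hqd τ ?_)
      ((i1.add i2).add i3).neg
    rw [uIcc_of_le (by linarith)] at hτ
    exact ht.trans_le hτ.1
  rw [← e, intervalIntegral.integral_neg, intervalIntegral.integral_add (i1.add i2) i3,
    intervalIntegral.integral_add i1 i2, intervalIntegral.integral_const_mul,
    intervalIntegral.integral_const_mul, intervalIntegral.integral_const_mul]
  field_simp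
  ring

end Asymptotics

/-! ### The switching laws -/

lemma locAC_of_hasDerivWithinAt {x v : ℝ → ℝ} (hv : ContinuousOn v (Ici 0))
    (hx : ∀ t, 0 ≤ t → HasDerivWithinAt x (v t) (Ici 0) t) : LocAC x := by
  refine locAC_of_integral (g := v)
    (fun t ht => intervalIntegrable_of_continuousOn_Ici hv le_rfl ht) fun t ht => ?_
  rw [intervalIntegral.integral_eq_sub_of_hasDerivAt_of_le ht
    (fun s hs => (hx s hs.1).continuousWithinAt.mono fun _ h => h.1)
    (fun s hs => (hx s hs.1.le).hasDerivAt (Ici_mem_nhds hs.1))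
    (intervalIntegrable_of_continuousOn_Ici hv le_rfl ht)]
  ring

/-- A Lyapunov function `s²/2 + Φ` with decay rate `a |s|`. -/
lemma lyapunov_le {s σ Φ φ : ℝ → ℝ} {a : ℝ} (ha : 0 < a) (hs : LocAC s) (hΦ : LocAC Φ)
    (hΦ0 : ∀ t, 0 ≤ t → 0 ≤ Φ t)
    (hsd : ∀ᵐ t, 0 < t → HasDerivAt s (σ t) t) (hΦd : ∀ᵐ t, 0 < t → HasDerivAt Φ (φ t) t)
    (h : ∀ᵐ t, 0 < t → s t * σ t + φ t ≤ -a * |s t|) {t : ℝ} (ht : 0 ≤ t) :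
    s t ^ 2 ≤ 2 * (1 / 2 * s 0 ^ 2 + Φ 0) ∧ Φ t ≤ 1 / 2 * s 0 ^ 2 + Φ 0 ∧
      ∫ τ in (0 : ℝ)..t, |s τ| ≤ (1 / 2 * s 0 ^ 2 + Φ 0) / a := by
  have hsc := hs.continuousOn.abs
  let H : ℝ → ℝ := fun t => 1 / 2 * (s t * s t) + Φ t + a * ∫ τ in (0 : ℝ)..t, |s τ|
  have hH : LocAC H := by
    intro T hT
    exact ((((hs T hT).fun_mul (hs T hT)).const_mul (1 / 2)).fun_add (hΦ T hT)).fun_add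
      (AbsolutelyContinuousOnInterval.const_mul a
      ((intervalIntegrable_of_continuousOn_Ici hsc le_rfl
        hT.le).absolutelyContinuousOnInterval_intervalIntegral left_mem_uIcc))
  have hHt : H t ≤ H 0 := by
    rw [← sub_nonpos, ← hH.integral_deriv le_rfl ht, intervalIntegral.integral_of_le ht]
    refine setIntegral_nonpos_of_ae_restrict ?_
    rw [EventuallyLE, ae_restrict_iff' measurableSet_Ioc]
    filter_upwards [hsd, hΦd, h] with r h1 h2 h3 hr
    have hd := (((((h1 hr.1).fun_mul (h1 hr.1)).const_mul (1 / 2)).fun_add (h2 hr.1)).fun_add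
      ((hasDerivAt_integral_of_continuousOn hsc hr.1).const_mul a)).deriv
    have h3 := h3 hr.1
    change deriv H r ≤ 0
    rw [show deriv H r = _ from hd]
    linarith
  simp only [H, intervalIntegral.integral_same, mul_zero, add_zero] at hHt
  have hi : 0 ≤ ∫ τ in (0 : ℝ)..t, |s τ| :=
    intervalIntegral.integral_nonneg ht fun τ _ => abs_nonneg _
  have h1 := hΦ0 t ht
  have h2 := mul_nonneg ha.le hi
  have h3 := mul_self_nonneg (s t)
  refine ⟨by linarith, by linarith, ?_⟩
  rw [le_div_iff₀ ha]
  linarith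

lemma LocAC.abs_sub_le {f f' : ℝ → ℝ} {L : ℝ} (hf : LocAC f)
    (hd : ∀ᵐ t, 0 < t → HasDerivAt f (f' t) t) (hL : ∀ᵐ t, 0 < t → |f' t| ≤ L) {r t : ℝ}
    (hr : 0 ≤ r) (hrt : r ≤ t) : |f t - f r| ≤ L * (t - r) := by
  rw [← hf.integral_deriv hr (hr.trans hrt), ← abs_of_nonneg (sub_nonneg.2 hrt),
    ← Real.norm_eq_abs]
  refine intervalIntegral.norm_integral_le_of_norm_le_const_ae ?_
  rw [uIoc_of_le hrt]
  filter_upwards [hd, hL] with τ h1 h2 hτ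
  have h0 : 0 < τ := hr.trans_lt hτ.1
  rw [(h1 h0).deriv, Real.norm_eq_abs]
  exact h2 h0

/-- A Lipschitz function with finite integral of its modulus tends to zero. -/
lemma tendsto_zero_of_integral_abs_le {s : ℝ → ℝ} {L B : ℝ} (hs : ContinuousOn s (Ici 0))
    (hL : ∀ r t, 0 ≤ r → r ≤ t → |s t - s r| ≤ L * (t - r))
    (hB : ∀ t, 0 ≤ t → ∫ τ in (0 : ℝ)..t, |s τ| ≤ B) : Tendsto s atTop (𝓝 0) := by
  refine tendsto_zero_of_window hs hL fun d _ => tendsto_window_of_integrableOn ?_ d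
  refine integrableOn_Ioi_of_intervalIntegral_norm_bounded (l := atTop) (b := id) B 0
    (fun t => ?_) tendsto_id ?_
  · exact (hs.mono fun r hr => hr.1).integrableOn_Icc.mono_set Ioc_subset_Icc_self
  · filter_upwards [eventually_ge_atTop 0] with t ht using hB t ht

/-- The Filippov value selected at 0 is multiplied by 0, so the power estimate does not depend on
the selection. -/
lemma mul_eq_abs_of_mem_signSet {r σ : ℝ} (h : σ ∈ signSet r) : r * σ = |r| := by
  rcases lt_trichotomy r 0 with hr | hr | hr
  · rw [h.2.2 hr, abs_of_neg hr, mul_neg_one]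
  · simp [hr]
  · rw [h.2.1 hr, abs_of_pos hr, mul_one]

lemma switching_power_le {f F K ρ s σ : ℝ} (hf : |f| ≤ F) (hσ : σ ∈ signSet s) :
    s * (f + (-K * σ - ρ * s)) ≤ (F - K) * |s| - ρ * s ^ 2 := by
  have h1 := mul_eq_abs_of_mem_signSet hσ
  have h2 : s * f ≤ F * |s| := by
    calc s * f ≤ |s * f| := le_abs_self _
      _ = |f| * |s| := by rw [abs_mul, mul_comm]
      _ ≤ F * |s| := by gcongr
  calc s * (f + (-K * σ - ρ * s)) = s * f - K * (s * σ) - ρ * s ^ 2 := by ring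
    _ ≤ _ := by rw [h1]; linarith

lemma abs_switching_le {f F K ρ s σ : ℝ} (hρ : 0 < ρ) (hf : |f| ≤ F) (hσ : σ ∈ signSet s) :
    |f + (-K * σ - ρ * s)| ≤ F + |K| + ρ * |s| := by
  have h1 : |-K * σ| ≤ |K| := by
    rw [abs_mul, abs_neg]
    exact mul_le_of_le_one_right (abs_nonneg _) (abs_le.2 hσ.1)
  have h2 := abs_add_le f (-K * σ - ρ * s)
  have h3 := abs_sub (-K * σ) (ρ * s)
  rw [abs_mul ρ, abs_of_pos hρ] at h3
  linarith

section Switching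

variable {m c₁ c₂ k α₁ α₂ : ℝ} {f u x₁ x₂ x₃ x₄ : ℝ → ℝ}

/-- Convergence of the sliding variable and of the position, from a Lyapunov function. -/
lemma IsStateTrajectory.tendsto_of_lyapunov
    (h : IsStateTrajectory m c₁ c₂ k α₁ α₂ f u x₁ x₂ x₃ x₄) (hm : 0 < m)
    (hc₁ : 0 < c₁) (hc₂ : 0 < c₂) (hk : 0 < k) (hα₁ : 0 < α₁) (hα : α₁ < α₂) (hα₂ : α₂ < 1)
    {Φ φ : ℝ → ℝ} {a : ℝ} (ha : 0 < a) (hΦ : LocAC Φ) (hΦ0 : ∀ t, 0 ≤ t → 0 ≤ Φ t)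
    (hΦd : ∀ᵐ t, 0 < t → HasDerivAt Φ (φ t) t)
    (hle : ∀ᵐ t, 0 < t → slidingVar m c₁ c₂ k x₁ x₂ x₃ x₄ t * ((f t + u t) / m) + φ t ≤
      -a * |slidingVar m c₁ c₂ k x₁ x₂ x₃ x₄ t|)
    (hb : ∀ S P, (∀ t, 0 ≤ t → |slidingVar m c₁ c₂ k x₁ x₂ x₃ x₄ t| ≤ S) →
      (∀ t, 0 ≤ t → Φ t ≤ P) → ∃ L, ∀ᵐ t, 0 < t → |(f t + u t) / m| ≤ L) :
    Tendsto (slidingVar m c₁ c₂ k x₁ x₂ x₃ x₄) atTop (𝓝 0) ∧ Tendsto x₁ atTop (𝓝 0) := by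
  set s := slidingVar m c₁ c₂ k x₁ x₂ x₃ x₄ with hs
  have hac : LocAC s := h.frac.locAC_slidingVar
  have hsd : ∀ᵐ t, 0 < t → HasDerivAt s ((f t + u t) / m) t :=
    (ae_restrict_iff' measurableSet_Ioi).1 h.ae_hasDerivAt_slidingVar
  have hlyap := fun t (ht : 0 ≤ t) => lyapunov_le ha hac hΦ hΦ0 hsd hΦd hle ht
  have hS : ∀ t, 0 ≤ t → |s t| ≤ √(2 * (1 / 2 * s 0 ^ 2 + Φ 0)) := fun t ht =>
    Real.abs_le_sqrt (hlyap t ht).1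
  -- The Lipschitz constant of `s` is available only now: the control is bounded in terms of the
  -- bounds on `s` and on Φ that the Lyapunov estimate has just supplied.
  obtain ⟨L, hL⟩ := hb _ _ hS fun t ht => (hlyap t ht).2.1
  have hB := fun t ht => (hlyap t ht).2.2
  have hs0 := tendsto_zero_of_integral_abs_le hac.continuousOn
    (fun r t hr hrt => hac.abs_sub_le hsd hL hr hrt) hB
  exact ⟨hs0, h.frac.tendsto_zero hm hc₁ hc₂ hk hα₁ hα hα₂ hS hB hs0⟩

lemma FollowsSwitchingLaw.ae {K s u : ℝ → ℝ} {ρ : ℝ} (h : FollowsSwitchingLaw K ρ s u) :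
    ∀ᵐ t, 0 < t → ∃ σ ∈ signSet (s t), u t = -K t * σ - ρ * s t :=
  (ae_restrict_iff' measurableSet_Ioi).1 h

/-- The switching law with a known force bound. -/
theorem IsStateTrajectory.switching
    (h : IsStateTrajectory m c₁ c₂ k α₁ α₂ f u x₁ x₂ x₃ x₄) (hm : 0 < m)
    (hc₁ : 0 < c₁) (hc₂ : 0 < c₂) (hk : 0 < k) (hα₁ : 0 < α₁) (hα : α₁ < α₂) (hα₂ : α₂ < 1)
    {F ρ₁ ρ₂ : ℝ} (hρ₁ : 0 < ρ₁) (hρ₂ : 0 < ρ₂) (hf : ∀ t : ℝ, 0 ≤ t → |f t| ≤ F)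
    (hu : FollowsSwitchingLaw (fun _ => F + ρ₁ / √2) ρ₂
      (slidingVar m c₁ c₂ k x₁ x₂ x₃ x₄) u) :
    (∀ᵐ t ∂(volume.restrict (Ioi (0 : ℝ))), ∃ d : ℝ,
      HasDerivAt (fun r => 1 / 2 * slidingVar m c₁ c₂ k x₁ x₂ x₃ x₄ r ^ 2) d t ∧
      d ≤ -(ρ₁ / m) * √(1 / 2 * slidingVar m c₁ c₂ k x₁ x₂ x₃ x₄ t ^ 2)
        - 2 * ρ₂ / m * (1 / 2 * slidingVar m c₁ c₂ k x₁ x₂ x₃ x₄ t ^ 2)) ∧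
    Tendsto (slidingVar m c₁ c₂ k x₁ x₂ x₃ x₄) atTop (𝓝 0) ∧
    Tendsto x₁ atTop (𝓝 0) := by
  set s := slidingVar m c₁ c₂ k x₁ x₂ x₃ x₄ with hs
  have h2 : 0 < √2 := by positivity
  have hpow : ∀ᵐ t, 0 < t →
      s t * ((f t + u t) / m) ≤ -(ρ₁ / (√2 * m)) * |s t| - ρ₂ / m * s t ^ 2 := by
    filter_upwards [hu.ae] with t hut ht
    obtain ⟨σ, hσ, hut⟩ := hut ht
    have := switching_power_le (K := F + ρ₁ / √2) (ρ := ρ₂) (hf t ht.le) hσ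
    rw [← hut, sub_add_cancel_left] at this
    rw [← mul_div_assoc, div_le_iff₀ hm]
    refine this.trans (le_of_eq ?_)
    field_simp
  -- The gain exceeds the force bound by ρ₁/√2, and division by m gives the rate; no auxiliary term
  -- Φ is needed.
  refine ⟨?_, h.tendsto_of_lyapunov hm hc₁ hc₂ hk hα₁ hα hα₂ (Φ := fun _ => 0) (φ := fun _ => 0)
    (a := ρ₁ / (√2 * m)) (by positivity) ?_ (fun _ _ => le_rfl) ?_ ?_ ?_⟩
  · filter_upwards [h.ae_hasDerivAt_slidingVar, (ae_restrict_iff' measurableSet_Ioi).2 hpow]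
      with t h3 h4
    refine ⟨_, (h3.pow 2).const_mul (1 / 2), ?_⟩
    have h5 : √(1 / 2 * s t ^ 2) = |s t| / √2 := by
      rw [one_div_mul_eq_div, Real.sqrt_div (sq_nonneg _), Real.sqrt_sq_eq_abs]
    rw [h5]
    calc _ = s t * ((f t + u t) / m) := by ring
      _ ≤ _ := h4
      _ = _ := by field_simp
  · exact fun T _ => (LipschitzWith.const (0 : ℝ)).lipschitzOnWith.absolutelyContinuousOnInterval
  · exact Eventually.of_forall fun t _ => hasDerivAt_const t 0
  · filter_upwards [hpow] with t h3 ht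
    have : 0 ≤ ρ₂ / m * s t ^ 2 := by positivity
    linarith [h3 ht]
  · intro S P hS _
    refine ⟨(F + |F + ρ₁ / √2| + ρ₂ * S) / m, ?_⟩
    filter_upwards [hu.ae] with t hut ht
    obtain ⟨σ, hσ, hut⟩ := hut ht
    have := abs_switching_le (K := F + ρ₁ / √2) hρ₂ (hf t ht.le) hσ
    have := hS t ht.le
    rw [hut, abs_div, abs_of_pos hm]
    gcongr
    refine le_trans ‹_› ?_
    gcongr

/-- The adaptive switching law. -/
theorem IsStateTrajectory.adaptive_switching
    (h : IsStateTrajectory m c₁ c₂ k α₁ α₂ f u x₁ x₂ x₃ x₄) (hm : 0 < m)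
    (hc₁ : 0 < c₁) (hc₂ : 0 < c₂) (hk : 0 < k) (hα₁ : 0 < α₁) (hα : α₁ < α₂) (hα₂ : α₂ < 1)
    {F ρ₁ ρ₂ μ : ℝ} {Fhat : ℝ → ℝ} (hρ₁ : 0 < ρ₁) (hρ₂ : 0 < ρ₂) (hμ : 0 < μ)
    (hf : ∀ t : ℝ, 0 ≤ t → |f t| ≤ F)
    (hu : FollowsSwitchingLaw (fun t => Fhat t + ρ₁ / √2) ρ₂
      (slidingVar m c₁ c₂ k x₁ x₂ x₃ x₄) u)
    (hF : FollowsAdaptiveLaw m μ (slidingVar m c₁ c₂ k x₁ x₂ x₃ x₄) Fhat) :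
    Tendsto (slidingVar m c₁ c₂ k x₁ x₂ x₃ x₄) atTop (𝓝 0) ∧
    Tendsto x₁ atTop (𝓝 0) := by
  set s := slidingVar m c₁ c₂ k x₁ x₂ x₃ x₄ with hs
  have h2 : 0 < √2 := by positivity
  have hac : LocAC s := h.frac.locAC_slidingVar
  have hFc : ContinuousOn Fhat (Ici 0) := fun t ht => (hF t ht).continuousWithinAt
  have hΦd : ∀ t, 0 ≤ t → HasDerivWithinAt (fun t => (Fhat t - F) ^ 2 / (2 * μ))
      ((Fhat t - F) * |s t| / m) (Ici 0) t := fun t ht => by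
    refine ((((hF t ht).sub_const F).pow 2).div_const (2 * μ)).congr_deriv ?_
    simp only [Nat.cast_ofNat, Nat.add_one_sub_one, pow_one]
    field_simp
  -- The adaptive law makes Φ' = (F̂ - F)|s|/m, which cancels the mismatch (F - F̂)|s|/m between
  -- force bound and gain. The true bound F occurs only in this Lyapunov function, and the bound on
  -- Φ in turn bounds the adaptive gain.
  refine h.tendsto_of_lyapunov hm hc₁ hc₂ hk hα₁ hα hα₂ (Φ := fun t => (Fhat t - F) ^ 2 / (2 * μ))
    (φ := fun t => (Fhat t - F) * |s t| / m)
    (a := ρ₁ / (√2 * m)) (by positivity) ?_ (fun _ _ => by positivity) ?_ ?_ ?_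
  · refine locAC_of_hasDerivWithinAt ?_ hΦd
    exact ((hFc.sub continuousOn_const).mul hac.continuousOn.abs).div_const m
  · exact Eventually.of_forall fun t ht => (hΦd t ht.le).hasDerivAt (Ici_mem_nhds ht)
  · filter_upwards [hu.ae] with t hut ht
    obtain ⟨σ, hσ, hut⟩ := hut ht
    have := switching_power_le (K := Fhat t + ρ₁ / √2) (ρ := ρ₂) (hf t ht.le) hσ
    rw [← hut] at this
    rw [← hs, ← mul_div_assoc, ← add_div, div_le_iff₀ hm]
    have e : -(ρ₁ / (√2 * m)) * |s t| * m = -(ρ₁ / √2) * |s t| := by field_simp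
    have : 0 ≤ ρ₂ * s t ^ 2 := by positivity
    rw [e]
    linarith
  · intro S P hS hP
    refine ⟨(F + (√(P * (2 * μ)) + |F| + ρ₁ / √2) + ρ₂ * S) / m, ?_⟩
    filter_upwards [hu.ae] with t hut ht
    obtain ⟨σ, hσ, hut⟩ := hut ht
    have h3 := abs_switching_le (K := Fhat t + ρ₁ / √2) hρ₂ (hf t ht.le) hσ
    have h4 := hS t ht.le
    have h5 := hP t ht.le
    rw [div_le_iff₀ (by positivity)] at h5
    have h6 := Real.abs_le_sqrt h5
    have h7 : |Fhat t + ρ₁ / √2| ≤ √(P * (2 * μ)) + |F| + ρ₁ / √2 := by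
      have e : Fhat t + ρ₁ / √2 = (Fhat t - F) + F + ρ₁ / √2 := by ring
      rw [e]
      refine (abs_add_three _ _ _).trans ?_
      rw [abs_of_pos (div_pos hρ₁ h2)]
      gcongr
    rw [hut, abs_div, abs_of_pos hm]
    gcongr
    refine h3.trans ?_
    gcongr

end Switching

end FracOsc

end

theorem mainTheorem4 (m c₁ c₂ k α₁ α₂ : ℝ) (hm : 0 < m) (hc₁ : 0 < c₁) (hc₂ : 0 < c₂)
    (hk : 0 < k) (hα₁ : 0 < α₁) (hα : α₁ < α₂) (hα₂ : α₂ < 1) :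
    -- the equation of motion is the four-dimensional fractional state equation
    (∀ f u x₁ x₂ x₃ x₄ : ℝ → ℝ,
      FracOsc.IsStateTrajectory m c₁ c₂ k α₁ α₂ f u x₁ x₂ x₃ x₄ ↔
        FracOsc.IsMotion m c₁ c₂ k α₁ α₂ f u x₁ ∧
          ∀ t : ℝ, 0 ≤ t → x₂ t = FracOsc.caputo α₁ x₁ t ∧ x₃ t = FracOsc.caputo α₂ x₁ t ∧
            x₄ t = FracOsc.velocity x₁ t) ∧
    -- the sliding variable: its derivative, and the dynamics obtained from `ds/dt = 0`
    (∀ f u x₁ x₂ x₃ x₄ : ℝ → ℝ,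
      FracOsc.IsStateTrajectory m c₁ c₂ k α₁ α₂ f u x₁ x₂ x₃ x₄ →
        (∀ᵐ t ∂(volume.restrict (Ioi (0 : ℝ))),
          HasDerivAt (FracOsc.slidingVar m c₁ c₂ k x₁ x₂ x₃ x₄) ((f t + u t) / m) t) ∧
        ((∀ t : ℝ, 0 ≤ t → FracOsc.slidingVar m c₁ c₂ k x₁ x₂ x₃ x₄ t =
            FracOsc.slidingVar m c₁ c₂ k x₁ x₂ x₃ x₄ 0) ↔
          FracOsc.IsSlidingTrajectory m c₁ c₂ k α₁ α₂ x₁ x₂ x₃ x₄)) ∧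
    -- the diffusive states and the energy during sliding
    (∀ (T : ℝ) (f u x₁ x₂ x₃ x₄ : ℝ → ℝ), 0 ≤ T →
      FracOsc.IsStateTrajectory m c₁ c₂ k α₁ α₂ f u x₁ x₂ x₃ x₄ →
      (∀ t : ℝ, T ≤ t → FracOsc.slidingVar m c₁ c₂ k x₁ x₂ x₃ x₄ t =
        FracOsc.slidingVar m c₁ c₂ k x₁ x₂ x₃ x₄ T) →
      (∃ z : ℝ → ℝ → ℝ, FracOsc.IsDiffusiveState (FracOsc.velocity x₁) z) ∧
      ∀ z₁ z₂ : ℝ → ℝ → ℝ, FracOsc.IsDiffusiveState (FracOsc.velocity x₁) z₁ →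
        FracOsc.IsDiffusiveState (FracOsc.velocity x₁) z₂ →
        (∀ t : ℝ, 0 ≤ t →
          IntegrableOn (fun ω => FracOsc.freqWeight (1 - α₁) ω * z₁ ω t) (Ioi 0) ∧
          x₂ t = ∫ ω in Ioi (0 : ℝ), FracOsc.freqWeight (1 - α₁) ω * z₁ ω t) ∧
        (∀ t : ℝ, 0 ≤ t →
          IntegrableOn (fun ω => FracOsc.freqWeight (1 - α₂) ω * z₂ ω t) (Ioi 0) ∧
          x₃ t = ∫ ω in Ioi (0 : ℝ), FracOsc.freqWeight (1 - α₂) ω * z₂ ω t) ∧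
        (∀ t : ℝ, 0 ≤ t →
          IntegrableOn (fun ω => FracOsc.freqWeight (1 - α₁) ω * z₁ ω t ^ 2) (Ioi 0) ∧
          IntegrableOn (fun ω => FracOsc.freqWeight (1 - α₂) ω * z₂ ω t ^ 2) (Ioi 0) ∧
          IntegrableOn (fun ω => ω * FracOsc.freqWeight (1 - α₁) ω * z₁ ω t ^ 2) (Ioi 0) ∧
          IntegrableOn (fun ω => ω * FracOsc.freqWeight (1 - α₂) ω * z₂ ω t ^ 2) (Ioi 0)) ∧
        (∀ t : ℝ, T < t →
          HasDerivAt (FracOsc.energy m c₁ c₂ k α₁ α₂ x₁ x₄ z₁ z₂)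
            (-FracOsc.dissipation c₁ c₂ α₁ α₂ z₁ z₂ t) t ∧
          -FracOsc.dissipation c₁ c₂ α₁ α₂ z₁ z₂ t ≤ 0 ∧
          (-FracOsc.dissipation c₁ c₂ α₁ α₂ z₁ z₂ t < 0 ∨
            ∀ τ ∈ Icc 0 t, x₁ τ = 0 ∧ x₂ τ = 0 ∧ x₃ τ = 0 ∧ x₄ τ = 0))) ∧
    -- stability of the sliding dynamics
    FracOsc.SlidingStable m c₁ c₂ k α₁ α₂ ∧
    -- the switching law with a known force bound
    (∀ (F ρ₁ ρ₂ : ℝ) (f u x₁ x₂ x₃ x₄ : ℝ → ℝ), 0 < ρ₁ → 0 < ρ₂ →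
      (∀ t : ℝ, 0 ≤ t → |f t| ≤ F) →
      FracOsc.IsStateTrajectory m c₁ c₂ k α₁ α₂ f u x₁ x₂ x₃ x₄ →
      FracOsc.FollowsSwitchingLaw (fun _ => F + ρ₁ / √2) ρ₂
        (FracOsc.slidingVar m c₁ c₂ k x₁ x₂ x₃ x₄) u →
      (∀ᵐ t ∂(volume.restrict (Ioi (0 : ℝ))), ∃ d : ℝ,
        HasDerivAt (fun r => 1 / 2 * FracOsc.slidingVar m c₁ c₂ k x₁ x₂ x₃ x₄ r ^ 2) d t ∧
        d ≤ -(ρ₁ / m) * √(1 / 2 * FracOsc.slidingVar m c₁ c₂ k x₁ x₂ x₃ x₄ t ^ 2)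
          - 2 * ρ₂ / m * (1 / 2 * FracOsc.slidingVar m c₁ c₂ k x₁ x₂ x₃ x₄ t ^ 2)) ∧
      Tendsto (FracOsc.slidingVar m c₁ c₂ k x₁ x₂ x₃ x₄) atTop (𝓝 0) ∧
      Tendsto x₁ atTop (𝓝 0)) ∧
    -- the adaptive law, the force bound being unknown to the controller
    (∀ (ρ₁ ρ₂ μ : ℝ) (f u Fhat x₁ x₂ x₃ x₄ : ℝ → ℝ), 0 < ρ₁ → 0 < ρ₂ → 0 < μ →
      (∃ F : ℝ, ∀ t : ℝ, 0 ≤ t → |f t| ≤ F) →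
      FracOsc.IsStateTrajectory m c₁ c₂ k α₁ α₂ f u x₁ x₂ x₃ x₄ →
      FracOsc.FollowsSwitchingLaw (fun t => Fhat t + ρ₁ / √2) ρ₂
        (FracOsc.slidingVar m c₁ c₂ k x₁ x₂ x₃ x₄) u →
      FracOsc.FollowsAdaptiveLaw m μ (FracOsc.slidingVar m c₁ c₂ k x₁ x₂ x₃ x₄) Fhat →
      Tendsto (FracOsc.slidingVar m c₁ c₂ k x₁ x₂ x₃ x₄) atTop (𝓝 0) ∧
      Tendsto x₁ atTop (𝓝 0)) := by
  refine ⟨fun f u x₁ x₂ x₃ x₄ =>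
      FracOsc.isStateTrajectory_iff_isMotion hm hα₁ hα hα₂ f u x₁ x₂ x₃ x₄,
    fun f u x₁ x₂ x₃ x₄ h => ⟨h.ae_hasDerivAt_slidingVar, h.slidingVar_eq_iff⟩,
    fun T f u x₁ x₂ x₃ x₄ hT h hs => h.diffusive_energy hm hc₁ hc₂ hk hα₁ hα hα₂ hT hs,
    FracOsc.slidingStable hm hc₁ hc₂ hk hα₁ hα hα₂,
    fun F ρ₁ ρ₂ f u x₁ x₂ x₃ x₄ hρ₁ hρ₂ hf h hu =>
      h.switching hm hc₁ hc₂ hk hα₁ hα hα₂ hρ₁ hρ₂ hf hu,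
    fun ρ₁ ρ₂ μ f u Fhat x₁ x₂ x₃ x₄ hρ₁ hρ₂ hμ hf h hu hF => ?_⟩
  obtain ⟨F, hf⟩ := hf
  exact h.adaptive_switching hm hc₁ hc₂ hk hα₁ hα hα₂ hρ₁ hρ₂ hμ hf hu hF
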